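/- If $X$ is a Hausdorff space, $B\le\mathrm{Homeo}(X)$ and $f\in\mathrm{Homeo}(X)$, let $\mathrm{sing}_B(f)$ be the set of points $p\in X$ such that $f$ does not agree with any element of $B$ on any neighborhood of $p$. Let $T$ be Thompson's group of all piecewise-linear homeomorphisms of the circle $S^1=\mathbb{R}/\mathbb{Z}$ with finitely many breakpoints, all of them dyadic, whose linear segments all have the form $t\mapsto 2^nt+b$ with $n\in\mathbb{Z}$ and $b\in\mathbb{Z}[\tfrac12]$. Let $T\mathcal{A}$ be the group of all $f\in\mathrm{Homeo}(S^1)$ such that 1. $\mathrm{sing}_T(f)$ is a finite set of dyadic points, and 2. if $p\in\mathrm{sing}_T(f)$, then $L_{f(p)}\circ f$ agrees with $f\circ L_p$ in some neighborhood of $p$, where $L_q$ denotes the linear map near $q$ that fixes $q$ and has slope $2$. Let $V$ be Thompson's group of all homeomorphisms $f$ of the Cantor set $\mathfrak{C}_2=\{0,1\}^\omega$ such that for every $p\in\mathfrak{C}_2$ there are finite prefixes $\alpha,\beta$ of $p$ and $f(p)$, respectively, such that $f$ agrees with the prefix replacement $\alpha\psi\mapsto\beta\psi$ in a neighborhood of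 $p$. Let $V\mathcal{A}$ be the group of all $f\in\mathrm{Homeo}(\mathfrak{C}_2)$ such that 1. $\mathrm{sing}_V(f)$ is finite, and each of its points ends in $\overline{0}=000\cdots$ or $\overline{1}=111\cdots$, and 2. if $p\in\mathrm{sing}_V(f)$, then there is a neighborhood of $p$ on which $f$ preserves the lexicographic order and $L_{f(p)}\circ f$ agrees with $f\circ L_p$; here, for a point $q=\alpha\overline{c}$ with $c\in\{0,1\}$, $L_q$ denotes the prefix replacement $\alpha c\psi\mapsto\alpha\psi$, defined near $q$ (its germ at $q$ does not depend on the choice of $\alpha$; the order condition forces $f(p)$ to be again of this form). **Theorem.** The groups $T\mathcal{A}$ and $V\mathcal{A}$ are simple. -/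

import Mathlib

open Filter Topology

namespace FiniteGerm

/-! ### Singular points relative to a base group of homeomorphisms -/

section Sing

variable {X : Type*} [TopologicalSpace X]

/-- The singular points of a homeomorphism `h` relative to a base group `B`: the points `p` such
that `h` does not agree with any element of `B` on any neighborhood of `p`. -/
def sing (B : Subgroup (X ≃ₜ X)) (h : X ≃ₜ X) : Set X :=
  {p | ¬ ∃ b ∈ B, ∀ᶠ x in 𝓝 p, h x = b x}

theorem notMem_sing {B : Subgroup (X ≃ₜ X)} {h : X ≃ₜ X} {p : X} :
    p ∉ sing B h ↔ ∃ b ∈ B, ∀ᶠ x in 𝓝 p, h x = b x := by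
  simp [sing]

theorem tendsto_homeo (h : X ≃ₜ X) (p : X) : Tendsto h (𝓝 p) (𝓝 (h p)) :=
  h.continuous.tendsto p

theorem sing_one (B : Subgroup (X ≃ₜ X)) : sing B (1 : X ≃ₜ X) = ∅ := by
  ext p
  simp only [Set.mem_empty_iff_false, iff_false, notMem_sing]
  exact ⟨1, B.one_mem, Eventually.of_forall fun _ => rfl⟩

theorem sing_mul {B : Subgroup (X ≃ₜ X)} {f g : X ≃ₜ X} {p : X} (hp : p ∈ sing B (f * g)) :
    p ∈ sing B g ∨ g p ∈ sing B f := by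
  by_contra! hcon
  obtain ⟨hg, hf⟩ := hcon
  rw [notMem_sing] at hg hf
  obtain ⟨b, hb, hgb⟩ := hg
  obtain ⟨c, hc, hfc⟩ := hf
  refine hp ⟨c * b, B.mul_mem hc hb, ?_⟩
  filter_upwards [hgb, (tendsto_homeo g p).eventually hfc] with x h1 h2
  change f (g x) = c (b x)
  rw [h2, h1]

theorem sing_mul_subset (B : Subgroup (X ≃ₜ X)) (f g : X ≃ₜ X) :
    sing B (f * g) ⊆ sing B g ∪ g ⁻¹' sing B f := fun _ hp => sing_mul hp

theorem sing_inv {B : Subgroup (X ≃ₜ X)} {f : X ≃ₜ X} {q : X} (hq : q ∈ sing B f⁻¹) :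
    f⁻¹ q ∈ sing B f := by
  by_contra hcon
  rw [notMem_sing] at hcon
  obtain ⟨b, hb, h⟩ := hcon
  refine hq ⟨b⁻¹, B.inv_mem hb, ?_⟩
  filter_upwards [(tendsto_homeo f⁻¹ q).eventually h] with y hy
  have h1 : f (f⁻¹ y) = y := f.apply_symm_apply y
  have h2 : b⁻¹ (b (f⁻¹ y)) = f⁻¹ y := b.symm_apply_apply _
  rw [← h2, ← hy, h1]

theorem sing_inv_subset (B : Subgroup (X ≃ₜ X)) (f : X ≃ₜ X) :
    sing B f⁻¹ ⊆ (f⁻¹ : X ≃ₜ X) ⁻¹' sing B f := fun _ hq => sing_inv hq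

theorem sing_of_mem {B : Subgroup (X ≃ₜ X)} {f : X ≃ₜ X} (hf : f ∈ B) : sing B f = ∅ := by
  ext p
  simp only [Set.mem_empty_iff_false, iff_false, notMem_sing]
  exact ⟨f, hf, Eventually.of_forall fun _ => rfl⟩

end Sing

/-! ### Thompson's group `T` on the circle `ℝ/ℤ` -/

/-- The dyadic rationals, i.e. the elements of `ℤ[1/2]`, as real numbers. -/
def IsDyadic (b : ℝ) : Prop := ∃ (a : ℤ) (k : ℕ), b = a / 2 ^ k

/-- The dyadic points of the circle `ℝ/ℤ`. -/
def IsDyadicPoint (p : UnitAddCircle) : Prop := ∃ b : ℝ, IsDyadic b ∧ (b : UnitAddCircle) = p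

/-- In a neighborhood of `t`, the map `f` of the circle has the form `s ↦ 2 ^ n * s + b` (modulo 1)
with `n ∈ ℤ` and `b ∈ ℤ[1/2]`. The condition depends only on the class of `t` modulo 1. -/
def DyadicAffineAt (f : UnitAddCircle ≃ₜ UnitAddCircle) (t : ℝ) : Prop :=
  ∃ (n : ℤ) (b : ℝ), IsDyadic b ∧
    ∀ᶠ s : ℝ in 𝓝 t, f (s : UnitAddCircle) = (((2 : ℝ) ^ n * s + b : ℝ) : UnitAddCircle)

theorem IsDyadic.add {x y : ℝ} (hx : IsDyadic x) (hy : IsDyadic y) : IsDyadic (x + y) := by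
  obtain ⟨a, k, rfl⟩ := hx
  obtain ⟨b, l, rfl⟩ := hy
  refine ⟨a * 2 ^ l + b * 2 ^ k, k + l, ?_⟩
  push_cast
  rw [pow_add]
  field_simp

theorem IsDyadic.neg {x : ℝ} (hx : IsDyadic x) : IsDyadic (-x) := by
  obtain ⟨a, k, rfl⟩ := hx
  exact ⟨-a, k, by push_cast; ring⟩

theorem IsDyadic.sub {x y : ℝ} (hx : IsDyadic x) (hy : IsDyadic y) : IsDyadic (x - y) := by
  rw [sub_eq_add_neg]; exact hx.add hy.neg

theorem IsDyadic.int (a : ℤ) : IsDyadic a := ⟨a, 0, by simp⟩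

theorem IsDyadic.zpow_mul {x : ℝ} (hx : IsDyadic x) (n : ℤ) : IsDyadic ((2 : ℝ) ^ n * x) := by
  obtain ⟨a, k, rfl⟩ := hx
  rcases Int.eq_nat_or_neg n with ⟨m, rfl | rfl⟩
  · refine ⟨2 ^ m * a, k, ?_⟩
    rw [zpow_natCast]; push_cast; ring
  · refine ⟨a, k + m, ?_⟩
    rw [zpow_neg, zpow_natCast, pow_add]; field_simp

theorem isDyadic_iff_affine {t b : ℝ} (n : ℤ) (hb : IsDyadic b) :
    IsDyadic ((2 : ℝ) ^ n * t + b) ↔ IsDyadic t := by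
  constructor
  · intro h
    have := (h.sub hb).zpow_mul (-n)
    rwa [add_sub_cancel_right, ← mul_assoc, ← zpow_add₀ two_ne_zero, neg_add_cancel, zpow_zero,
      one_mul] at this
  · intro h
    exact (h.zpow_mul n).add hb

theorem coe_eq_coe {x y : ℝ} (h : (x : UnitAddCircle) = y) : ∃ k : ℤ, x = y + k := by
  rw [← sub_eq_zero, ← AddCircle.coe_sub, AddCircle.coe_eq_zero_iff] at h
  obtain ⟨k, hk⟩ := h
  refine ⟨k, ?_⟩
  simp at hk
  linarith

theorem coe_add_int (x : ℝ) (k : ℤ) : ((x + k : ℝ) : UnitAddCircle) = x := by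
  rw [AddCircle.coe_add, add_eq_left, AddCircle.coe_eq_zero_iff]
  exact ⟨k, by simp⟩

theorem isDyadicPoint_coe {t : ℝ} : IsDyadicPoint (t : UnitAddCircle) ↔ IsDyadic t := by
  constructor
  · rintro ⟨b, hb, h⟩
    obtain ⟨k, hk⟩ := coe_eq_coe h.symm
    rw [hk]; exact hb.add (IsDyadic.int k)
  · intro h; exact ⟨t, h, rfl⟩

theorem exists_coe (p : UnitAddCircle) : ∃ t : ℝ, (t : UnitAddCircle) = p :=
  QuotientAddGroup.mk_surjective p

theorem eventually_coe {t : ℝ} {P : UnitAddCircle → Prop} :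
    (∀ᶠ x in 𝓝 (t : UnitAddCircle), P x) ↔ ∀ᶠ s : ℝ in 𝓝 t, P (s : UnitAddCircle) := by
  have : 𝓝 (t : UnitAddCircle) = map ((↑) : ℝ → UnitAddCircle) (𝓝 t) :=
    QuotientAddGroup.nhds_eq _ t
  rw [this, eventually_map]

theorem DyadicAffineAt.isDyadicPoint_iff {f : UnitAddCircle ≃ₜ UnitAddCircle} {t : ℝ}
    (h : DyadicAffineAt f t) :
    IsDyadicPoint (f (t : UnitAddCircle)) ↔ IsDyadicPoint (t : UnitAddCircle) := by
  obtain ⟨n, b, hb, h⟩ := h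
  rw [h.self_of_nhds, isDyadicPoint_coe, isDyadicPoint_coe, isDyadic_iff_affine n hb]

theorem DyadicAffineAt.inv {f : UnitAddCircle ≃ₜ UnitAddCircle} {t u : ℝ}
    (h : DyadicAffineAt f t) (hu : f (t : UnitAddCircle) = u) : DyadicAffineAt f⁻¹ u := by
  obtain ⟨n, b, hb, h⟩ := h
  have h0 := h.self_of_nhds
  rw [hu] at h0
  obtain ⟨k, hk⟩ := coe_eq_coe h0
  have h2 : (2 : ℝ) ^ n ≠ 0 := by positivity
  refine ⟨-n, -((2 : ℝ) ^ (-n) * (b + k)), ((hb.add (IsDyadic.int k)).zpow_mul _).neg, ?_⟩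
  have hlim : Tendsto (fun s : ℝ => (2 : ℝ) ^ (-n) * s + -((2 : ℝ) ^ (-n) * (b + k))) (𝓝 u)
      (𝓝 t) := by
    have hc : Continuous (fun s : ℝ => (2 : ℝ) ^ (-n) * s + -((2 : ℝ) ^ (-n) * (b + k))) := by
      fun_prop
    have := hc.tendsto u
    convert this using 2
    rw [hk, zpow_neg]; field_simp; ring
  filter_upwards [hlim.eventually h] with s hs
  change f.symm s = _
  rw [Homeomorph.symm_apply_eq, hs]
  have he : s = (2 : ℝ) ^ n * ((2 : ℝ) ^ (-n) * s + -((2 : ℝ) ^ (-n) * (b + k))) + b + k := by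
    rw [zpow_neg]; field_simp; ring
  conv_lhs => rw [he]
  rw [coe_add_int]

theorem eventually_notMem_finite {D : Set UnitAddCircle} (hD : D.Finite) (t : ℝ) :
    ∀ᶠ s : ℝ in 𝓝[≠] t, (s : UnitAddCircle) ∉ D := by
  have h1 : ∀ᶠ x in 𝓝 (t : UnitAddCircle), x ∉ D \ {(t : UnitAddCircle)} :=
    (hD.subset Set.sdiff_subset).isClosed.isOpen_compl.mem_nhds (by simp)
  rw [eventually_coe] at h1
  have h2 : ∀ᶠ s : ℝ in 𝓝 t, |s - t| < 1 := by
    have := Metric.ball_mem_nhds t one_pos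
    filter_upwards [this] with s hs using hs
  filter_upwards [h1.filter_mono nhdsWithin_le_nhds, h2.filter_mono nhdsWithin_le_nhds,
    self_mem_nhdsWithin] with s hs hs' hne hmem
  apply hs
  refine ⟨hmem, fun heq => hne ?_⟩
  obtain ⟨k, hk⟩ := coe_eq_coe heq
  have : k = 0 := by
    rw [hk, add_sub_cancel_left] at hs'
    rw [← Int.abs_lt_one_iff]
    exact_mod_cast hs'
  simp [hk, this]

/-- Two affine formulas that agree modulo 1 near a point agree modulo 1 everywhere. -/
theorem affine_unique {n m : ℤ} {b c t : ℝ}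
    (h : ∀ᶠ s : ℝ in 𝓝 t, (((2 : ℝ) ^ n * s + b : ℝ) : UnitAddCircle) =
      (((2 : ℝ) ^ m * s + c : ℝ) : UnitAddCircle)) (s : ℝ) :
    (((2 : ℝ) ^ n * s + b : ℝ) : UnitAddCircle) = (((2 : ℝ) ^ m * s + c : ℝ) : UnitAddCircle) := by
  obtain ⟨k, hk⟩ := coe_eq_coe h.self_of_nhds
  have hlim : Tendsto (fun s : ℝ => ((2 : ℝ) ^ n * s + b) - ((2 : ℝ) ^ m * s + c) - k) (𝓝 t)
      (𝓝 0) := by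
    have hc : Continuous (fun s : ℝ => ((2 : ℝ) ^ n * s + b) - ((2 : ℝ) ^ m * s + c) - k) := by
      fun_prop
    have := hc.tendsto t
    rwa [hk, add_sub_cancel_left, sub_self] at this
  have hsmall : ∀ᶠ s : ℝ in 𝓝 t, |((2 : ℝ) ^ n * s + b) - ((2 : ℝ) ^ m * s + c) - k| < 1 := by
    have := hlim.eventually (Metric.ball_mem_nhds (0 : ℝ) one_pos)
    filter_upwards [this] with s hs
    simpa using hs
  have hex : ∀ᶠ s : ℝ in 𝓝 t, (2 : ℝ) ^ n * s + b = (2 : ℝ) ^ m * s + c + k := by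
    filter_upwards [h, hsmall] with s h1 h2
    obtain ⟨l, hl⟩ := coe_eq_coe h1
    rw [hl, add_sub_cancel_left] at h2
    have : l - k = 0 := by
      rw [← Int.abs_lt_one_iff]
      exact_mod_cast h2
    rw [hl, sub_eq_zero.mp this]
  obtain ⟨x, hx, hxt⟩ :=
    ((hex.filter_mono nhdsWithin_le_nhds).and (self_mem_nhdsWithin : {t}ᶜ ∈ 𝓝[≠] t)).exists
  have hslope : (2 : ℝ) ^ n = (2 : ℝ) ^ m := by
    have : ((2 : ℝ) ^ n - (2 : ℝ) ^ m) * (x - t) = 0 := by linarith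
    rcases mul_eq_zero.mp this with h' | h'
    · linarith
    · exact absurd (sub_eq_zero.mp h') hxt
  have : (2 : ℝ) ^ n * s + b = (2 : ℝ) ^ m * s + c + k := by
    rw [hslope] at hk ⊢; linarith
  rw [this, coe_add_int]

/-- A homeomorphism that is locally of the form `s ↦ 2 ^ n * s + b` at every point of an open
interval is given by one such formula on the closed interval. -/
theorem affine_on_Icc {f : UnitAddCircle ≃ₜ UnitAddCircle} {u v : ℝ} (huv : u < v)
    (h : ∀ t ∈ Set.Ioo u v, DyadicAffineAt f t) :
    ∃ (n : ℤ) (b : ℝ), IsDyadic b ∧ ∀ s ∈ Set.Icc u v,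
      f (s : UnitAddCircle) = (((2 : ℝ) ^ n * s + b : ℝ) : UnitAddCircle) := by
  obtain ⟨m, hm⟩ : (Set.Ioo u v).Nonempty := Set.nonempty_Ioo.mpr huv
  obtain ⟨n, b, hb, hnb⟩ := h m hm
  refine ⟨n, b, hb, ?_⟩
  set W : Set ℝ := {t | ∀ᶠ s : ℝ in 𝓝 t,
    f (s : UnitAddCircle) = (((2 : ℝ) ^ n * s + b : ℝ) : UnitAddCircle)} with hW
  set W' : Set ℝ := {t | ∃ (n' : ℤ) (b' : ℝ), (∀ᶠ s : ℝ in 𝓝 t,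
    f (s : UnitAddCircle) = (((2 : ℝ) ^ n' * s + b' : ℝ) : UnitAddCircle)) ∧
    ¬ ∀ s : ℝ, (((2 : ℝ) ^ n' * s + b' : ℝ) : UnitAddCircle) =
      (((2 : ℝ) ^ n * s + b : ℝ) : UnitAddCircle)} with hW'
  have hWo : IsOpen W := by
    rw [isOpen_iff_mem_nhds]
    intro t ht
    exact eventually_eventually_nhds.mpr ht
  have hWo' : IsOpen W' := by
    rw [isOpen_iff_mem_nhds]
    rintro t ⟨n', b', ht, hne⟩
    filter_upwards [eventually_eventually_nhds.mpr ht] with s hs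
    exact ⟨n', b', hs, hne⟩
  have hcover : Set.Ioo u v ⊆ W ∪ W' := by
    intro t ht
    obtain ⟨n', b', -, hn'⟩ := h t ht
    by_cases hall : ∀ s : ℝ, (((2 : ℝ) ^ n' * s + b' : ℝ) : UnitAddCircle) =
      (((2 : ℝ) ^ n * s + b : ℝ) : UnitAddCircle)
    · left
      filter_upwards [hn'] with s hs
      rw [hs, hall]
    · right
      exact ⟨n', b', hn', hall⟩
  have hsub : Set.Ioo u v ⊆ W :=
    IsPreconnected.subset_left_of_subset_union hWo hWo'
      (by
        rw [Set.disjoint_iff]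
        rintro t ⟨h1, n', b', h2, h3⟩
        apply h3
        apply affine_unique (t := t)
        filter_upwards [h1, h2] with s h1 h2
        rw [← h1, ← h2])
      hcover ⟨m, hm, hnb⟩ isPreconnected_Ioo
  have heq : Set.EqOn (fun s : ℝ => f (s : UnitAddCircle))
      (fun s : ℝ => (((2 : ℝ) ^ n * s + b : ℝ) : UnitAddCircle)) (Set.Ioo u v) :=
    fun s hs => (hsub hs).self_of_nhds
  have hcont : Continuous (fun s : ℝ => f (s : UnitAddCircle)) :=
    f.continuous.comp (AddCircle.continuous_mk' 1)
  have hcont' : Continuous (fun s : ℝ => (((2 : ℝ) ^ n * s + b : ℝ) : UnitAddCircle)) :=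
    (AddCircle.continuous_mk' 1).comp (by fun_prop)
  have := heq.closure hcont hcont'
  rwa [closure_Ioo huv.ne] at this

/-- The defining condition of Thompson's group `T`: `f` is piecewise linear, all breakpoints lie in
a finite set `D` of dyadic points, and away from `D` the map has the form `s ↦ 2 ^ n * s + b` with
`n ∈ ℤ` and `b ∈ ℤ[1/2]`. -/
def IsThompsonT (f : UnitAddCircle ≃ₜ UnitAddCircle) : Prop :=
  ∃ D : Set UnitAddCircle, D.Finite ∧ (∀ p ∈ D, IsDyadicPoint p) ∧
    ∀ t : ℝ, (t : UnitAddCircle) ∉ D → DyadicAffineAt f t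

/-- An element of `T` has a linear piece on each side of every point. -/
theorem IsThompsonT.sides {f : UnitAddCircle ≃ₜ UnitAddCircle} (hf : IsThompsonT f) (t : ℝ) :
    ∃ ε > 0, (∃ (n : ℤ) (b : ℝ), IsDyadic b ∧ ∀ s ∈ Set.Icc t (t + ε),
        f (s : UnitAddCircle) = (((2 : ℝ) ^ n * s + b : ℝ) : UnitAddCircle)) ∧
      (∃ (n : ℤ) (b : ℝ), IsDyadic b ∧ ∀ s ∈ Set.Icc (t - ε) t,
        f (s : UnitAddCircle) = (((2 : ℝ) ^ n * s + b : ℝ) : UnitAddCircle)) := by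
  obtain ⟨D, hD, -, hf⟩ := hf
  have h1 := eventually_notMem_finite hD t
  rw [eventually_nhdsWithin_iff, Metric.eventually_nhds_iff] at h1
  obtain ⟨ε, hε, h1⟩ := h1
  refine ⟨ε, hε, affine_on_Icc (by linarith) fun s hs => hf s (h1 ?_ ?_),
    affine_on_Icc (by linarith) fun s hs => hf s (h1 ?_ ?_)⟩
  · rw [Real.dist_eq, abs_lt]; constructor <;> linarith [hs.1, hs.2]
  · exact hs.1.ne'
  · rw [Real.dist_eq, abs_lt]; constructor <;> linarith [hs.1, hs.2]
  · exact hs.2.ne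

theorem IsThompsonT.isDyadicPoint_iff {f : UnitAddCircle ≃ₜ UnitAddCircle} (hf : IsThompsonT f)
    (p : UnitAddCircle) : IsDyadicPoint (f p) ↔ IsDyadicPoint p := by
  obtain ⟨t, rfl⟩ := exists_coe p
  obtain ⟨ε, hε, ⟨n, b, hb, h⟩, -⟩ := hf.sides t
  rw [h t ⟨le_rfl, by linarith⟩, isDyadicPoint_coe, isDyadicPoint_coe, isDyadic_iff_affine n hb]

/-- Thompson's group `T`, acting on the circle `ℝ/ℤ`. -/
def thompsonT : Subgroup (UnitAddCircle ≃ₜ UnitAddCircle) where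
  carrier := {f | IsThompsonT f}
  one_mem' := ⟨∅, Set.finite_empty, by simp, fun t _ =>
    ⟨0, 0, ⟨0, 0, by simp⟩, Eventually.of_forall fun s => by simp⟩⟩
  mul_mem' := by
    intro f g hf hg
    obtain ⟨D, hD, hDd, hfD⟩ := id hf
    obtain ⟨E, hE, hEd, hgE⟩ := id hg
    refine ⟨E ∪ g ⁻¹' D, hE.union (hD.preimage g.injective.injOn), ?_, ?_⟩
    · rintro p (hp | hp)
      · exact hEd p hp
      · exact (hg.isDyadicPoint_iff p).mp (hDd _ hp)
    · intro t ht
      rw [Set.mem_union, not_or] at ht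
      obtain ⟨n, b, hb, h⟩ := hgE t ht.1
      have h0 := h.self_of_nhds
      obtain ⟨m, c, hc, h'⟩ := hfD ((2 : ℝ) ^ n * t + b) (by rw [← h0]; exact ht.2)
      refine ⟨m + n, (2 : ℝ) ^ m * b + c, (hb.zpow_mul m).add hc, ?_⟩
      have hlim : Tendsto (fun s : ℝ => (2 : ℝ) ^ n * s + b) (𝓝 t) (𝓝 ((2 : ℝ) ^ n * t + b)) :=
        (by fun_prop : Continuous (fun s : ℝ => (2 : ℝ) ^ n * s + b)).tendsto t
      filter_upwards [h, hlim.eventually h'] with s h1 h2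
      change f (g s) = _
      rw [h1, h2, zpow_add₀ two_ne_zero]
      congr 1; ring
  inv_mem' := by
    intro f hf
    obtain ⟨D, hD, hDd, hfD⟩ := id hf
    refine ⟨f '' D, hD.image f, ?_, ?_⟩
    · rintro _ ⟨p, hp, rfl⟩
      exact (hf.isDyadicPoint_iff p).mpr (hDd p hp)
    · intro u hu
      obtain ⟨t, ht⟩ := exists_coe (f.symm u)
      have hfu : f (t : UnitAddCircle) = u := by rw [ht, f.apply_symm_apply]
      exact (hfD t fun hmem => hu ⟨t, hmem, hfu⟩).inv hfu

/-! ### The group `TA` -/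

/-- The map of the circle that fixes `p` and has slope 2, i.e. `x ↦ p + 2 (x - p)`. -/
def doubling (p x : UnitAddCircle) : UnitAddCircle := p + 2 • (x - p)

/-- `L_{f(p)} ∘ f` agrees with `f ∘ L_p` in some neighborhood of `p`. -/
def CommutesWithDoubling (f : UnitAddCircle ≃ₜ UnitAddCircle) (p : UnitAddCircle) : Prop :=
  ∀ᶠ x in 𝓝 p, doubling (f p) (f x) = f (doubling p x)

theorem doubling_coe (t s : ℝ) :
    doubling (t : UnitAddCircle) (s : UnitAddCircle) = ((2 * s - t : ℝ) : UnitAddCircle) := by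
  rw [doubling, ← AddCircle.coe_sub, ← AddCircle.coe_nsmul, ← AddCircle.coe_add]
  congr 1
  simp only [nsmul_eq_mul, Nat.cast_ofNat]
  ring

theorem tendsto_doubling (p : UnitAddCircle) : Tendsto (doubling p) (𝓝 p) (𝓝 p) := by
  have hc : Continuous (doubling p) := by unfold doubling; fun_prop
  have := hc.tendsto p
  rwa [show doubling p p = p by simp [doubling]] at this

theorem CommutesWithDoubling.mul {f g : UnitAddCircle ≃ₜ UnitAddCircle} {p : UnitAddCircle}
    (hf : CommutesWithDoubling f (g p)) (hg : CommutesWithDoubling g p) :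
    CommutesWithDoubling (f * g) p := by
  filter_upwards [hg, (tendsto_homeo g p).eventually hf] with x h1 h2
  change doubling (f (g p)) (f (g x)) = f (g (doubling p x))
  rw [h2, h1]

theorem CommutesWithDoubling.inv {f : UnitAddCircle ≃ₜ UnitAddCircle} {q : UnitAddCircle}
    (hf : CommutesWithDoubling f (f⁻¹ q)) : CommutesWithDoubling f⁻¹ q := by
  filter_upwards [(tendsto_homeo f⁻¹ q).eventually hf] with y h
  have h1 : ∀ z, f (f⁻¹ z) = z := f.apply_symm_apply
  have h2 : ∀ z, f⁻¹ (f z) = z := f.symm_apply_apply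
  rw [h1, h1] at h
  rw [h, h2]

theorem CommutesWithDoubling.congr {f g : UnitAddCircle ≃ₜ UnitAddCircle} {p : UnitAddCircle}
    (hg : CommutesWithDoubling g p) (h : ∀ᶠ x in 𝓝 p, f x = g x) : CommutesWithDoubling f p := by
  filter_upwards [hg, h, (tendsto_doubling p).eventually h] with x h1 h2 h3
  rw [h.self_of_nhds, h2, h3, h1]

theorem IsThompsonT.commutesWithDoubling {f : UnitAddCircle ≃ₜ UnitAddCircle}
    (hf : IsThompsonT f) (p : UnitAddCircle) : CommutesWithDoubling f p := by
  obtain ⟨t, rfl⟩ := exists_coe p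
  obtain ⟨ε, hε, ⟨n, b, -, h⟩, ⟨m, c, -, h'⟩⟩ := hf.sides t
  rw [CommutesWithDoubling, eventually_coe, Metric.eventually_nhds_iff]
  refine ⟨ε / 2, by linarith, fun s hs => ?_⟩
  rw [Real.dist_eq, abs_lt] at hs
  rcases le_total t s with hts | hts
  · rw [h t ⟨le_rfl, by linarith⟩, h s ⟨hts, by linarith⟩, doubling_coe, doubling_coe,
      h _ ⟨by linarith, by linarith⟩]
    congr 1; ring
  · rw [h' t ⟨by linarith, le_rfl⟩, h' s ⟨by linarith, hts⟩, doubling_coe, doubling_coe,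
      h' _ ⟨by linarith, by linarith⟩]
    congr 1; ring

/-- The defining conditions of `TA`: the singular set (relative to `T`) is a finite set of dyadic
points, and at each singular point `p` the maps `L_{f(p)} ∘ f` and `f ∘ L_p` agree near `p`. -/
structure IsTA (f : UnitAddCircle ≃ₜ UnitAddCircle) : Prop where
  finite : (sing thompsonT f).Finite
  dyadic : ∀ p ∈ sing thompsonT f, IsDyadicPoint p
  commutes : ∀ p ∈ sing thompsonT f, CommutesWithDoubling f p

theorem IsTA.commutesWithDoubling {f : UnitAddCircle ≃ₜ UnitAddCircle} (hf : IsTA f)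
    (p : UnitAddCircle) : CommutesWithDoubling f p := by
  by_cases hp : p ∈ sing thompsonT f
  · exact hf.commutes p hp
  · rw [notMem_sing] at hp
    obtain ⟨b, hb, h⟩ := hp
    exact (IsThompsonT.commutesWithDoubling hb p).congr h

theorem isDyadicPoint_iff_of_notMem_sing {f : UnitAddCircle ≃ₜ UnitAddCircle} {p : UnitAddCircle}
    (hp : p ∉ sing thompsonT f) : IsDyadicPoint (f p) ↔ IsDyadicPoint p := by
  rw [notMem_sing] at hp
  obtain ⟨b, hb, h⟩ := hp
  rw [h.self_of_nhds]
  exact IsThompsonT.isDyadicPoint_iff hb p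

/-- Elements of `TA` preserve the set of dyadic points. -/
theorem IsTA.isDyadicPoint_iff {f : UnitAddCircle ≃ₜ UnitAddCircle} (hf : IsTA f)
    (p : UnitAddCircle) : IsDyadicPoint (f p) ↔ IsDyadicPoint p := by
  by_cases hp : p ∈ sing thompsonT f
  swap
  · exact isDyadicPoint_iff_of_notMem_sing hp
  have hpd := hf.dyadic p hp
  refine ⟨fun _ => hpd, fun _ => ?_⟩
  obtain ⟨t, rfl⟩ := exists_coe p
  rw [isDyadicPoint_coe] at hpd
  have hev := eventually_notMem_finite hf.finite t
  have hc := hf.commutes _ hp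
  rw [CommutesWithDoubling, eventually_coe] at hc
  have hlim0 : Tendsto (fun k : ℕ => ((1 : ℝ) / 2) ^ k) atTop (𝓝 0) :=
    tendsto_pow_atTop_nhds_zero_of_lt_one (by norm_num) (by norm_num)
  have hlim : Tendsto (fun k : ℕ => t + ((1 : ℝ) / 2) ^ k) atTop (𝓝 t) := by
    simpa using hlim0.const_add t
  have hlim' : Tendsto (fun k : ℕ => t + ((1 : ℝ) / 2) ^ k) atTop (𝓝[≠] t) := by
    rw [tendsto_nhdsWithin_iff]
    refine ⟨hlim, Eventually.of_forall fun k => ?_⟩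
    have : (0 : ℝ) < (1 / 2) ^ k := by positivity
    simp
  obtain ⟨k, h1, h2, h3⟩ := ((hlim'.eventually hev).and
    (((hlim'.comp (tendsto_add_atTop_nat 1)).eventually hev).and
      ((hlim.comp (tendsto_add_atTop_nat 1)).eventually hc))).exists
  simp only [Function.comp_apply] at h2 h3
  have hd : ∀ j : ℕ, IsDyadic (t + ((1 : ℝ) / 2) ^ j) := fun j =>
    hpd.add ⟨1, j, by rw [div_pow]; simp⟩
  rw [doubling_coe, show 2 * (t + ((1 : ℝ) / 2) ^ (k + 1)) - t = t + (1 / 2) ^ k by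
    rw [pow_succ]; ring] at h3
  have e1 := (isDyadicPoint_iff_of_notMem_sing h1).mpr (isDyadicPoint_coe.mpr (hd k))
  have e2 := (isDyadicPoint_iff_of_notMem_sing h2).mpr (isDyadicPoint_coe.mpr (hd (k + 1)))
  obtain ⟨x, hx⟩ := exists_coe (f t)
  obtain ⟨y, hyd, hy⟩ := e1
  obtain ⟨z, hzd, hz⟩ := e2
  rw [← hx, ← hy, ← hz, doubling_coe] at h3
  obtain ⟨l, hl⟩ := coe_eq_coe h3
  rw [← hx, isDyadicPoint_coe]
  have : x = z + z - y - l := by linarith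
  rw [this]
  exact ((hzd.add hzd).sub hyd).sub (IsDyadic.int l)

/-- The group `TA` of homeomorphisms of the circle `ℝ/ℤ`. -/
def TA : Subgroup (UnitAddCircle ≃ₜ UnitAddCircle) where
  carrier := {f | IsTA f}
  one_mem' := by
    constructor <;> simp [sing_one]
  mul_mem' := by
    intro f g hf hg
    refine ⟨?_, ?_, ?_⟩
    · exact (hg.finite.union (hf.finite.preimage g.injective.injOn)).subset (sing_mul_subset _ f g)
    · intro p hp
      rcases sing_mul hp with h | h
      · exact hg.dyadic p h
      · exact (hg.isDyadicPoint_iff p).mp (hf.dyadic _ h)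
    · intro p _
      exact (hf.commutesWithDoubling (g p)).mul (hg.commutesWithDoubling p)
  inv_mem' := by
    intro f hf
    refine ⟨?_, ?_, ?_⟩
    · exact (hf.finite.preimage (f⁻¹).injective.injOn).subset (sing_inv_subset _ f)
    · intro q hq
      have h := hf.dyadic _ (sing_inv hq)
      rw [← hf.isDyadicPoint_iff] at h
      rwa [show f (f⁻¹ q) = q from f.apply_symm_apply q] at h
    · intro q _
      exact (hf.commutesWithDoubling _).inv

/-! ### Thompson's group `V` on the Cantor set -/

/-- The Cantor set `{0,1}^ω` of infinite binary sequences, with the product topology. -/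
abbrev Cantor : Type := ℕ → Bool

/-- The infinite sequence `αψ` obtained by prepending the finite word `α` to `ψ`. -/
def cat : List Bool → Cantor → Cantor
  | [], ψ => ψ
  | a :: α, ψ => fun i => Nat.casesOn i a (fun j => cat α ψ j)

/-- The constant sequence `ccc⋯`. -/
def const (c : Bool) : Cantor := fun _ => c

/-- There are finite words `α`, `β` (necessarily prefixes of `p` and `f p`) such that `f` agrees with
the prefix replacement `αψ ↦ βψ` in a neighborhood of `p`. -/
def PrefixReplacementAt (f : Cantor ≃ₜ Cantor) (p : Cantor) : Prop :=
  ∃ α β : List Bool, ∀ᶠ x in 𝓝 p, ∃ ψ : Cantor, x = cat α ψ ∧ f x = cat β ψ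

theorem cat_nil (ψ : Cantor) : cat [] ψ = ψ := rfl

theorem cat_append (α β : List Bool) (ψ : Cantor) : cat (α ++ β) ψ = cat α (cat β ψ) := by
  induction α with
  | nil => rfl
  | cons a α ih =>
    funext i
    cases i with
    | zero => rfl
    | succ i => exact congrFun ih i

theorem cat_cons_inj {a b : Bool} {α β : List Bool} {ψ χ : Cantor} :
    cat (a :: α) ψ = cat (b :: β) χ ↔ a = b ∧ cat α ψ = cat β χ := by
  constructor
  · intro h
    exact ⟨congrFun h 0, funext fun i => congrFun h (i + 1)⟩
  · rintro ⟨rfl, h⟩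
    funext i
    cases i with
    | zero => rfl
    | succ i => exact congrFun h i

theorem cat_inj {α : List Bool} {ψ χ : Cantor} : cat α ψ = cat α χ ↔ ψ = χ := by
  induction α with
  | nil => rfl
  | cons a α ih => rw [cat_cons_inj, ih]; simp

theorem const_eq (c : Bool) : const c = cat [c] (const c) := by
  funext i
  cases i <;> rfl

theorem const_eq_replicate (c : Bool) (n : ℕ) : const c = cat (List.replicate n c) (const c) := by
  induction n with
  | zero => rfl
  | succ n ih =>
    rw [List.replicate_succ, ← List.singleton_append, cat_append, ← ih]
    exact const_eq c

theorem exists_append {α β : List Bool} {ψ χ : Cantor} (h : cat α ψ = cat β χ)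
    (hl : α.length ≤ β.length) : ∃ ε, β = α ++ ε := by
  induction α generalizing β with
  | nil => exact ⟨β, rfl⟩
  | cons a α ih =>
    cases β with
    | nil => simp at hl
    | cons b β =>
      rw [cat_cons_inj] at h
      obtain ⟨ε, rfl⟩ := ih h.2 (by simpa using hl)
      exact ⟨ε, by rw [h.1]; rfl⟩

theorem cat_apply_lt {α : List Bool} {ψ χ : Cantor} {i : ℕ} (hi : i < α.length) :
    cat α ψ i = cat α χ i := by
  induction α generalizing i with
  | nil => simp at hi
  | cons a α ih =>
    cases i with
    | zero => rfl
    | succ i => exact ih (by simpa using hi)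

theorem exists_of_mem_nhds {p : Cantor} {N : Set Cantor} (hN : N ∈ 𝓝 p) :
    ∃ n : ℕ, ∀ x : Cantor, (∀ i < n, x i = p i) → x ∈ N := by
  rw [nhds_pi, Filter.mem_pi] at hN
  obtain ⟨I, hI, t, ht, hsub⟩ := hN
  obtain ⟨n, hn⟩ := hI.bddAbove
  refine ⟨n + 1, fun x hx => hsub fun i hi => ?_⟩
  rw [hx i (Nat.lt_succ_of_le (hn hi))]
  exact mem_of_mem_nhds (ht i)

theorem eventually_agree (p : Cantor) (n : ℕ) : ∀ᶠ x in 𝓝 p, ∀ i < n, x i = p i := by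
  have : ∀ i : ℕ, ∀ᶠ x in 𝓝 p, x i = p i := fun i =>
    (continuous_apply i).continuousAt.eventually
      ((isOpen_discrete {p i}).mem_nhds (Set.mem_singleton (p i)))
  have h := (Set.finite_lt_nat n).eventually_all (l := 𝓝 p) (p := fun i x => x i = p i)
  exact h.mpr fun i _ => this i

theorem exists_cat_of_agree {α : List Bool} {ψ x : Cantor}
    (h : ∀ i < α.length, x i = cat α ψ i) : ∃ χ, x = cat α χ := by
  induction α generalizing x with
  | nil => exact ⟨x, rfl⟩
  | cons a α ih =>
    obtain ⟨χ, hχ⟩ := ih (x := fun i => x (i + 1)) (fun i hi => h (i + 1) (by simpa using hi))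
    refine ⟨χ, funext fun i => ?_⟩
    cases i with
    | zero => exact h 0 (by simp)
    | succ i => exact congrFun hχ i

theorem eventually_cat (α : List Bool) (ψ : Cantor) :
    ∀ᶠ x in 𝓝 (cat α ψ), ∃ χ, x = cat α χ := by
  filter_upwards [eventually_agree (cat α ψ) α.length] with x hx
  exact exists_cat_of_agree hx

theorem PrefixReplacementAt.mul {f g : Cantor ≃ₜ Cantor} {p : Cantor}
    (hf : PrefixReplacementAt f (g p)) (hg : PrefixReplacementAt g p) :
    PrefixReplacementAt (f * g) p := by
  obtain ⟨α, β, h⟩ := hg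
  obtain ⟨γ, δ, h'⟩ := hf
  obtain ⟨ψ, -, h1⟩ := h.self_of_nhds
  obtain ⟨χ, h2, -⟩ := h'.self_of_nhds
  rw [h1] at h2
  have hev := h.and ((tendsto_homeo g p).eventually h')
  rcases le_total β.length γ.length with hl | hl
  · obtain ⟨ε, rfl⟩ := exists_append h2 hl
    refine ⟨α ++ ε, δ, ?_⟩
    filter_upwards [hev] with x ⟨⟨ψ', hx, hgx⟩, χ', hgx', hfx⟩
    rw [hgx, cat_append, cat_inj] at hgx'
    exact ⟨χ', by rw [hx, hgx', cat_append], hfx⟩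
  · obtain ⟨ε, rfl⟩ := exists_append h2.symm hl
    refine ⟨α, δ ++ ε, ?_⟩
    filter_upwards [hev] with x ⟨⟨ψ', hx, hgx⟩, χ', hgx', hfx⟩
    rw [hgx, cat_append, cat_inj] at hgx'
    refine ⟨ψ', hx, ?_⟩
    rw [cat_append, hgx']
    exact hfx

theorem PrefixReplacementAt.inv {f : Cantor ≃ₜ Cantor} {q : Cantor}
    (hf : PrefixReplacementAt f (f⁻¹ q)) : PrefixReplacementAt f⁻¹ q := by
  obtain ⟨α, β, h⟩ := hf
  refine ⟨β, α, ?_⟩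
  filter_upwards [(tendsto_homeo f⁻¹ q).eventually h] with y ⟨ψ, h1, h2⟩
  rw [show f (f⁻¹ y) = y from f.apply_symm_apply y] at h2
  exact ⟨ψ, h2, h1⟩

/-- Thompson's group `V`, acting on the Cantor set. -/
def thompsonV : Subgroup (Cantor ≃ₜ Cantor) where
  carrier := {f | ∀ p, PrefixReplacementAt f p}
  one_mem' := fun _ => ⟨[], [], Eventually.of_forall fun x => ⟨x, rfl, rfl⟩⟩
  mul_mem' := fun {_ g} hf hg p => (hf (g p)).mul (hg p)
  inv_mem' := fun {_} hf _ => (hf _).inv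

/-! ### The group `VA` -/

/-- The sequence `p` ends in `000⋯` or in `111⋯`. -/
def EndsConst (p : Cantor) : Prop := ∃ (α : List Bool) (c : Bool), p = cat α (const c)

/-- The map `f` is order-preserving, for the lexicographic order, on a neighborhood of `p`. -/
def OrderPreservingAt (f : Cantor ≃ₜ Cantor) (p : Cantor) : Prop :=
  ∃ U ∈ 𝓝 p, ∀ x ∈ U, ∀ y ∈ U, toLex x < toLex y → toLex (f x) < toLex (f y)

/-- `L_{f(p)} ∘ f` agrees with `f ∘ L_p` in a neighborhood of `p`, where `L_p` is the germ at
`p = αccc⋯` of the prefix replacement `αcψ ↦ αψ`. This germ does not depend on the choice of `α`.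
Here `p = αccc⋯` and `f p = βddd⋯`, and for `x = αcψ` near `p` with `f x = βdχ` one has
`L_p x = αψ` and `L_{f(p)} (f x) = βχ`. -/
def CommutesWithShift (f : Cantor ≃ₜ Cantor) (p : Cantor) : Prop :=
  ∃ (α β : List Bool) (c d : Bool), p = cat α (const c) ∧ f p = cat β (const d) ∧
    ∀ᶠ x in 𝓝 p, ∃ ψ χ : Cantor,
      x = cat (α ++ [c]) ψ ∧ f x = cat (β ++ [d]) χ ∧ cat β χ = f (cat α ψ)

theorem toLex_cat_lt {α : List Bool} {ψ χ : Cantor} :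
    toLex (cat α ψ) < toLex (cat α χ) ↔ toLex ψ < toLex χ := by
  induction α with
  | nil => rfl
  | cons a α ih =>
    rw [← ih]
    constructor
    · rintro ⟨i, h1, h2⟩
      cases i with
      | zero => exact absurd h2 (lt_irrefl _)
      | succ i => exact ⟨i, fun j hj => h1 (j + 1) (Nat.succ_lt_succ hj), h2⟩
    · rintro ⟨i, h1, h2⟩
      refine ⟨i + 1, fun j hj => ?_, h2⟩
      cases j with
      | zero => rfl
      | succ j => exact h1 j (Nat.lt_of_succ_lt_succ hj)

theorem OrderPreservingAt.mul {f g : Cantor ≃ₜ Cantor} {p : Cantor}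
    (hf : OrderPreservingAt f (g p)) (hg : OrderPreservingAt g p) :
    OrderPreservingAt (f * g) p := by
  obtain ⟨U, hU, h⟩ := hg
  obtain ⟨W, hW, h'⟩ := hf
  refine ⟨U ∩ g ⁻¹' W, inter_mem hU (tendsto_homeo g p hW), ?_⟩
  intro x hx y hy hxy
  exact h' _ hx.2 _ hy.2 (h x hx.1 y hy.1 hxy)

theorem OrderPreservingAt.inv {f : Cantor ≃ₜ Cantor} {q : Cantor}
    (hf : OrderPreservingAt f (f⁻¹ q)) : OrderPreservingAt f⁻¹ q := by
  obtain ⟨U, hU, h⟩ := hf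
  refine ⟨(f⁻¹ : Cantor ≃ₜ Cantor) ⁻¹' U, tendsto_homeo f⁻¹ q hU, ?_⟩
  intro x hx y hy hxy
  have e : ∀ z, f (f⁻¹ z) = z := f.apply_symm_apply
  rcases lt_trichotomy (toLex (f⁻¹ x)) (toLex (f⁻¹ y)) with h1 | h1 | h1
  · exact h1
  · have := (f⁻¹).injective (toLex.injective h1)
    rw [this] at hxy
    exact absurd hxy (lt_irrefl _)
  · have := h _ hy _ hx h1
    rw [e, e] at this
    exact absurd hxy this.asymm

theorem cat_shift {ε : List Bool} {c d : Bool} (h : const c = cat ε (const d)) (ψ : Cantor) :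
    cat (ε ++ [d]) ψ = cat (c :: ε) ψ := by
  induction ε with
  | nil =>
    have : c = d := congrFun h 0
    rw [this]; rfl
  | cons a ε ih =>
    rw [const_eq, cat_cons_inj, cat_nil] at h
    obtain ⟨rfl, h⟩ := h
    rw [List.cons_append, cat_cons_inj]
    exact ⟨rfl, ih h⟩

/-- The germ `L_p` does not depend on the choice of `α`. -/
theorem shift_unique {α β : List Bool} {c d : Bool} {ψ χ : Cantor}
    (h : cat α (const c) = cat β (const d)) (h' : cat (α ++ [c]) ψ = cat (β ++ [d]) χ) :
    cat α ψ = cat β χ := by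
  have key : ∀ {α β : List Bool} {c d : Bool} {ψ χ : Cantor}, α.length ≤ β.length →
      cat α (const c) = cat β (const d) → cat (α ++ [c]) ψ = cat (β ++ [d]) χ →
      cat α ψ = cat β χ := by
    intro α β c d ψ χ hl h h'
    obtain ⟨ε, rfl⟩ := exists_append h hl
    rw [cat_append, cat_inj] at h
    rw [List.append_assoc, cat_append, cat_append, cat_inj, cat_shift h, cat_cons_inj] at h'
    rw [cat_append, cat_inj]
    exact h'.2
  rcases le_total α.length β.length with hl | hl
  · exact key hl h h'
  · exact (key hl h.symm h'.symm).symm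

theorem CommutesWithShift.mul {f g : Cantor ≃ₜ Cantor} {p : Cantor}
    (hf : CommutesWithShift f (g p)) (hg : CommutesWithShift g p) :
    CommutesWithShift (f * g) p := by
  obtain ⟨α, β, c, d, hp, hgp, h⟩ := hg
  obtain ⟨α', β', c', d', hgp', hfp, h'⟩ := hf
  refine ⟨α, β', c, d', hp, hfp, ?_⟩
  filter_upwards [h, (tendsto_homeo g p).eventually h'] with x ⟨ψ, χ, h1, h2, h3⟩
    ⟨ψ', χ', h1', h2', h3'⟩
  refine ⟨ψ, χ', h1, h2', ?_⟩
  change _ = f (g (cat α ψ))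
  rw [← h3, shift_unique (hgp.symm.trans hgp') (h2.symm.trans h1'), h3']

theorem CommutesWithShift.inv {f : Cantor ≃ₜ Cantor} {q : Cantor}
    (hf : CommutesWithShift f (f⁻¹ q)) : CommutesWithShift f⁻¹ q := by
  obtain ⟨α, β, c, d, hp, hfp, h⟩ := hf
  have e : ∀ z, f (f⁻¹ z) = z := f.apply_symm_apply
  rw [e] at hfp
  refine ⟨β, α, d, c, hfp, hp, ?_⟩
  filter_upwards [(tendsto_homeo f⁻¹ q).eventually h] with y ⟨ψ, χ, h1, h2, h3⟩
  rw [e] at h2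
  refine ⟨χ, ψ, h2, h1, ?_⟩
  rw [h3]
  exact (f.symm_apply_apply _).symm

theorem CommutesWithShift.endsConst {f : Cantor ≃ₜ Cantor} {p : Cantor}
    (h : CommutesWithShift f p) : EndsConst (f p) := by
  obtain ⟨α, β, c, d, -, hfp, -⟩ := h
  exact ⟨β, d, hfp⟩

theorem exists_tail {γ α : List Bool} {c : Bool} {ψ : Cantor} (h : cat γ (const c) = cat α ψ) :
    ∃ ε, ψ = cat ε (const c) := by
  induction α generalizing γ with
  | nil => exact ⟨γ, h.symm⟩
  | cons a α ih =>
    cases γ with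
    | nil =>
      rw [cat_nil, const_eq, cat_cons_inj] at h
      exact ih h.2
    | cons b γ =>
      rw [cat_cons_inj] at h
      exact ih h.2

theorem PrefixReplacementAt.endsConst {f : Cantor ≃ₜ Cantor} {p : Cantor}
    (h : PrefixReplacementAt f p) (hp : EndsConst (f p)) : EndsConst p := by
  obtain ⟨α, β, h⟩ := h
  obtain ⟨ψ, h1, h2⟩ := h.self_of_nhds
  obtain ⟨γ, c, hp⟩ := hp
  obtain ⟨ε, rfl⟩ := exists_tail (hp.symm.trans h2)
  exact ⟨α ++ ε, c, by rw [h1, cat_append]⟩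

theorem PrefixReplacementAt.orderPreservingAt {f : Cantor ≃ₜ Cantor} {p : Cantor}
    (h : PrefixReplacementAt f p) : OrderPreservingAt f p := by
  obtain ⟨α, β, h⟩ := h
  refine ⟨_, h, ?_⟩
  rintro x ⟨ψ, hx, hfx⟩ y ⟨χ, hy, hfy⟩ hxy
  rw [hx, hy, toLex_cat_lt] at hxy
  rwa [hfx, hfy, toLex_cat_lt]

theorem PrefixReplacementAt.commutesWithShift {f : Cantor ≃ₜ Cantor} {p : Cantor}
    (h : PrefixReplacementAt f p) (hp : EndsConst p) : CommutesWithShift f p := by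
  obtain ⟨α, β, h⟩ := h
  obtain ⟨ψ, h1, h2⟩ := h.self_of_nhds
  obtain ⟨γ, c, hp⟩ := hp
  obtain ⟨ε, rfl⟩ := exists_tail (hp.symm.trans h1)
  obtain ⟨n, hn⟩ := exists_of_mem_nhds h
  have hc := const_eq_replicate c n
  set ρ := List.replicate n c with hρ
  have hp' : p = cat (α ++ ε ++ ρ) (const c) := by
    rw [h1, cat_append, cat_append, ← hc]
  have hfp' : f p = cat (β ++ ε ++ ρ) (const c) := by
    rw [h2, cat_append, cat_append, ← hc]
  have hcone : ∀ χ : Cantor, f (cat (α ++ ε ++ ρ) χ) = cat (β ++ ε ++ ρ) χ := by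
    intro χ
    obtain ⟨ψ, hx, hfx⟩ := hn (cat (α ++ ε ++ ρ) χ) (fun i hi => by
      rw [hp']
      refine cat_apply_lt ?_
      simp only [List.length_append, hρ, List.length_replicate]
      omega)
    rw [hfx]
    rw [cat_append, cat_append, cat_inj] at hx
    rw [← hx, cat_append, cat_append]
  refine ⟨α ++ ε ++ ρ, β ++ ε ++ ρ, c, c, hp', hfp', ?_⟩
  have hev := eventually_cat (α ++ ε ++ ρ ++ [c]) (const c)
  rw [cat_append _ [c], ← const_eq, ← hp'] at hev
  filter_upwards [hev] with x ⟨χ, hx⟩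
  refine ⟨χ, χ, hx, ?_, (hcone χ).symm⟩
  rw [hx, cat_append _ [c], hcone, ← cat_append]

theorem prefixReplacementAt_of_notMem_sing {f : Cantor ≃ₜ Cantor} {p : Cantor}
    (hp : p ∉ sing thompsonV f) : PrefixReplacementAt f p := by
  rw [notMem_sing] at hp
  obtain ⟨b, hb, h⟩ := hp
  obtain ⟨α, β, hb⟩ := hb p
  refine ⟨α, β, ?_⟩
  filter_upwards [h, hb] with x h1 ⟨ψ, h2, h3⟩
  exact ⟨ψ, h2, h1.trans h3⟩

/-- The defining conditions of `VA`: the singular set (relative to `V`) is a finite set of points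
that end in `000⋯` or `111⋯`, and at each singular point `p` the map `f` is order-preserving near
`p` and the maps `L_{f(p)} ∘ f` and `f ∘ L_p` agree near `p`. -/
structure IsVA (f : Cantor ≃ₜ Cantor) : Prop where
  finite : (sing thompsonV f).Finite
  endsConst : ∀ p ∈ sing thompsonV f, EndsConst p
  orderPreserving : ∀ p ∈ sing thompsonV f, OrderPreservingAt f p
  commutes : ∀ p ∈ sing thompsonV f, CommutesWithShift f p

theorem IsVA.orderPreservingAt {f : Cantor ≃ₜ Cantor} (hf : IsVA f) (p : Cantor) :
    OrderPreservingAt f p := by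
  by_cases hp : p ∈ sing thompsonV f
  · exact hf.orderPreserving p hp
  · exact (prefixReplacementAt_of_notMem_sing hp).orderPreservingAt

theorem IsVA.commutesWithShift {f : Cantor ≃ₜ Cantor} (hf : IsVA f) {p : Cantor}
    (hp : EndsConst p) : CommutesWithShift f p := by
  by_cases hps : p ∈ sing thompsonV f
  · exact hf.commutes p hps
  · exact (prefixReplacementAt_of_notMem_sing hps).commutesWithShift hp

theorem IsVA.endsConst_mul {f g : Cantor ≃ₜ Cantor} (hf : IsVA f) (hg : IsVA g) {p : Cantor}
    (hp : p ∈ sing thompsonV (f * g)) : EndsConst p := by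
  by_cases h : p ∈ sing thompsonV g
  · exact hg.endsConst p h
  · exact (prefixReplacementAt_of_notMem_sing h).endsConst
      (hf.endsConst _ ((sing_mul hp).resolve_left h))

/-- The group `VA` of homeomorphisms of the Cantor set. -/
def VA : Subgroup (Cantor ≃ₜ Cantor) where
  carrier := {f | IsVA f}
  one_mem' := by
    constructor <;> simp [sing_one]
  mul_mem' := by
    intro f g hf hg
    refine ⟨?_, ?_, ?_, ?_⟩
    · exact (hg.finite.union (hf.finite.preimage g.injective.injOn)).subset (sing_mul_subset _ f g)
    · exact fun p hp => hf.endsConst_mul hg hp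
    · exact fun p _ => (hf.orderPreservingAt _).mul (hg.orderPreservingAt p)
    · intro p hp
      have h := hg.commutesWithShift (hf.endsConst_mul hg hp)
      exact (hf.commutesWithShift h.endsConst).mul h
  inv_mem' := by
    intro f hf
    refine ⟨?_, ?_, ?_, ?_⟩
    · exact (hf.finite.preimage (f⁻¹).injective.injOn).subset (sing_inv_subset _ f)
    · intro q hq
      have h := (hf.commutes _ (sing_inv hq)).endsConst
      rwa [show f (f⁻¹ q) = q from f.apply_symm_apply q] at h
    · exact fun q _ => (hf.orderPreservingAt _).inv
    · exact fun q hq => (hf.commutes _ (sing_inv hq)).inv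

end FiniteGerm

/-! Let `N` be a nontrivial normal subgroup. Some element of `N` moves a neighbourhood `U` of a
chosen point off itself, and a double commutator argument (`commutator_mem`) puts all commutators of
elements supported in `U` into `N`. After conjugation the point is `0` on the circle, respectively
`000⋯` in the Cantor set. It remains to see that a normal subgroup containing these commutators is
everything.

This is an induction on the number of singular points. With none, the element lies in the base group
`T` or `V`, and the base group is shown to lie in `N`. Otherwise, one singular point is removed by
an element of `N` that has the same germ there, after moving the point and its image to the base
point, and has no other singular point. So each germ at the base point must be realized inside `N`.

The germs are tractable because they commute with the local scaling. A piecewise linear exponential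
turns doubling to the right of `0` into `x ↦ x + 1`, and a right germ of `TA` becomes a piecewise
linear dyadic homeomorphism of the line commuting with the unit translation, that is, a lift of an
element of `T`. Writing points near `000⋯` as `0 ⋯ 0 1 ψ` does the same for `VA`. Both cases are
treated on an abstract line `ℤ × Y` with self-similar cells `Y`. There the germs are exactly the
changes of labelled partition `c'⁻¹ * c`: deepest siblings can be merged until one cell per period
is left (`Mono.frame_inv`).

Send a germ to the class modulo `N` of an element that realizes it with no other singularity. This
is well defined because an element with trivial germ lies in the base group, hence in `N`. It is
available at first only for germs with a dyadic fixed point, where they can be cut off. It kills the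
shift, which is the germ of an element of the base group, and it sends two specific moves to
commuting classes, since both can be realized with support in `U`. The algebraic core
`Frame.mem_graphKer_of_commute` says that such a partial homomorphism is trivial: the commutator of
the two moves is again a move of adjacent cells, so all moves die, and a rotation then has an image
of order dividing both `m` and `m + 1`.

The same core, applied to lifts of circle maps, gives `T ≤ N` (`mem_of_mem_thompsonT`). For `V`, the
group is generated by swaps of disjoint cones, and halving the cones makes the class `e` of a swap
satisfy `e = e * e` (`swap_mem`). Left germs on the circle and points ending in `111⋯` are reduced
to the other case by a reflection. -/

namespace FiniteGerm

/-! ### Split systems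

A split system is the algebraic skeleton of the universal central extension of Thompson's group `T`
acting on a line that is divided into unit cells: `S` is the shift by one cell, and `σ m i` halves
every cell whose index is congruent to `i` modulo `m`, relabelling the cells afterwards. -/

/-- The shift and the splitting maps, with their relations. -/
structure SplitSystem (H : Type*) [Group H] where
  S : H
  σ : ℕ → ℕ → H
  pow : ∀ {m i}, i < m → σ m i * S ^ m = S ^ (m + 1) * σ m i
  rot : ∀ {m i}, i + 1 < m → σ m (i + 1) * S = S * σ m i
  comm : ∀ {m i j}, i < j → j < m → σ (m + 1) (j + 1) * σ m i = σ (m + 1) i * σ m j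

namespace SplitSystem

variable {H Q : Type*} [Group H] [Group Q] (D : SplitSystem H)

/-- Labelled periodic partitions into `m` cells per period, as maps to the standard partition. -/
inductive Frame : ℕ → H → Prop
  | one : Frame 1 1
  | shift {m : ℕ} {c : H} (j : ℤ) : Frame m c → Frame m (D.S ^ j * c)
  | split {m i : ℕ} {c : H} : Frame m c → i < m → Frame (m + 1) (D.σ m i * c)

variable {D}

theorem Frame.pos {m : ℕ} {c : H} (hc : D.Frame m c) : 0 < m := by
  induction hc with
  | one => exact one_pos
  | shift j _ ih => exact ih
  | split _ _ ih => omega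

theorem Frame.shift_one {m : ℕ} {c : H} (hc : D.Frame m c) : D.Frame m (D.S * c) := by
  simpa using hc.shift 1

/-- One period of the partition is `m` labels long. Consequently every quotient `c'⁻¹ * c` of two
frames commutes with the shift. -/
theorem Frame.pow_mul {m : ℕ} {c : H} (hc : D.Frame m c) : D.S ^ m * c = c * D.S := by
  induction hc with
  | one => simp
  | @shift m c j _ ih =>
    have h : D.S ^ m * D.S ^ j = D.S ^ j * D.S ^ m := (Commute.refl D.S).pow_left m |>.zpow_right j
    rw [← mul_assoc, h, mul_assoc, ih, mul_assoc]
  | @split m i c _ hi ih =>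
    rw [← mul_assoc, ← D.pow hi, mul_assoc, ih, mul_assoc]

/-- The rotation by one cell is an `m`-th root of the shift; once the shift is killed, this bounds
the order of its image. -/
theorem Frame.conj_pow {m : ℕ} {c : H} (hc : D.Frame m c) : (c⁻¹ * D.S * c) ^ m = D.S := by
  have h := _root_.conj_pow (a := c⁻¹) (b := D.S) (i := m)
  rw [inv_inv] at h
  rw [h, mul_assoc, hc.pow_mul, inv_mul_cancel_left]

theorem σ_eq_conj {m i : ℕ} (hi : i < m) : D.σ m i = D.S ^ i * D.σ m 0 * (D.S ^ i)⁻¹ := by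
  induction i with
  | zero => simp
  | succ i ih =>
    rw [← mul_inv_eq_iff_eq_mul.mpr (D.rot hi).symm, ih (by omega)]
    simp only [pow_succ', mul_inv_rev, mul_assoc]

/-- Adjacent moves differ only by relabelling, so the move of the cells 0 and 1 stands for all of
them. -/
theorem σ_pair {m i : ℕ} (hi : i + 1 < m) :
    (D.σ m (i + 1))⁻¹ * D.σ m i = D.S ^ i * ((D.σ m 1)⁻¹ * D.σ m 0) * (D.S ^ i)⁻¹ := by
  have h1 : D.σ m 1 = D.S * D.σ m 0 * D.S⁻¹ := by
    have := σ_eq_conj (D := D) (show 1 < m by omega)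
    simpa using this
  rw [σ_eq_conj hi, σ_eq_conj (show i < m by omega), h1]
  simp only [pow_succ, mul_inv_rev, mul_assoc, inv_mul_cancel_left, inv_inv]

/-- Up to a move, rotating `m` cells is the same as rotating the `m + 1` cells obtained by splitting
cell 1. This is what brings the two coprime exponents `m` and `m + 1` together. -/
theorem rot_conj {m : ℕ} (c : H) (hm : 2 ≤ m) :
    c⁻¹ * D.S * c = (D.σ m 1 * c)⁻¹ * D.S * (D.σ m 1 * c) *
      (c⁻¹ * ((D.σ m 1)⁻¹ * D.σ m 0) * c) := by
  have h : D.σ m 1 * D.S = D.S * D.σ m 0 := D.rot (i := 0) (by omega)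
  simp only [mul_inv_rev, mul_assoc, mul_inv_cancel_left]
  rw [← mul_assoc D.S (D.σ m 0), ← h]
  simp only [mul_assoc, inv_mul_cancel_left]

/-- A subgroup that contains the shift and certain conjugates of elementary moves contains all
changes of labelled partition. -/
theorem Frame.mem_of_generators {K : Subgroup H} (hS : D.S ∈ K)
    (hmove : ∀ {m c}, D.Frame m c → ∀ {i j}, i < m → j < m →
      c⁻¹ * ((D.σ m i)⁻¹ * D.σ m j) * c ∈ K)
    (hrot : ∀ {m c}, D.Frame m c → 3 ≤ m →
      c⁻¹ * ((D.σ m 0)⁻¹ * D.σ m 2 * D.S) * c ∈ K)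
    {m : ℕ} {c c' : H} (hc : D.Frame m c) (hc' : D.Frame m c') : c'⁻¹ * c ∈ K := by
  -- A rotation is a move times the generator of `hrot`. That generator is preferred to the rotation
  -- because it will turn out to have a fixed point on the line.
  have hrot3 : ∀ {m c}, D.Frame m c → 3 ≤ m → c⁻¹ * D.S * c ∈ K := by
    intro m c hc hm
    have h1 := hmove hc (i := 2) (j := 0) (by omega) (by omega)
    have := K.mul_mem h1 (hrot hc hm)
    simpa only [mul_assoc, mul_inv_cancel_left, inv_mul_cancel_left] using this
  have hrotall : ∀ {m c}, D.Frame m c → c⁻¹ * D.S * c ∈ K := by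
    intro m c hc
    have := hc.pos
    obtain rfl | rfl | hm : m = 1 ∨ m = 2 ∨ 3 ≤ m := by omega
    · have := hc.conj_pow
      rw [pow_one] at this
      rwa [this]
    · rw [rot_conj (D := D) c le_rfl]
      exact K.mul_mem (hrot3 (hc.split (by omega)) (by omega)) (hmove hc (by omega) (by omega))
    · exact hrot3 hc hm
  -- Reference frames, obtained by always splitting cell 0. The recursion starts with the
  -- unconstrained value `σ 0 0`, which the leading factor in `hstd` cancels.
  let std : ℕ → H := fun m => Nat.rec 1 (fun m x => D.σ m 0 * x) m
  have hstd : ∀ {m c}, D.Frame m c → D.σ 0 0 * (std m)⁻¹ * c ∈ K := by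
    intro m c hc
    induction hc with
    | one =>
      have : std 1 = D.σ 0 0 * 1 := rfl
      rw [this]
      simp
    | @shift m c j hc ih =>
      have h := K.zpow_mem (hrotall hc) j
      have h2 := conj_zpow (a := c⁻¹) (b := D.S) (i := j)
      rw [inv_inv] at h2
      rw [h2] at h
      have := K.mul_mem ih h
      simpa only [mul_assoc, mul_inv_cancel_left, inv_mul_cancel_left] using this
    | @split m i c hc hi ih =>
      have h := K.mul_mem ih (hmove hc hc.pos hi)
      have h1 : std (m + 1) = D.σ m 0 * std m := rfl
      rw [h1]
      simpa only [mul_assoc, mul_inv_cancel_left, inv_mul_cancel_left, mul_inv_rev, inv_inv,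
        one_mul] using h
  have := K.mul_mem (K.inv_mem (hstd hc')) (hstd hc)
  simpa only [mul_assoc, mul_inv_cancel_left, inv_mul_cancel_left, mul_inv_rev, inv_inv,
        one_mul, inv_one] using this

/-! ### Partial homomorphisms given by their graphs -/

section Graph

variable (R : Subgroup (H × Q))

/-- The kernel of a partial homomorphism that is given by its graph. -/
def graphKer : Subgroup H where
  carrier := {h | (h, 1) ∈ R}
  one_mem' := R.one_mem
  mul_mem' := fun {a b} ha hb => by simpa using R.mul_mem ha hb
  inv_mem' := fun {a} ha => by simpa using R.inv_mem ha

variable {R}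

theorem mem_graphKer {h : H} : h ∈ graphKer R ↔ (h, 1) ∈ R := Iff.rfl

theorem conj_mem_graphKer {u h : H} (hu : u ∈ R.map (MonoidHom.fst H Q)) (hh : h ∈ graphKer R) :
    u * h * u⁻¹ ∈ graphKer R := by
  obtain ⟨⟨u', q⟩, hq, rfl⟩ := hu
  have := R.mul_mem (R.mul_mem hq hh) (R.inv_mem hq)
  simpa [mem_graphKer] using this

/-- Two frames with equally many cells differ by an element of the domain, and the domain normalizes
the kernel. So whether a relabelled element is killed depends on `m` but not on the frame. -/
theorem conj_frame {m : ℕ}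
    (hdom : ∀ {m c c'}, D.Frame m c → D.Frame m c' → c'⁻¹ * c ∈ R.map (MonoidHom.fst H Q))
    {c c' h : H} (hc : D.Frame m c) (hc' : D.Frame m c') (hh : c⁻¹ * h * c ∈ graphKer R) :
    c'⁻¹ * h * c' ∈ graphKer R := by
  have := conj_mem_graphKer (hdom hc hc') hh
  simpa only [mul_assoc, mul_inv_cancel_left, inv_mul_cancel_left, mul_inv_rev, inv_inv,
        one_mul, inv_one] using this

/-- A partial homomorphism (given by its graph `R`) that is defined on a generating set of changes
of labelled partition, kills the shift, and sends two particular moves to commuting elements kills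
all changes of labelled partition. -/
theorem Frame.mem_graphKer_of_commute (hfun : ∀ {q}, ((1 : H), q) ∈ R → q = 1)
    (hS : (D.S, 1) ∈ R)
    (hmove : ∀ {m c}, D.Frame m c → ∀ {i j}, i < m → j < m →
      c⁻¹ * ((D.σ m i)⁻¹ * D.σ m j) * c ∈ R.map (MonoidHom.fst H Q))
    (hrot : ∀ {m c}, D.Frame m c → 3 ≤ m →
      c⁻¹ * ((D.σ m 0)⁻¹ * D.σ m 2 * D.S) * c ∈ R.map (MonoidHom.fst H Q))
    {m₀ : ℕ} {c₀ : H} (hc₀ : D.Frame m₀ c₀) (hm₀ : 3 ≤ m₀)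
    (hcomm : ∃ p q, (c₀⁻¹ * ((D.σ m₀ 1)⁻¹ * D.σ m₀ 0) * c₀, p) ∈ R ∧
      (c₀⁻¹ * ((D.σ m₀ 0)⁻¹ * D.σ m₀ 2) * c₀, q) ∈ R ∧ Commute p q)
    {m : ℕ} {c c' : H} (hc : D.Frame m c) (hc' : D.Frame m c') : c'⁻¹ * c ∈ graphKer R := by
  have hdom : ∀ {m c c'}, D.Frame m c → D.Frame m c' → c'⁻¹ * c ∈ R.map (MonoidHom.fst H Q) := by
    intro m c c' hc hc'
    exact hc.mem_of_generators (K := R.map (MonoidHom.fst H Q)) ⟨_, hS, rfl⟩ hmove hrot hc'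
  have c01 : D.σ (m₀ + 1) 2 * D.σ m₀ 0 = D.σ (m₀ + 1) 0 * D.σ m₀ 1 :=
    D.comm (by omega) (by omega)
  have c02 : ∀ {m}, 3 ≤ m → D.σ (m + 1) 3 * D.σ m 0 = D.σ (m + 1) 0 * D.σ m 2 := fun hm =>
    D.comm (by omega) (by omega)
  have c12 : ∀ {m}, 3 ≤ m → D.σ (m + 1) 3 * D.σ m 1 = D.σ (m + 1) 1 * D.σ m 2 := fun hm =>
    D.comm (by omega) (by omega)
  -- Splitting cell 2 does not interfere with the cells 0 and 1, so the basic move with `m` cells is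
  -- also the basic move with `m + 1` cells. The third cell is the reason for `3 ≤ m`.
  have hτ : ∀ {m}, 3 ≤ m → (D.σ (m + 1) 1)⁻¹ * D.σ (m + 1) 0 =
      D.σ m 2 * ((D.σ m 1)⁻¹ * D.σ m 0) * (D.σ m 2)⁻¹ := by
    intro m hm
    rw [eq_mul_inv_of_mul_eq (c12 hm).symm, eq_mul_inv_of_mul_eq (c02 hm).symm]
    simp only [mul_assoc, inv_mul_cancel_left, mul_inv_rev, inv_inv]
  -- triviality of the basic move depends only on the number of cells
  have hstep : ∀ {m}, 3 ≤ m → ∀ {c d}, D.Frame m c → D.Frame (m + 1) d →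
      (c⁻¹ * ((D.σ m 1)⁻¹ * D.σ m 0) * c ∈ graphKer R ↔
      d⁻¹ * ((D.σ (m + 1) 1)⁻¹ * D.σ (m + 1) 0) * d ∈ graphKer R) := by
    intro m hm c d hc hd
    have hc2 : D.Frame (m + 1) (D.σ m 2 * c) := hc.split (by omega)
    have key : c⁻¹ * ((D.σ m 1)⁻¹ * D.σ m 0) * c = (D.σ m 2 * c)⁻¹ *
        ((D.σ (m + 1) 1)⁻¹ * D.σ (m + 1) 0) * (D.σ m 2 * c) := by
      rw [hτ hm]
      simp only [mul_assoc, inv_mul_cancel_left, mul_inv_rev]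
    rw [key]
    exact ⟨conj_frame hdom hc2 hd, conj_frame hdom hd hc2⟩
  have hpair : ∀ {m}, ∀ {i}, i + 1 < m → ∀ {c d}, D.Frame m c → D.Frame m d →
      (c⁻¹ * ((D.σ m (i + 1))⁻¹ * D.σ m i) * c ∈ graphKer R ↔
      d⁻¹ * ((D.σ m 1)⁻¹ * D.σ m 0) * d ∈ graphKer R) := by
    intro m i hi c d hc hd
    have key : c⁻¹ * ((D.σ m (i + 1))⁻¹ * D.σ m i) * c = (D.S ^ (-(i : ℤ)) * c)⁻¹ *
        ((D.σ m 1)⁻¹ * D.σ m 0) * (D.S ^ (-(i : ℤ)) * c) := by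
      rw [σ_pair hi, zpow_neg, zpow_natCast]
      simp only [mul_assoc, mul_inv_rev, inv_inv]
    rw [key]
    exact ⟨conj_frame hdom (hc.shift _) hd, conj_frame hdom hd (hc.shift _)⟩
  have hy : D.Frame (m₀ + 1) (D.σ m₀ 0 * c₀) := hc₀.split (by omega)
  -- With `x` and `k` the two given moves, the commutator `x * k * x⁻¹ * k⁻¹` equals the move of the
  -- adjacent cells 1 and 2 in the frame with `m₀ + 1` cells, and it is killed because the images
  -- commute.
  have hbase : (D.σ m₀ 0 * c₀)⁻¹ * ((D.σ (m₀ + 1) 2)⁻¹ * D.σ (m₀ + 1) 1) * (D.σ m₀ 0 * c₀) ∈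
      graphKer R := by
    obtain ⟨p, q, hx, hk, hpq⟩ := hcomm
    have ha := R.mul_mem (R.mul_mem hk hx) (R.inv_mem hk)
    have := R.mul_mem hx (R.inv_mem ha)
    rw [mem_graphKer]
    convert! this using 1
    have e1 : q * p * q⁻¹ = p := by rw [← hpq.eq, mul_inv_cancel_right]
    simp only [Prod.mk_mul_mk, Prod.inv_mk, e1, mul_inv_cancel, Prod.mk.injEq, and_true]
    have e2 : D.σ (m₀ + 1) 1 = D.σ (m₀ + 1) 0 * (D.σ m₀ 2 * ((D.σ m₀ 1)⁻¹ * D.σ m₀ 0) *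
        (D.σ m₀ 2)⁻¹)⁻¹ := by
      rw [← hτ hm₀]; simp
    have e3 : D.σ (m₀ + 1) 2 = D.σ (m₀ + 1) 0 * D.σ m₀ 1 * (D.σ m₀ 0)⁻¹ := by
      rw [← c01]; simp
    rw [e2, e3]
    simp only [mul_assoc, mul_inv_cancel_left, inv_mul_cancel_left, mul_inv_rev, inv_inv]
  have h3 : ∀ {m}, 3 ≤ m → ∀ {c}, D.Frame m c →
      c⁻¹ * ((D.σ m 1)⁻¹ * D.σ m 0) * c ∈ graphKer R := by
    have hex : ∀ {m}, 3 ≤ m → ∃ c, D.Frame m c := by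
      intro m hm
      induction m, hm using Nat.le_induction with
      | base => exact ⟨_, (Frame.one.split (i := 0) (by omega)).split (i := 0) (by omega)⟩
      | succ m hm ih =>
        obtain ⟨c, hc⟩ := ih
        exact ⟨_, hc.split (i := 0) (by omega)⟩
    have h0 : ∀ {c}, D.Frame (m₀ + 1) c →
        c⁻¹ * ((D.σ (m₀ + 1) 1)⁻¹ * D.σ (m₀ + 1) 0) * c ∈ graphKer R := fun hc =>
      (hpair (by omega) hy hc).mp hbase
    -- Descend from `m₀ + 1` cells to three with `hstep`; afterwards climb to every larger number.
    have h00 : ∀ {c}, D.Frame 3 c → c⁻¹ * ((D.σ 3 1)⁻¹ * D.σ 3 0) * c ∈ graphKer R := by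
      have : ∀ m, 3 ≤ m → (∃ c, D.Frame m c ∧
          c⁻¹ * ((D.σ m 1)⁻¹ * D.σ m 0) * c ∈ graphKer R) →
          ∀ {c}, D.Frame 3 c → c⁻¹ * ((D.σ 3 1)⁻¹ * D.σ 3 0) * c ∈ graphKer R := by
        intro m hm
        induction m, hm using Nat.le_induction with
        | base => rintro ⟨c, hc, h⟩ d hd; exact conj_frame hdom hc hd h
        | succ m hm ih =>
          rintro ⟨c, hc, h⟩
          obtain ⟨d, hd⟩ := hex hm
          exact ih ⟨d, hd, (hstep hm hd hc).mpr h⟩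
      exact fun {_} hd => this (m₀ + 1) (by omega) ⟨_, hy, h0 hy⟩ hd
    intro m hm
    induction m, hm using Nat.le_induction with
    | base => exact h00
    | succ m hm ih =>
      intro c hc
      obtain ⟨d, hd⟩ := hex hm
      exact (hstep hm hd hc).mp (ih hd)
  -- Two cells are out of reach of `hstep`; after splitting cell 0, the move becomes the product of
  -- the two adjacent moves of three cells.
  have h2 : ∀ {c}, D.Frame 2 c → c⁻¹ * ((D.σ 2 1)⁻¹ * D.σ 2 0) * c ∈ graphKer R := by
    intro c hc
    have hy : D.Frame 3 (D.σ 2 0 * c) := hc.split (by omega)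
    have e : D.σ 3 2 * D.σ 2 0 = D.σ 3 0 * D.σ 2 1 := D.comm (by omega) (by omega)
    have := (graphKer R).mul_mem ((hpair (i := 1) (by omega) hy hy).mpr (h3 le_rfl hy))
      (h3 le_rfl hy)
    have e3 : D.σ 3 2 = D.σ 3 0 * D.σ 2 1 * (D.σ 2 0)⁻¹ := by
      rw [← e]; simp
    rw [e3] at this
    simpa only [mul_assoc, mul_inv_cancel_left, inv_mul_cancel_left, mul_inv_rev, inv_inv]
      using this
  have hbasic : ∀ {m}, 2 ≤ m → ∀ {c}, D.Frame m c →
      c⁻¹ * ((D.σ m 1)⁻¹ * D.σ m 0) * c ∈ graphKer R := by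
    intro m hm
    obtain rfl | hm := hm.eq_or_lt
    · exact h2
    · exact h3 hm
  have hmove' : ∀ {m c}, D.Frame m c → ∀ {i j}, i < m → j < m →
      c⁻¹ * ((D.σ m i)⁻¹ * D.σ m j) * c ∈ graphKer R := by
    intro m c hc
    have hz : ∀ {i}, i < m → c⁻¹ * ((D.σ m i)⁻¹ * D.σ m 0) * c ∈ graphKer R := by
      intro i hi
      induction i with
      | zero => simp
      | succ i ih =>
        have := (graphKer R).mul_mem ((hpair hi hc hc).mpr (hbasic (by omega) hc)) (ih (by omega))
        simpa only [mul_assoc, mul_inv_cancel_left, inv_mul_cancel_left] using this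
    intro i j hi hj
    have := (graphKer R).mul_mem (hz hi) ((graphKer R).inv_mem (hz hj))
    simpa only [mul_assoc, mul_inv_cancel_left, inv_mul_cancel_left, mul_inv_rev, inv_inv]
      using this
  -- If `q` is the image of the rotation of `m` cells, then `q ^ m = 1`. By `rot_conj` it is also
  -- the image of a rotation of `m + 1` cells, so `q ^ (m + 1) = 1` and `q = 1`.
  have hrot' : ∀ {m c}, D.Frame m c → 2 ≤ m → c⁻¹ * D.S * c ∈ graphKer R := by
    intro m c hc hm
    have hpow : ∀ {m c q}, D.Frame m c → (c⁻¹ * D.S * c, q) ∈ R → q ^ m = 1 := by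
      intro m c q hc hq
      have h1 := R.pow_mem hq m
      rw [Prod.pow_mk, hc.conj_pow] at h1
      have h2 := R.mul_mem (R.inv_mem hS) h1
      simpa using hfun (by simpa using h2)
    have hr : c⁻¹ * D.S * c ∈ R.map (MonoidHom.fst H Q) := by
      have := hdom hc.shift_one hc
      rwa [← mul_assoc] at this
    obtain ⟨⟨_, q⟩, hq, rfl⟩ := hr
    have h1 := hpow hc hq
    have h2 := R.mul_mem hq (R.inv_mem (hbasic hm hc))
    have hc' : D.Frame (m + 1) (D.σ m 1 * c) := hc.split (by omega)
    have h3 := hpow (q := q) hc' (by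
      convert! h2 using 1
      simp only [Prod.inv_mk, inv_one, Prod.mk_mul_mk, mul_one, Prod.mk.injEq,
        and_true]
      rw [rot_conj (D := D) c hm, mul_inv_cancel_right])
    rw [pow_succ, h1, one_mul] at h3
    rw [h3] at hq
    exact hq
  refine hc.mem_of_generators (K := graphKer R) hS hmove' ?_ hc'
  intro m c hc hm
  have := (graphKer R).mul_mem (hmove' hc (i := 0) (j := 2) (by omega) (by omega))
    (hrot' hc (by omega))
  simpa only [mul_assoc, mul_inv_cancel_left] using this

end Graph

end SplitSystem

end FiniteGerm

namespace FiniteGerm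

/-! ### Lines of self-similar cells -/

/-- A linear order with a least element that is the ordered sum of two copies of itself. -/
class Halving (Y : Type*) [LinearOrder Y] [OrderBot Y] where
  sp : Y ≃ Bool × Y
  lt_iff : ∀ y z : Y, y < z ↔
    (sp y).1 < (sp z).1 ∨ (sp y).1 = (sp z).1 ∧ (sp y).2 < (sp z).2
  sp_bot : sp ⊥ = (false, ⊥)

namespace Line

open Halving

section Order

variable {Y : Type*} [LinearOrder Y]

/-- The lexicographic order on `ℤ × Y`. -/
def LT (x y : ℤ × Y) : Prop := x.1 < y.1 ∨ x.1 = y.1 ∧ x.2 < y.2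

theorem LT.trichotomy (x y : ℤ × Y) : LT x y ∨ x = y ∨ LT y x := by
  rcases lt_trichotomy x.1 y.1 with h | h | h
  · exact Or.inl (Or.inl h)
  · rcases lt_trichotomy x.2 y.2 with h' | h' | h'
    · exact Or.inl (Or.inr ⟨h, h'⟩)
    · exact Or.inr (Or.inl (Prod.ext h h'))
    · exact Or.inr (Or.inr (Or.inr ⟨h.symm, h'⟩))
  · exact Or.inr (Or.inr (Or.inl h))

theorem LT.asymm {x y : ℤ × Y} (h : LT x y) : ¬ LT y x := by
  rintro (h' | ⟨h', h''⟩) <;> rcases h with h | ⟨h, h3⟩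
  · omega
  · omega
  · omega
  · exact h''.asymm h3

theorem LT.irrefl (x : ℤ × Y) : ¬ LT x x := fun h => h.asymm h

/-- Order-preserving permutations of the line. -/
def Mono (φ : Equiv.Perm (ℤ × Y)) : Prop := ∀ x y, LT x y → LT (φ x) (φ y)

theorem Mono.lt_iff {φ : Equiv.Perm (ℤ × Y)} (h : Mono φ) {x y : ℤ × Y} :
    LT (φ x) (φ y) ↔ LT x y := by
  refine ⟨fun hxy => ?_, h x y⟩
  rcases LT.trichotomy x y with h1 | h1 | h1
  · exact h1
  · rw [h1] at hxy; exact absurd hxy (LT.irrefl _)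
  · exact absurd (h _ _ h1) hxy.asymm

theorem Mono.one : Mono (1 : Equiv.Perm (ℤ × Y)) := fun _ _ h => h

theorem Mono.mul {φ χ : Equiv.Perm (ℤ × Y)} (h : Mono φ) (h' : Mono χ) : Mono (φ * χ) :=
  fun _ _ hxy => h _ _ (h' _ _ hxy)

theorem Mono.inv {φ : Equiv.Perm (ℤ × Y)} (h : Mono φ) : Mono φ⁻¹ := by
  intro x y hxy
  rw [← h.lt_iff]
  simpa using hxy

/-- The order-preserving permutations of the line. -/
def monoGroup (Y : Type*) [LinearOrder Y] : Subgroup (Equiv.Perm (ℤ × Y)) where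
  carrier := {φ | Mono φ}
  one_mem' := Mono.one
  mul_mem' := Mono.mul
  inv_mem' := Mono.inv

/-- The shift of the line by one cell. -/
def shift (Y : Type*) : Equiv.Perm (ℤ × Y) where
  toFun x := (x.1 + 1, x.2)
  invFun x := (x.1 - 1, x.2)
  left_inv x := by simp
  right_inv x := by simp

theorem shift_apply {Y : Type*} (k : ℤ) (y : Y) : shift Y (k, y) = (k + 1, y) := rfl

theorem shift_zpow_apply {Y : Type*} (j : ℤ) (x : ℤ × Y) : (shift Y ^ j) x = (x.1 + j, x.2) := by
  induction j generalizing x with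
  | zero => simp
  | succ n ih => rw [zpow_add_one, Equiv.Perm.mul_apply, ih]; ext <;> simp [shift]; ring
  | pred n ih =>
    rw [zpow_sub_one, Equiv.Perm.mul_apply, ih, Equiv.Perm.inv_def]; ext <;> simp [shift]; ring

theorem shift_pow_apply {Y : Type*} (j : ℕ) (x : ℤ × Y) : (shift Y ^ j) x = (x.1 + j, x.2) := by
  rw [← zpow_natCast, shift_zpow_apply]

theorem mono_shift : Mono (shift Y) := by
  rintro ⟨k, y⟩ ⟨l, z⟩ (h | ⟨h, h'⟩)
  · exact Or.inl (by simpa [shift_apply] using h)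
  · exact Or.inr ⟨by simpa [shift_apply] using h, h'⟩

end Order

variable {Y : Type*} [LinearOrder Y] [OrderBot Y] [Halving Y]

/-- Doubling the line: every cell is stretched onto two consecutive cells. -/
def double (Y : Type*) [LinearOrder Y] [OrderBot Y] [Halving Y] : Equiv.Perm (ℤ × Y) where
  toFun x := (2 * x.1 + ((sp x.2).1.toNat : ℤ), (sp x.2).2)
  invFun x := (x.1 / 2, sp.symm (decide (x.1 % 2 = 1), x.2))
  left_inv := by
    rintro ⟨k, y⟩
    obtain ⟨⟨b, y⟩, rfl⟩ := sp.symm.surjective y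
    cases b <;> simp; omega
  right_inv := by
    rintro ⟨k, y⟩
    rcases Int.emod_two_eq_zero_or_one k with h | h <;> simp [h] <;> omega

theorem double_apply (k : ℤ) (b : Bool) (y : Y) :
    double Y (k, sp.symm (b, y)) = (2 * k + (b.toNat : ℤ), y) := by
  simp [double]

theorem mono_double : Mono (double Y) := by
  rintro ⟨k, y⟩ ⟨l, z⟩ h
  obtain ⟨⟨b, y⟩, rfl⟩ := sp.symm.surjective y
  obtain ⟨⟨c, z⟩, rfl⟩ := sp.symm.surjective z
  rw [double_apply, double_apply]
  simp only [LT] at h ⊢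
  rw [Halving.lt_iff (sp.symm (b, y))] at h
  simp only [Equiv.apply_symm_apply] at h
  have hb : ∀ b : Bool, (b.toNat : ℤ) ≤ 1 ∧ (0 : ℤ) ≤ b.toNat := by intro b; cases b <;> simp
  have h1 := hb b
  have h2 := hb c
  rcases h with h | ⟨rfl, h | ⟨rfl, h⟩⟩
  · left; omega
  · left
    obtain ⟨rfl, rfl⟩ : b = false ∧ c = true := Bool.lt_iff.mp h
    simp
  · exact Or.inr ⟨rfl, h⟩

theorem double_bot (k : ℤ) : double Y (k, ⊥) = (2 * k, ⊥) := by
  have : (⊥ : Y) = sp.symm (false, ⊥) := by rw [Equiv.eq_symm_apply, sp_bot]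
  conv_lhs => rw [this]
  rw [double_apply]; simp

theorem double_pow_bot (n : ℕ) (k : ℤ) : (double Y ^ n) (k, ⊥) = (2 ^ n * k, ⊥) := by
  induction n generalizing k with
  | zero => simp
  | succ n ih => rw [pow_succ, Equiv.Perm.mul_apply, double_bot, ih]; ring_nf

theorem double_mul_shift : double Y * shift Y = shift Y ^ 2 * double Y := by
  ext1 x
  rw [Equiv.Perm.mul_apply, Equiv.Perm.mul_apply, shift_pow_apply]
  ext <;> simp [double, shift]; ring

theorem double_pow_shift (n : ℕ) (j : ℤ) :
    double Y ^ n * shift Y ^ j = shift Y ^ (2 ^ n * j) * double Y ^ n := by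
  have h1 : ∀ j : ℤ, double Y * shift Y ^ j = shift Y ^ (2 * j) * double Y := by
    intro j
    have : SemiconjBy (double Y) (shift Y) (shift Y ^ 2) := double_mul_shift
    have := this.zpow_right j
    rwa [← zpow_natCast, ← zpow_mul] at this
  induction n with
  | zero => simp
  | succ n ih =>
    rw [pow_succ', mul_assoc, ih, ← mul_assoc, h1, mul_assoc]
    congr 2
    ring

/-- A map of a standard cell onto a dyadic subinterval of the line. -/
def IsCell (g : Y → ℤ × Y) : Prop := ∃ (n : ℕ) (a : ℤ), ∀ y, g y = (double Y ^ n)⁻¹ (a, y)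

theorem shift_zpow_cell (j : ℤ) (n : ℕ) (a : ℤ) (y : Y) :
    (shift Y ^ j) ((double Y ^ n)⁻¹ (a, y)) = (double Y ^ n)⁻¹ (a + 2 ^ n * j, y) := by
  rw [Equiv.Perm.eq_inv_iff_eq, ← Equiv.Perm.mul_apply, double_pow_shift, Equiv.Perm.mul_apply,
    ← Equiv.Perm.mul_apply (double Y ^ n), mul_inv_cancel, Equiv.Perm.one_apply, shift_zpow_apply]

theorem IsCell.shift_zpow {g : Y → ℤ × Y} (hg : IsCell g) (j : ℤ) :
    IsCell fun y => (shift Y ^ j) (g y) := by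
  obtain ⟨n, a, h⟩ := hg
  exact ⟨n, a + 2 ^ n * j, fun y => by simp only [h, shift_zpow_cell]⟩

theorem cell_succ (n : ℕ) (a : ℤ) (b : Bool) (y : Y) :
    (double Y ^ (n + 1))⁻¹ (2 * a + (b.toNat : ℤ), y) =
      (double Y ^ n)⁻¹ (a, sp.symm (b, y)) := by
  rw [pow_succ', mul_inv_rev, Equiv.Perm.mul_apply]
  congr 1
  rw [Equiv.Perm.inv_eq_iff_eq, double_apply]

/-! ### Splitting maps -/

theorem emod_ediv {m q r : ℤ} (h0 : 0 ≤ r) (h1 : r < m) :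
    (m * q + r) / m = q ∧ (m * q + r) % m = r := by
  constructor
  · rw [Int.mul_add_ediv_left _ _ (by omega), Int.ediv_eq_zero_of_lt h0 h1, add_zero]
  · rw [Int.mul_add_emod_self_left, Int.emod_eq_of_lt h0 h1]

/-- Halve all cells whose index is congruent to `i` modulo `m`. -/
def splitFun (m i : ℤ) (x : ℤ × Y) : ℤ × Y :=
  if x.1 % m < i then ((m + 1) * (x.1 / m) + x.1 % m, x.2)
  else if x.1 % m = i then ((m + 1) * (x.1 / m) + (i + ((sp x.2).1.toNat : ℤ)), (sp x.2).2)
  else ((m + 1) * (x.1 / m) + (x.1 % m + 1), x.2)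

/-- The inverse of `splitFun`. -/
def mergeFun (m i : ℤ) (x : ℤ × Y) : ℤ × Y :=
  if x.1 % (m + 1) < i then (m * (x.1 / (m + 1)) + x.1 % (m + 1), x.2)
  else if x.1 % (m + 1) = i then (m * (x.1 / (m + 1)) + i, sp.symm (false, x.2))
  else if x.1 % (m + 1) = i + 1 then (m * (x.1 / (m + 1)) + i, sp.symm (true, x.2))
  else (m * (x.1 / (m + 1)) + (x.1 % (m + 1) - 1), x.2)

section

variable {m i q r : ℤ} {y : Y}

theorem splitFun_lt (h0 : 0 ≤ r) (h1 : r < i) (hi : i < m) :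
    splitFun m i (m * q + r, y) = ((m + 1) * q + r, y) := by
  obtain ⟨e1, e2⟩ := emod_ediv (q := q) h0 (h1.trans hi)
  simp [splitFun, e1, e2, h1]

theorem splitFun_eq (h0 : 0 ≤ i) (hi : i < m) (b : Bool) :
    splitFun m i (m * q + i, sp.symm (b, y)) = ((m + 1) * q + (i + (b.toNat : ℤ)), y) := by
  obtain ⟨e1, e2⟩ := emod_ediv (q := q) h0 hi
  simp [splitFun, e1, e2]

theorem splitFun_gt (h0 : 0 ≤ i) (h1 : i < r) (h2 : r < m) :
    splitFun m i (m * q + r, y) = ((m + 1) * q + (r + 1), y) := by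
  obtain ⟨e1, e2⟩ := emod_ediv (q := q) (h0.trans h1.le) h2
  simp [splitFun, e1, e2, h1.ne', h1.le.not_gt]

theorem mergeFun_lt (h0 : 0 ≤ r) (h1 : r < i) (hi : i < m) :
    mergeFun m i ((m + 1) * q + r, y) = (m * q + r, y) := by
  obtain ⟨e1, e2⟩ := emod_ediv (m := m + 1) (q := q) h0 (by omega)
  simp [mergeFun, e1, e2, h1]

theorem mergeFun_eq (h0 : 0 ≤ i) (hi : i < m) (b : Bool) :
    mergeFun m i ((m + 1) * q + (i + (b.toNat : ℤ)), y) = (m * q + i, sp.symm (b, y)) := by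
  obtain ⟨e1, e2⟩ := emod_ediv (m := m + 1) (q := q) (r := i + (b.toNat : ℤ))
    (by omega) (by cases b <;> simp <;> omega)
  cases b <;> simp_all [mergeFun]

theorem mergeFun_gt (h0 : 0 ≤ i) (h1 : i < r) (h2 : r < m) :
    mergeFun m i ((m + 1) * q + (r + 1), y) = (m * q + r, y) := by
  obtain ⟨e1, e2⟩ := emod_ediv (m := m + 1) (q := q) (r := r + 1) (by omega) (by omega)
  have e3 : ¬ r + 1 < i := by omega
  have e4 : ¬ r + 1 = i := by omega
  have e5 : ¬ r = i := by omega
  simp [mergeFun, e1, e2, e3, e4, e5]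

end

theorem exists_index {m : ℤ} (hm : 0 < m) (k : ℤ) : ∃ q r, k = m * q + r ∧ 0 ≤ r ∧ r < m :=
  ⟨k / m, k % m, (Int.mul_ediv_add_emod k m).symm, Int.emod_nonneg _ hm.ne',
    Int.emod_lt_of_pos _ hm⟩

theorem merge_split {m i : ℤ} (h0 : 0 ≤ i) (hi : i < m) (x : ℤ × Y) :
    mergeFun m i (splitFun m i x) = x := by
  obtain ⟨k, y⟩ := x
  obtain ⟨q, r, rfl, hr0, hr⟩ := exists_index (h0.trans_lt hi) k
  rcases lt_trichotomy r i with h | h | h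
  · rw [splitFun_lt hr0 h hi, mergeFun_lt hr0 h hi]
  · subst h
    obtain ⟨⟨b, y⟩, rfl⟩ := sp.symm.surjective y
    rw [splitFun_eq h0 hi, mergeFun_eq h0 hi]
  · rw [splitFun_gt h0 h hr, mergeFun_gt h0 h hr]

theorem split_merge {m i : ℤ} (h0 : 0 ≤ i) (hi : i < m) (x : ℤ × Y) :
    splitFun m i (mergeFun m i x) = x := by
  obtain ⟨k, y⟩ := x
  obtain ⟨q, r, rfl, hr0, hr⟩ := exists_index (m := m + 1) (by omega) k
  rcases lt_trichotomy r i with h | h | h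
  · rw [mergeFun_lt hr0 h hi, splitFun_lt hr0 h hi]
  · subst h
    have := mergeFun_eq (q := q) (y := y) h0 hi false
    simp only [Bool.toNat_false, Nat.cast_zero, add_zero] at this
    rw [this, splitFun_eq h0 hi]
    simp
  · obtain h' | h' : r = i + 1 ∨ i < r - 1 := by omega
    · subst h'
      have := mergeFun_eq (q := q) (y := y) h0 hi true
      simp only [Bool.toNat_true, Nat.cast_one] at this
      rw [this, splitFun_eq h0 hi]
      simp
    · have := mergeFun_gt (m := m) (q := q) (y := y) h0 h' (by omega)
      rw [sub_add_cancel] at this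
      rw [this, splitFun_gt h0 h' (by omega), sub_add_cancel]

/-- The splitting maps of the line. -/
def split (Y : Type*) [LinearOrder Y] [OrderBot Y] [Halving Y] (m i : ℕ) :
    Equiv.Perm (ℤ × Y) :=
  if h : i < m then
    { toFun := splitFun m i
      invFun := mergeFun m i
      left_inv := merge_split (by omega) (by exact_mod_cast h)
      right_inv := split_merge (by omega) (by exact_mod_cast h) }
  else 1

section

variable {m i : ℕ} {q r : ℤ} {y : Y}

theorem split_apply (hi : i < m) (x : ℤ × Y) : split Y m i x = splitFun m i x := by
  simp [split, hi]

theorem split_lt (h0 : 0 ≤ r) (h1 : r < i) (hi : i < m) :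
    split Y m i (m * q + r, y) = ((m + 1 : ℕ) * q + r, y) := by
  rw [split_apply hi, splitFun_lt h0 h1 (by exact_mod_cast hi)]
  simp

theorem split_eq (hi : i < m) (b : Bool) :
    split Y m i (m * q + i, sp.symm (b, y)) = ((m + 1 : ℕ) * q + (i + (b.toNat : ℤ)), y) := by
  rw [split_apply hi, splitFun_eq (by omega) (by exact_mod_cast hi)]
  simp

theorem split_gt (hi : i < m) (h1 : i < r) (h2 : r < m) :
    split Y m i (m * q + r, y) = ((m + 1 : ℕ) * q + (r + 1), y) := by
  rw [split_apply hi, splitFun_gt (by omega) h1 h2]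
  simp

end

theorem split_mul_pow {m i : ℕ} (hi : i < m) :
    split Y m i * shift Y ^ m = shift Y ^ (m + 1) * split Y m i := by
  ext1 ⟨k, y⟩
  obtain ⟨q, r, rfl, hr0, hr⟩ := exists_index (m := m) (by omega) k
  simp only [Equiv.Perm.mul_apply, shift_pow_apply]
  rw [show (m : ℤ) * q + r + m = m * (q + 1) + r by ring]
  rcases lt_trichotomy r i with h | h | h
  · rw [split_lt hr0 h hi, split_lt hr0 h hi]
    ext
    · simp only; ring
    · rfl
  · subst h
    obtain ⟨⟨b, y⟩, rfl⟩ := sp.symm.surjective y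
    rw [split_eq hi, split_eq hi]
    ext
    · simp only; ring
    · rfl
  · rw [split_gt hi h hr, split_gt hi h hr]
    ext
    · simp only; ring
    · rfl

theorem split_mul_shift {m i : ℕ} (hi : i + 1 < m) :
    split Y m (i + 1) * shift Y = shift Y * split Y m i := by
  ext1 ⟨k, y⟩
  obtain ⟨q, r, rfl, hr0, hr⟩ := exists_index (m := m) (by omega) k
  simp only [Equiv.Perm.mul_apply, shift_apply]
  -- The last cell of a period is shifted to cell 0 of the next one, where the quotient changes.
  obtain hrm | hrm : r + 1 = m ∨ r + 1 < m := by omega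
  · rw [show (m : ℤ) * q + r + 1 = m * (q + 1) + 0 by rw [← hrm]; ring,
      split_lt le_rfl (by omega) hi, split_gt (by omega) (by omega) hr, shift_apply]
    ext
    · simp only; push_cast; rw [← hrm]; ring
    · rfl
  rw [add_assoc]
  rcases lt_trichotomy r i with h | h | h
  · rw [split_lt hr0 h (by omega), split_lt (by omega) (by push_cast; omega) hi, shift_apply]
    ext
    · simp only; ring
    · rfl
  · subst h
    obtain ⟨⟨b, y⟩, rfl⟩ := sp.symm.surjective y
    have := split_eq (Y := Y) (q := q) (y := y) hi b
    push_cast at this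
    rw [this, split_eq (by omega), shift_apply]
    ext
    · simp only; push_cast; ring
    · rfl
  · rw [split_gt (by omega) h hr, split_gt hi (by push_cast; omega) hrm, shift_apply]
    ext
    · simp only; ring
    · rfl

theorem split_comm {m i j : ℕ} (hij : i < j) (hj : j < m) :
    split Y (m + 1) (j + 1) * split Y m i = split Y (m + 1) i * split Y m j := by
  ext1 ⟨k, y⟩
  obtain ⟨q, r, rfl, hr0, hr⟩ := exists_index (m := m) (by omega) k
  simp only [Equiv.Perm.mul_apply]
  rcases lt_trichotomy r i with h | h | h
  · rw [split_lt hr0 h (by omega), split_lt hr0 (by omega) hj,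
      split_lt hr0 (by push_cast; omega) (by omega), split_lt hr0 h (by omega)]
  · subst h
    obtain ⟨⟨b, y⟩, rfl⟩ := sp.symm.surjective y
    rw [split_eq (by omega), split_lt (by omega) (by omega) hj, split_eq (by omega),
      split_lt (by omega) (by cases b <;> simp <;> omega) (by omega)]
  · rcases lt_trichotomy r j with h' | h' | h'
    · rw [split_gt (by omega) h hr, split_lt hr0 h' hj,
        split_lt (by omega) (by push_cast; omega) (by omega),
        split_gt (by omega) h (by push_cast; omega)]
    · subst h'
      obtain ⟨⟨b, y⟩, rfl⟩ := sp.symm.surjective y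
      have := split_eq (Y := Y) (m := m + 1) (i := j + 1) (q := q) (y := y) (by omega) b
      push_cast at this
      have e : split Y m i ((m : ℤ) * q + j, sp.symm (b, y)) =
          (((m : ℤ) + 1) * q + (j + 1), sp.symm (b, y)) := by
        rw [split_gt (by omega) h (by omega)]; push_cast; rfl
      rw [e, this, split_eq hj,
        split_gt (by omega) (by cases b <;> simp <;> omega) (by cases b <;> simp <;> omega)]
      push_cast
      ext
      · simp only; ring
      · rfl
    · rw [split_gt (by omega) h hr, split_gt hj h' hr,
        split_gt (by omega) (by push_cast; omega) (by push_cast; omega),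
        split_gt (by omega) (by omega) (by push_cast; omega)]

/-- The split system of a line of self-similar cells. -/
def system (Y : Type*) [LinearOrder Y] [OrderBot Y] [Halving Y] :
    SplitSystem (Equiv.Perm (ℤ × Y)) where
  S := shift Y
  σ := split Y
  pow := split_mul_pow
  rot := split_mul_shift
  comm := split_comm

theorem mono_split (m i : ℕ) : Mono (split Y m i) := by
  by_cases hi : i < m
  swap
  · simp [split, hi, Mono.one]
  rintro ⟨k, y⟩ ⟨l, z⟩ hlt
  obtain ⟨q, r, rfl, hr0, hr⟩ := exists_index (m := m) (by omega) k
  obtain ⟨q', r', rfl, hr0', hr'⟩ := exists_index (m := m) (by omega) l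
  have hb : ∀ b : Bool, (0 : ℤ) ≤ b.toNat ∧ (b.toNat : ℤ) ≤ 1 := by intro b; cases b <;> simp
  -- A summary of the splitting map on one cell: later cells move up by one, and cell `i` spreads
  -- over two positions. Monotonicity then follows by comparing periods, residues and points in a
  -- cell.
  have hval : ∀ (q r : ℤ) (y : Y), 0 ≤ r → r < m → ∃ (s : ℤ) (w : Y),
      split Y m i (m * q + r, y) = ((m + 1 : ℕ) * q + s, w) ∧ r ≤ s ∧ s ≤ r + 1 ∧
      (r < i → s = r) ∧ (i < r → s = r + 1) ∧ (r ≠ i → w = y) ∧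
      (r = i → s = i + ((sp y).1.toNat : ℤ) ∧ w = (sp y).2) := by
    intro q r y hr0 hr
    rcases lt_trichotomy r i with h | h | h
    · exact ⟨r, y, split_lt hr0 h hi, by omega, by omega, fun _ => rfl, fun _ => by omega,
        fun _ => rfl, fun _ => by omega⟩
    · subst h
      obtain ⟨⟨b, y⟩, rfl⟩ := sp.symm.surjective y
      have := hb b
      exact ⟨_, y, split_eq hi b, by omega, by omega, fun _ => by omega, fun _ => by omega,
        fun h => absurd rfl h, fun _ => by simp⟩
    · exact ⟨r + 1, y, split_gt hi h hr, by omega, by omega, fun _ => by omega, fun _ => rfl,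
        fun _ => rfl, fun _ => by omega⟩
  obtain ⟨s, w, e, h1, h2, h3, h4, h5, h6⟩ := hval q r y hr0 hr
  obtain ⟨s', w', e', h1', h2', h3', h4', h5', h6'⟩ := hval q' r' z hr0' hr'
  rw [e, e']
  simp only [LT] at hlt ⊢
  rcases lt_trichotomy q q' with hq | hq | hq
  · left
    have : ((m + 1 : ℕ) : ℤ) * (q + 1) ≤ (m + 1 : ℕ) * q' :=
      mul_le_mul_of_nonneg_left hq (by positivity)
    push_cast at this ⊢
    linarith
  · subst hq
    rcases lt_trichotomy r r' with hrr | hrr | hrr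
    · left
      have : s < s' := by
        rcases lt_trichotomy r i with h | h | h
        · have := h3 h; omega
        · have := h4' (by omega); have := hb (sp y).1; have := (h6 h).1; omega
        · have := h4' (by omega); omega
      omega
    · subst hrr
      have hyz : y < z := by
        rcases hlt with h | h
        · omega
        · exact h.2
      rcases lt_trichotomy r i with h | h | h
      · right
        rw [h3 h, h3' h, h5 h.ne, h5' h.ne]
        exact ⟨rfl, hyz⟩
      · obtain ⟨hs, rfl⟩ := h6 h
        obtain ⟨hs', rfl⟩ := h6' h
        rw [hs, hs']
        rcases (Halving.lt_iff y z).mp hyz with h7 | ⟨h7, h8⟩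
        · left
          have h9 : (sp y).1 = false ∧ (sp z).1 = true := Bool.lt_iff.mp h7
          rw [h9.1, h9.2]; simp
        · right
          rw [h7]; exact ⟨rfl, h8⟩
      · right
        rw [h4 h, h4' h, h5 h.ne', h5' h.ne']
        exact ⟨rfl, hyz⟩
    · exfalso
      rcases hlt with h | h <;> omega
  · exfalso
    have : (m : ℤ) * (q' + 1) ≤ m * q := mul_le_mul_of_nonneg_left hq (by positivity)
    rcases hlt with h | h <;> linarith

theorem frame_mono {m : ℕ} {c : Equiv.Perm (ℤ × Y)} (hc : (system Y).Frame m c) : Mono c := by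
  induction hc with
  | one => exact Mono.one
  | shift j _ ih => exact ((monoGroup Y).zpow_mem mono_shift j : Mono _).mul ih
  | split _ _ ih => exact (mono_split _ _).mul ih

/-- Every cell of a labelled partition is a dyadic interval. -/
theorem frame_isCell {m : ℕ} {c : Equiv.Perm (ℤ × Y)} (hc : (system Y).Frame m c) (k : ℤ) :
    IsCell fun y => c⁻¹ (k, y) := by
  induction hc generalizing k with
  | one => exact ⟨0, k, fun y => by simp⟩
  | @shift m c j hc ih =>
    have : ∀ y, (((system Y).S ^ j * c)⁻¹ : Equiv.Perm (ℤ × Y)) (k, y) = c⁻¹ (k - j, y) := by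
      intro y
      rw [mul_inv_rev, Equiv.Perm.mul_apply, ← zpow_neg]
      change c⁻¹ ((shift Y ^ (-j)) (k, y)) = _
      rw [shift_zpow_apply]; rfl
    simpa only [this] using ih (k - j)
  | @split m i c hc hi ih =>
    have key : ∀ (l : ℤ) (y z : Y), split Y m i (l, y) = (k, z) →
        (((system Y).σ m i * c)⁻¹ : Equiv.Perm (ℤ × Y)) (k, z) = c⁻¹ (l, y) := by
      intro l y z h
      rw [mul_inv_rev, Equiv.Perm.mul_apply]
      congr 1
      rw [Equiv.Perm.inv_eq_iff_eq]
      exact h.symm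
    obtain ⟨q, r, rfl, hr0, hr⟩ := exists_index (m := (m + 1 : ℕ)) (by omega) k
    rcases lt_trichotomy r i with h | h | h
    · simpa only [key _ _ _ (split_lt hr0 h hi)] using ih (m * q + r)
    · subst h
      obtain ⟨n, a, h⟩ := ih (m * q + i)
      refine ⟨n + 1, 2 * a, fun y => ?_⟩
      have := split_eq (Y := Y) (q := q) (y := y) hi false
      simp only [Bool.toNat_false, Nat.cast_zero, add_zero] at this
      have e := cell_succ n a false y
      simp only [Bool.toNat_false, Nat.cast_zero, add_zero] at e
      simp only at h ⊢
      rw [key _ _ _ this, h, e]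
    · obtain h' | h' : r = i + 1 ∨ i < r - 1 := by omega
      · subst h'
        obtain ⟨n, a, h⟩ := ih (m * q + i)
        refine ⟨n + 1, 2 * a + 1, fun y => ?_⟩
        have := split_eq (Y := Y) (q := q) (y := y) hi true
        simp only [Bool.toNat_true, Nat.cast_one] at this
        have e := cell_succ n a true y
        simp only [Bool.toNat_true, Nat.cast_one] at e
        simp only at h ⊢
        rw [key _ _ _ this, h, e]
      · have : ∀ y, split Y m i (m * q + (r - 1), y) = ((m + 1 : ℕ) * q + r, y) := by
          intro y
          rw [split_gt hi h' (by push_cast at hr; omega), sub_add_cancel]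
        simpa only [key _ _ _ (this _)] using ih (m * q + (r - 1))

end Line

end FiniteGerm

namespace FiniteGerm

namespace Line

/-! ### Germs in a one-sided coordinate -/

section Order

variable {Y P : Type*} [LinearOrder Y] [TopologicalSpace P]

/-- In the coordinate `θ`, which is a parametrization of a one-sided neighborhood of a point by the
cells with very negative index, the map `f` is given by `φ`. -/
def HasGerm (θ : ℤ × Y → P) (f : P ≃ₜ P) (φ : Equiv.Perm (ℤ × Y)) : Prop :=
  ∃ K : ℤ, ∀ x : ℤ × Y, x.1 ≤ K → (φ x).1 ≤ -1 ∧ f (θ x) = θ (φ x)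

/-- By equivariance one orbit of the shift has constant displacement, and by monotonicity it
controls all other points. Hence neighbourhoods of `-∞` go into neighbourhoods of `-∞`, which lets
germs be composed and inverted. -/
theorem exists_le_of_mono {φ : Equiv.Perm (ℤ × Y)} (hφ : Mono φ) (hS : Commute φ (shift Y))
    (K : ℤ) : ∃ L : ℤ, ∀ x : ℤ × Y, x.1 ≤ L → (φ x).1 ≤ K := by
  by_cases hY : Nonempty Y
  swap
  · exact ⟨0, fun x => absurd ⟨x.2⟩ hY⟩
  obtain ⟨y⟩ := hY
  obtain ⟨l, hl⟩ : ∃ l, l = (φ (0, y)).1 := ⟨_, rfl⟩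
  refine ⟨K - l - 1, fun x hx => ?_⟩
  have h1 : LT x (K - l, y) := Or.inl (by simp; omega)
  have h2 := hφ _ _ h1
  have h3 : φ (K - l, y) = (l + (K - l), (φ (0, y)).2) := by
    have := congrArg (fun g => g (0, y)) (hS.zpow_right (K - l)).eq
    simp only [Equiv.Perm.mul_apply, shift_zpow_apply, zero_add] at this
    rw [this, hl]
  rw [h3] at h2
  rcases h2 with h2 | ⟨h2, -⟩
  · simp at h2; omega
  · simp at h2; omega

theorem HasGerm.mul {θ : ℤ × Y → P} {f g : P ≃ₜ P} {φ χ : Equiv.Perm (ℤ × Y)}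
    (hχ : Mono χ) (hS : Commute χ (shift Y)) (hf : HasGerm θ f φ) (hg : HasGerm θ g χ) :
    HasGerm θ (f * g) (φ * χ) := by
  obtain ⟨K, hK⟩ := hf
  obtain ⟨L, hL⟩ := hg
  obtain ⟨M, hM⟩ := exists_le_of_mono hχ hS K
  refine ⟨min L M, fun x hx => ?_⟩
  obtain ⟨h1, h2⟩ := hK _ (hM x (hx.trans (min_le_right _ _)))
  refine ⟨h1, ?_⟩
  change f (g (θ x)) = _
  rw [(hL x (hx.trans (min_le_left _ _))).2, h2, Equiv.Perm.mul_apply]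

theorem HasGerm.inv {θ : ℤ × Y → P} {f : P ≃ₜ P} {φ : Equiv.Perm (ℤ × Y)}
    (hφ : Mono φ) (hS : Commute φ (shift Y)) (hf : HasGerm θ f φ) : HasGerm θ f⁻¹ φ⁻¹ := by
  obtain ⟨K, hK⟩ := hf
  obtain ⟨M, hM⟩ := exists_le_of_mono hφ.inv hS.inv_left (min K (-1))
  refine ⟨M, fun x hx => ?_⟩
  have h1 := hM x hx
  refine ⟨h1.trans (min_le_right _ _), ?_⟩
  have h2 := (hK _ (h1.trans (min_le_left _ _))).2
  rw [← Equiv.Perm.mul_apply, mul_inv_cancel, Equiv.Perm.one_apply] at h2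
  change f.symm _ = _
  rw [Homeomorph.symm_apply_eq, h2]

end Order

variable {Y : Type*} [LinearOrder Y] [OrderBot Y] [Halving Y]

open Halving

/-! ### Recognizing changes of labelled partition -/

/-- The point `(k + 1, ⊥)` is the least one above the whole cell `k`, and order isomorphisms respect
this description. Adjacency of image cells is extracted from this. -/
theorem Mono.next {ψ : Equiv.Perm (ℤ × Y)} (hψ : Mono ψ) {k a : ℤ} {n : ℕ}
    (h : ∀ y, ψ (k, y) = (double Y ^ n)⁻¹ (a, y)) :
    ψ (k + 1, ⊥) = (double Y ^ n)⁻¹ (a + 1, ⊥) := by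
  have hδ : Mono (double Y ^ n) := (monoGroup Y).pow_mem mono_double n
  obtain ⟨⟨l, u⟩, hw⟩ := ψ.surjective ((double Y ^ n)⁻¹ (a + 1, ⊥))
  have h1 : ∀ y, LT (k, y) (l, u) := by
    intro y
    rw [← hψ.lt_iff, hw, h, hδ.inv.lt_iff]
    exact Or.inl (by simp)
  have hkl : k + 1 ≤ l := by
    rcases h1 u with h2 | ⟨-, h2⟩
    · exact h2
    · exact absurd h2 (lt_irrefl _)
  rcases LT.trichotomy (k + 1, ⊥) (l, u) with h2 | h2 | h2
  · exfalso
    have h3 := hψ _ _ h2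
    rw [hw, ← hδ.lt_iff] at h3
    -- Nothing lies above every point of cell `a` and strictly below `(a + 1, ⊥)`.
    have h4 : ∀ y, LT (a, y) ((double Y ^ n) (ψ (k + 1, ⊥))) := by
      intro y
      have h5 : LT (k, y) (k + 1, ⊥) := Or.inl (by simp)
      have h6 := hδ _ _ (hψ _ _ h5)
      rw [h] at h6
      simpa using h6
    generalize (double Y ^ n) (ψ (k + 1, ⊥)) = z at h3 h4
    obtain ⟨b, v⟩ := z
    have h5 := h4 v
    simp only [LT] at h3 h5
    rcases h5 with h5 | ⟨-, h5⟩
    · rcases h3 with h3 | h3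
      · simp at h3; omega
      · simp at h3
    · exact absurd h5 (lt_irrefl _)
  · rw [h2, hw]
  · exfalso
    rcases h2 with h2 | h2
    · simp at h2; omega
    · simp at h2

/-- The left endpoint of a cell stands for the dyadic number `a / 2 ^ n`; the denominators are
cleared. -/
theorem cell_bot_inj {n n' : ℕ} {a a' : ℤ}
    (h : (double Y ^ n)⁻¹ (a, ⊥) = (double Y ^ n')⁻¹ (a', ⊥)) : 2 ^ n' * a = 2 ^ n * a' := by
  have h1 : (double Y ^ n') ((double Y ^ n) ((double Y ^ n)⁻¹ (a, ⊥))) =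
      (double Y ^ n) ((double Y ^ n') ((double Y ^ n)⁻¹ (a, ⊥))) := by
    rw [← Equiv.Perm.mul_apply (double Y ^ n'), ← Equiv.Perm.mul_apply (double Y ^ n) (double Y ^ n'),
      ← pow_add, ← pow_add, add_comm]
  conv_rhs at h1 => rw [h]
  simp only [← Equiv.Perm.mul_apply (double Y ^ _) (double Y ^ _)⁻¹, mul_inv_cancel,
    Equiv.Perm.one_apply, double_pow_bot] at h1
  simpa using h1

theorem shift_conj_cell {Y : Type*} {m : ℕ} {ψ : Equiv.Perm (ℤ × Y)} (hψ : ψ * shift Y ^ m = shift Y * ψ)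
    (q k : ℤ) (y : Y) : ψ (m * q + k, y) = (shift Y ^ q) (ψ (k, y)) := by
  have h : SemiconjBy ψ (shift Y ^ m) (shift Y) := hψ
  have h2 := congrArg (fun f => f (k, y)) (h.zpow_right q)
  simp only [Equiv.Perm.mul_apply] at h2
  rw [← h2, ← zpow_natCast, ← zpow_mul, shift_zpow_apply]
  simp only
  rw [add_comm]

/-- A periodic sequence of standard intervals that are adjacent to each other, more than one per
period, contains the two halves of a standard interval. -/
theorem exists_siblings {m : ℕ} (hm : 2 ≤ m) {n : ℤ → ℕ} {a : ℤ → ℤ}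
    (hn : ∀ k, n (k + m) = n k) (ha : ∀ k, a (k + m) = a k + 2 ^ n k)
    (hadj : ∀ k, 2 ^ n k * a (k + 1) = 2 ^ n (k + 1) * (a k + 1)) :
    ∃ k ν e, n k = ν + 1 ∧ n (k + 1) = ν + 1 ∧ a k = 2 * e ∧ a (k + 1) = 2 * e + 1 := by
  have hper : ∀ (q : ℤ) k, n (m * q + k) = n k := by
    intro q
    induction q with
    | zero => simp
    | succ j ih => intro k; rw [← ih k, ← hn (m * j + k)]; congr 1; ring
    | pred j ih =>
      intro k
      rw [← ih k, ← hn (m * (-(j : ℤ) - 1) + k)]; congr 1; ring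
  -- An interval of maximal depth: one of its two neighbours has to be its sibling.
  obtain ⟨k₀, -, hk₀⟩ := Finset.exists_max_image (Finset.range m) (fun k : ℕ => n k)
    ⟨0, by simp; omega⟩
  have hmax : ∀ k, n k ≤ n k₀ := by
    intro k
    obtain ⟨q, r, rfl, h0, h1⟩ := exists_index (m := m) (by omega) k
    rw [hper]
    obtain ⟨r, rfl⟩ := Int.eq_ofNat_of_zero_le h0
    exact hk₀ r (by simpa using h1)
  obtain hν | ⟨ν, hν⟩ : n k₀ = 0 ∨ ∃ ν, n k₀ = ν + 1 := by
    cases h : n k₀ with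
    | zero => exact Or.inl rfl
    | succ ν => exact Or.inr ⟨ν, rfl⟩
  -- If all depths are 0, then `m ≥ 2` unit intervals would fill a period of length one.
  · exfalso
    have hz : ∀ k, n k = 0 := fun k => by have := hmax k; omega
    have h1 : ∀ k : ℕ, a k = a 0 + k := by
      intro k
      induction k with
      | zero => simp
      | succ k ih => have := hadj k; simp only [hz] at this; push_cast; linarith
    have h2 := ha 0
    have h3 := h1 m
    simp only [hz, zero_add] at h2
    rw [h2] at h3
    simp at h3
    omega
  -- An endpoint that is an odd multiple of `2 ^ (-d)` and a multiple of `2 ^ (-(ν + 1))` forces,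
  -- under `d ≤ ν + 1`, the depth `d = ν + 1`, or else the numerator would be even.
  have key : ∀ {d : ℕ} {x z : ℤ}, d ≤ ν + 1 → 2 ^ d * x = 2 ^ (ν + 1) * z → x % 2 = 1 →
      d = ν + 1 ∧ x = z := by
    intro d x z hd h hx
    obtain ⟨j, hj⟩ := Nat.exists_eq_add_of_le hd
    rw [hj, pow_add, mul_assoc] at h
    have h' := mul_left_cancel₀ (by positivity) h
    cases j with
    | zero => exact ⟨by omega, by simpa using h'⟩
    | succ j =>
      rw [pow_succ, mul_comm ((2 : ℤ) ^ j) 2, mul_assoc] at h'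
      omega
  -- An even numerator means a left half: its right endpoint has odd numerator, so the next interval
  -- is equally deep. An odd numerator means a right half, and the previous interval is the sibling.
  rcases Int.emod_two_eq_zero_or_one (a k₀) with h | h
  · have h1 := hadj k₀
    rw [hν] at h1
    obtain ⟨h2, h3⟩ := key (by have := hmax (k₀ + 1); omega) h1.symm (by omega)
    exact ⟨k₀, ν, a k₀ / 2, hν, h2, by omega, by omega⟩
  · have h1 := hadj (k₀ - 1)
    rw [sub_add_cancel, hν] at h1
    obtain ⟨h2, h3⟩ := key (by have := hmax (k₀ - 1); omega) h1 h
    exact ⟨k₀ - 1, ν, a k₀ / 2, h2, by rw [sub_add_cancel, hν], by omega,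
      by rw [sub_add_cancel]; omega⟩

/-- An order-preserving map of the line that is equivariant for the shift and carries cells to
dyadic intervals is the inverse of a labelled partition. -/
theorem Mono.frame_inv {m : ℕ} (hm : 0 < m) {ψ : Equiv.Perm (ℤ × Y)} (hψ : Mono ψ)
    (hS : ψ * shift Y ^ m = shift Y * ψ) (hcell : ∀ k, IsCell fun y => ψ (k, y)) :
    (system Y).Frame m ψ⁻¹ := by
  obtain ⟨m, rfl⟩ : ∃ j, m = j + 1 := ⟨m - 1, by omega⟩
  induction m generalizing ψ with
  | zero =>
    -- With one cell per period, adjacency and equivariance give `a + 1 = a + 2 ^ n`. So `n = 0` and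
    -- `ψ` is a power of the shift.
    obtain ⟨n, a, h⟩ := hcell 0
    simp only at h
    have h1 := hψ.next h
    have h2 := shift_conj_cell hS 1 0 ⊥
    rw [h, shift_zpow_cell] at h2
    simp only [Nat.cast_one, mul_one, zero_add, add_zero] at h1 h2
    rw [h1] at h2
    have h3 := cell_bot_inj h2
    have h4 := mul_left_cancel₀ (by positivity) h3
    have hn : n = 0 := by
      have h5 : (2 : ℤ) ^ n = 1 := by linarith
      by_contra h0
      have := one_lt_pow₀ (one_lt_two : (1 : ℤ) < 2) h0
      omega
    subst hn
    have : ψ = shift Y ^ a := by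
      ext1 ⟨k, y⟩
      have h5 := shift_conj_cell hS k 0 y
      rw [h] at h5
      simp only [Nat.cast_one, one_mul, zero_add, add_zero, pow_zero, inv_one,
        Equiv.Perm.one_apply, shift_zpow_apply] at h5 ⊢
      rw [h5, add_comm]
    rw [this, ← zpow_neg]
    have := (SplitSystem.Frame.one (D := system Y)).shift (-a)
    rwa [mul_one] at this
  | succ m ih =>
    set M := m + 1 with hM
    choose n₀ a₀ h₀ using hcell
    -- The chosen cell data need not be periodic, so only the choices on residues are kept and
    -- extended by equivariance.
    let n : ℤ → ℕ := fun k => n₀ (k % (M + 1 : ℕ))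
    let a : ℤ → ℤ := fun k => a₀ (k % (M + 1 : ℕ)) + 2 ^ n k * (k / (M + 1 : ℕ))
    have h : ∀ k y, ψ (k, y) = (double Y ^ n k)⁻¹ (a k, y) := by
      intro k y
      have := shift_conj_cell hS (k / (M + 1 : ℕ)) (k % (M + 1 : ℕ)) y
      rw [Int.mul_ediv_add_emod] at this
      rw [this]
      have h1 := h₀ (k % (M + 1 : ℕ)) y
      simp only at h1
      rw [h1, shift_zpow_cell]
    have hdiv : ∀ k : ℤ, (k + (M + 1 : ℕ)) / ((M + 1 : ℕ) : ℤ) = k / (M + 1 : ℕ) + 1 := fun k =>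
      Int.add_ediv_of_dvd_right (dvd_refl _) |>.trans (by rw [Int.ediv_self (by omega)])
    have hn : ∀ k, n (k + (M + 1 : ℕ)) = n k := fun k => by simp only [n, Int.add_emod_right]
    have ha : ∀ k, a (k + (M + 1 : ℕ)) = a k + 2 ^ n k := by
      intro k
      have h1 := hn k
      simp only [a, h1]
      simp only [Int.add_emod_right, hdiv]
      ring
    obtain ⟨k₁, ν, e, hn1, hn2, ha1, ha2⟩ := exists_siblings (m := M + 1) (by omega) hn ha
      (fun k => by
        have := hψ.next (h k)
        rw [h] at this
        exact cell_bot_inj this.symm ▸ (cell_bot_inj this).symm)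
    -- Relabel so that the two siblings become the cells 0 and 1 of a period.
    set ψ₁ : Equiv.Perm (ℤ × Y) := ψ * shift Y ^ k₁ with hψ1
    have hψ₁ : Mono ψ₁ := hψ.mul ((monoGroup Y).zpow_mem mono_shift k₁)
    have hS₁ : ψ₁ * shift Y ^ (M + 1) = shift Y * ψ₁ := by
      rw [hψ1, mul_assoc, ← mul_assoc (shift Y), ← hS, mul_assoc,
        ((Commute.refl (shift Y)).pow_right (M + 1)).zpow_left k₁ |>.eq]
    have hv : ∀ k y, ψ₁ (k, y) = ψ (k + k₁, y) := by
      intro k y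
      rw [hψ1, Equiv.Perm.mul_apply, shift_zpow_apply]
    -- Precomposing with the splitting of cell 0 merges the siblings into their parent `(ν, e)` and
    -- leaves one cell less per period.
    set ψ₂ : Equiv.Perm (ℤ × Y) := ψ₁ * split Y M 0 with hψ2
    have hψ₂ : Mono ψ₂ := hψ₁.mul (mono_split _ _)
    have hS₂ : ψ₂ * shift Y ^ M = shift Y * ψ₂ := by
      rw [hψ2, mul_assoc, split_mul_pow (by omega), ← mul_assoc, hS₁, mul_assoc]
    have hcell₂ : ∀ k, IsCell fun y => ψ₂ (k, y) := by
      intro k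
      obtain ⟨q, r, rfl, hr0, hr⟩ := exists_index (m := M) (by omega) k
      rcases hr0.eq_or_lt with rfl | hr0
      · have h1 : IsCell fun y => ψ₂ (0, y) := by
          refine ⟨ν, e, fun y => ?_⟩
          obtain ⟨⟨b, y⟩, rfl⟩ := sp.symm.surjective y
          have := split_eq (Y := Y) (m := M) (i := 0) (q := 0) (y := y) (by omega) b
          simp only [mul_zero, Nat.cast_zero, zero_add] at this
          simp only
          rw [hψ2, Equiv.Perm.mul_apply, this, hv, ← cell_succ, h]
          cases b
          · simp [hn1, ha1]
          · simp only [Bool.toNat_true, Nat.cast_one]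
            rw [add_comm, hn2, ha2]
        obtain h2 := h1.shift_zpow q
        simpa only [shift_conj_cell hS₂ q 0] using h2
      · have : ∀ y, ψ₂ (M * q + r, y) = ψ ((M + 1 : ℕ) * q + (r + 1) + k₁, y) := by
          intro y
          rw [hψ2, Equiv.Perm.mul_apply, split_gt (by omega) (by simpa using hr0) hr, hv]
        simp only [this]
        exact ⟨_, _, h _⟩
    have hfr := ih hψ₂ hcell₂ (by omega) hS₂
    have h5 := (hfr.split (i := 0) (by omega)).shift k₁
    have : (system Y).S ^ k₁ * ((system Y).σ (m + 1) 0 * ψ₂⁻¹) = ψ⁻¹ := by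
      rw [hψ2, hψ1]
      simp only [mul_inv_rev, system]
      rw [← hM, mul_inv_cancel_left, mul_inv_cancel_left]
    rwa [this] at h5

/-- A change of labelled partition. -/
def IsChange (φ : Equiv.Perm (ℤ × Y)) : Prop :=
  ∃ m c c', (system Y).Frame m c ∧ (system Y).Frame m c' ∧ φ = c'⁻¹ * c

/-- The uniform partition is obtained from the recognition theorem, without writing it as a sequence
of splittings. -/
theorem frame_double (N : ℕ) : (system Y).Frame (2 ^ N) (double Y ^ N) := by
  have h : Mono (double Y ^ N) := (monoGroup Y).pow_mem mono_double N
  have h1 := Mono.frame_inv (ψ := (double Y ^ N)⁻¹) (m := 2 ^ N) (by positivity) h.inv ?_ fun k => ⟨N, k, fun _ => rfl⟩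
  · rwa [inv_inv] at h1
  · have := double_pow_shift (Y := Y) N 1
    rw [mul_one, zpow_one] at this
    rw [inv_mul_eq_iff_eq_mul, ← mul_assoc, this, mul_inv_cancel_right, ← zpow_natCast]
    simp

theorem IsChange.mono {φ : Equiv.Perm (ℤ × Y)} (h : IsChange φ) : Mono φ := by
  obtain ⟨m, c, c', hc, hc', rfl⟩ := h
  exact (frame_mono hc').inv.mul (frame_mono hc)

theorem IsChange.commute {φ : Equiv.Perm (ℤ × Y)} (h : IsChange φ) : Commute φ (shift Y) := by
  obtain ⟨m, c, c', hc, hc', rfl⟩ := h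
  have h1 : shift Y ^ m * c = c * shift Y := hc.pow_mul
  have h2 : shift Y ^ m * c' = c' * shift Y := hc'.pow_mul
  rw [Commute, SemiconjBy, mul_assoc, ← h1, ← mul_assoc, ← mul_assoc,
    inv_mul_eq_iff_eq_mul.mpr]
  rw [← mul_assoc, ← h2, mul_inv_cancel_right]

/-- A map of the line that carries small dyadic intervals to dyadic intervals. -/
def CellMap (φ : Equiv.Perm (ℤ × Y)) : Prop :=
  ∀ x, ∃ (n : ℕ) (a : ℤ) (y : Y) (n' : ℕ) (a' : ℤ), x = (double Y ^ n)⁻¹ (a, y) ∧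
    ∀ z, φ ((double Y ^ n)⁻¹ (a, z)) = (double Y ^ n')⁻¹ (a', z)

theorem IsChange.cellMap {φ : Equiv.Perm (ℤ × Y)} (h : IsChange φ) : CellMap φ := by
  obtain ⟨m, c, c', hc, hc', rfl⟩ := h
  intro x
  obtain ⟨⟨k, y⟩, rfl⟩ := (c⁻¹ : Equiv.Perm _).surjective x
  obtain ⟨n, a, h⟩ := frame_isCell hc k
  obtain ⟨n', a', h'⟩ := frame_isCell hc' k
  refine ⟨n, a, y, n', a', h y, fun z => ?_⟩
  rw [← h, ← h', Equiv.Perm.mul_apply, ← Equiv.Perm.mul_apply c, mul_inv_cancel,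
    Equiv.Perm.one_apply]

/-- The uniform partition of depth `N` serves as source and its image under `φ` as target;
equivariance reduces the hypothesis to the cells of one period. -/
theorem IsChange.of_cells {φ : Equiv.Perm (ℤ × Y)} (hφ : Mono φ) (hS : Commute φ (shift Y))
    {N : ℕ} (h : ∀ k : ℤ, 0 ≤ k → k < 2 ^ N → IsCell fun y => φ ((double Y ^ N)⁻¹ (k, y))) :
    IsChange φ := by
  have hδ : Mono (double Y ^ N)⁻¹ := ((monoGroup Y).pow_mem mono_double N : Mono _).inv
  have hfr := frame_double (Y := Y) N
  have hS' : φ * (double Y ^ N)⁻¹ * shift Y ^ 2 ^ N = shift Y * (φ * (double Y ^ N)⁻¹) := by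
    have h1 : shift Y ^ 2 ^ N * double Y ^ N = double Y ^ N * shift Y := hfr.pow_mul
    rw [← mul_assoc, ← hS.eq, mul_assoc, mul_assoc]
    congr 1
    rw [inv_mul_eq_iff_eq_mul, ← mul_assoc, ← h1, mul_inv_cancel_right]
  refine ⟨2 ^ N, double Y ^ N, (φ * (double Y ^ N)⁻¹)⁻¹, hfr,
    Mono.frame_inv (by positivity) (hφ.mul hδ) hS' fun k => ?_, by simp⟩
  obtain ⟨q, r, rfl, hr0, hr⟩ := exists_index (m := (2 ^ N : ℕ)) (by positivity) k
  simp only [shift_conj_cell hS' q r]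
  exact IsCell.shift_zpow (h r hr0 (by exact_mod_cast hr)) q

theorem isChange_shift : IsChange (shift Y) :=
  ⟨1, shift Y * 1, 1, (SplitSystem.Frame.one (D := system Y)).shift_one, .one,
    by simp⟩

/-- The left endpoints of dyadic intervals. -/
def IsBase (x : ℤ × Y) : Prop := ∃ (n : ℕ) (a : ℤ), x = (double Y ^ n)⁻¹ (a, ⊥)

theorem frame_isBase {m : ℕ} {c : Equiv.Perm (ℤ × Y)} (hc : (system Y).Frame m c) (k : ℤ) :
    IsBase (c⁻¹ (k, ⊥)) := by
  obtain ⟨n, a, h⟩ := frame_isCell hc k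
  exact ⟨n, a, h ⊥⟩

theorem IsBase.shift_zpow {x : ℤ × Y} (hx : IsBase x) (j : ℤ) : IsBase ((shift Y ^ j) x) := by
  obtain ⟨n, a, rfl⟩ := hx
  exact ⟨n, _, shift_zpow_cell j n a ⊥⟩

theorem bot_eq : (⊥ : Y) = sp.symm (false, ⊥) := by rw [Equiv.eq_symm_apply, sp_bot]

theorem split_base {m i : ℕ} (hi : i < m) : split Y m i ((i : ℤ), ⊥) = ((i : ℤ), ⊥) := by
  have := split_eq (Y := Y) (q := 0) (y := ⊥) hi false
  rw [← bot_eq] at this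
  simpa using this

theorem split_zero_bot {m i : ℕ} (hi : i < m) : split Y m i (0, ⊥) = (0, ⊥) := by
  obtain rfl | h := Nat.eq_zero_or_pos i
  · exact split_base hi
  · simpa using split_lt (Y := Y) (q := 0) (r := 0) (y := ⊥) le_rfl (by omega) hi

theorem isChange_move {m : ℕ} {c : Equiv.Perm (ℤ × Y)} (hc : (system Y).Frame m c) {i j : ℕ}
    (hi : i < m) (hj : j < m) : IsChange (c⁻¹ * ((split Y m i)⁻¹ * split Y m j) * c) :=
  ⟨m + 1, _, _, hc.split hj, hc.split hi, by simp only [mul_inv_rev, mul_assoc]; rfl⟩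

/-- Every splitting fixes the left endpoint of cell 0, so moves have a dyadic fixed point. -/
theorem move_base {m : ℕ} (c : Equiv.Perm (ℤ × Y)) {i j : ℕ} (hi : i < m) (hj : j < m) :
    (c⁻¹ * ((split Y m i)⁻¹ * split Y m j) * c) (c⁻¹ (0, ⊥)) = c⁻¹ (0, ⊥) := by
  have h : (split Y m i)⁻¹ (0, ⊥) = (0, ⊥) := by
    rw [Equiv.Perm.inv_eq_iff_eq, split_zero_bot hi]
  rw [← Equiv.Perm.mul_apply, mul_assoc, mul_inv_cancel, mul_one]
  simp only [Equiv.Perm.mul_apply, split_zero_bot hj, h]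

theorem isChange_rot {m : ℕ} {c : Equiv.Perm (ℤ × Y)} (hc : (system Y).Frame m c) (hm : 3 ≤ m) :
    IsChange (c⁻¹ * ((split Y m 0)⁻¹ * split Y m 2 * shift Y) * c) :=
  ⟨m + 1, _, _, hc.shift_one.split (i := 2) (by omega), hc.split (i := 0) (by omega), by
    simp only [mul_inv_rev, mul_assoc]; rfl⟩

/-- The shift takes the endpoint 1 to 2, splitting cell 2 keeps its left endpoint, and undoing the
splitting of cell 0 returns 2 to 1. The rotation alone has no fixed point, so it could not be cut
off. -/
theorem rot_base {m : ℕ} (c : Equiv.Perm (ℤ × Y)) (hm : 3 ≤ m) :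
    (c⁻¹ * ((split Y m 0)⁻¹ * split Y m 2 * shift Y) * c) (c⁻¹ (1, ⊥)) = c⁻¹ (1, ⊥) := by
  have h : (split Y m 0)⁻¹ (2, ⊥) = (1, ⊥) := by
    rw [Equiv.Perm.inv_eq_iff_eq]
    have := split_gt (Y := Y) (m := m) (i := 0) (q := 0) (r := 1) (y := ⊥) (by omega) (by simp)
      (by omega)
    simp only [mul_zero, zero_add] at this
    exact this.symm
  have h2 : split Y m 2 (2, ⊥) = (2, ⊥) := by
    exact_mod_cast split_base (Y := Y) (m := m) (i := 2) (by omega)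
  rw [← Equiv.Perm.mul_apply, mul_assoc, mul_inv_cancel, mul_one]
  simp only [Equiv.Perm.mul_apply, shift_apply, one_add_one_eq_two, h2, h]

/-- A partial homomorphism that is defined on the changes of labelled partition that have a dyadic
fixed point, that kills the shift, and that sends two particular moves to commuting elements kills
all changes of labelled partition. -/
theorem IsChange.mem_graphKer {Q : Type*} [Group Q] {R : Subgroup (Equiv.Perm (ℤ × Y) × Q)}
    (hfun : ∀ {q}, ((1 : Equiv.Perm (ℤ × Y)), q) ∈ R → q = 1) (hS : (shift Y, 1) ∈ R)
    (hdom : ∀ φ x, IsChange φ → IsBase x → φ x = x → ∃ q, (φ, q) ∈ R)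
    {m₀ : ℕ} {c₀ : Equiv.Perm (ℤ × Y)} (hc₀ : (system Y).Frame m₀ c₀) (hm₀ : 3 ≤ m₀)
    (hcomm : ∃ p q, (c₀⁻¹ * ((split Y m₀ 1)⁻¹ * split Y m₀ 0) * c₀, p) ∈ R ∧
      (c₀⁻¹ * ((split Y m₀ 0)⁻¹ * split Y m₀ 2) * c₀, q) ∈ R ∧ Commute p q)
    {φ : Equiv.Perm (ℤ × Y)} (hφ : IsChange φ) : (φ, 1) ∈ R := by
  have hdom' : ∀ φ x, IsChange φ → IsBase x → φ x = x → φ ∈ R.map (MonoidHom.fst _ Q) := by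
    intro φ x h1 h2 h3
    obtain ⟨q, hq⟩ := hdom φ x h1 h2 h3
    exact ⟨_, hq, rfl⟩
  obtain ⟨m, c, c', hc, hc', rfl⟩ := hφ
  exact SplitSystem.Frame.mem_graphKer_of_commute (D := system Y) hfun hS
    (fun hc _ _ hi hj => hdom' _ _ (isChange_move hc hi hj) (frame_isBase hc 0)
      (move_base _ hi hj))
    (fun hc hm => hdom' _ _ (isChange_rot hc hm) (frame_isBase hc 1) (rot_base _ hm))
    hc₀ hm₀ hcomm hc hc'

/-! ### Germs at a fixed point -/

section Germ

variable {P : Type*} [TopologicalSpace P]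

/-- A normal subgroup that contains an element moving `U` off itself contains all commutators of
elements supported in `U`. -/
theorem commutator_mem {G : Subgroup (P ≃ₜ P)} {N : Subgroup G} [hN : N.Normal] {f : G} (hf : f ∈ N)
    {U : Set P} (hU : ∀ p ∈ U, f.1 p ∉ U) (g h : G) (hg : ∀ p ∉ U, g.1 p = p)
    (hh : ∀ p ∉ U, h.1 p = p) : g * h * g⁻¹ * h⁻¹ ∈ N := by
  have hg' : ∀ p ∉ U, g.1.symm p = p := fun p hp => by
    rw [Homeomorph.symm_apply_eq, hg p hp]
  -- The conjugate `f * g⁻¹ * f⁻¹` is supported on the image of `U`, hence away from `U`, and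
  -- commutes with `h`.
  have hk : ∀ p ∈ U, (f * g⁻¹ * f⁻¹).1 p = p := by
    intro p hp
    change f.1 (g.1.symm (f.1.symm p)) = p
    rw [hg', Homeomorph.apply_symm_apply]
    intro h
    exact hU _ h (by rwa [Homeomorph.apply_symm_apply])
  have hcomm : (f * g⁻¹ * f⁻¹) * h = h * (f * g⁻¹ * f⁻¹) := by
    generalize f * g⁻¹ * f⁻¹ = k at hk
    apply Subtype.ext
    ext p
    change k.1 (h.1 p) = h.1 (k.1 p)
    by_cases hp : p ∈ U
    · have : h.1 p ∈ U := by
        by_contra hn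
        have := h.1.injective (hh _ hn)
        rw [this] at hn
        exact hn hp
      rw [hk p hp, hk _ this]
    · rw [hh p hp]
      by_cases hkp : k.1 p ∈ U
      · have := k.1.injective (hk _ hkp)
        rw [this] at hkp
        exact absurd hkp hp
      · rw [hh _ hkp]
  -- Writing `k` for that conjugate, `g * k` lies in `N` and has the same commutator with `h` as `g`
  -- has.
  have hx : g * (f * g⁻¹ * f⁻¹) ∈ N := by
    have := N.mul_mem (hN.conj_mem _ hf g) (N.inv_mem hf)
    simpa only [mul_assoc] using this
  have := N.mul_mem hx (hN.conj_mem _ (N.inv_mem hx) h)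
  generalize f * g⁻¹ * f⁻¹ = k at this hcomm
  have e : g * k * (h * (g * k)⁻¹ * h⁻¹) = g * h * g⁻¹ * h⁻¹ := by
    rw [mul_inv_rev]
    have : k * h * k⁻¹ = h := by rw [hcomm, mul_inv_cancel_right]
    calc _ = g * (k * h * k⁻¹) * g⁻¹ * h⁻¹ := by simp only [mul_assoc]
      _ = _ := by rw [this]
  rwa [e] at this

/-- Every change of labelled partition is the germ (in a coordinate `θ`) of an element of `N`, for a
normal subgroup `N` of `G`, provided that `N` contains the elements with trivial germ, an element
whose germ is the shift, and the commutators of elements with small support, and that the changes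
with a fixed point can be cut off at that point. -/
theorem exists_mem_of_isChange {G : Subgroup (P ≃ₜ P)} {N : Subgroup G} [N.Normal] {B : Subgroup (P ≃ₜ P)}
    {θ : ℤ × Y → P} {U : Set P} {K₀ : ℤ}
    (htriv : ∀ f : G, f.1 ∈ B → (∃ K : ℤ, ∀ x : ℤ × Y, x.1 ≤ K → f.1 (θ x) = θ x) → f ∈ N)
    (hshift : ∃ f : G, f.1 ∈ B ∧ f ∈ N ∧ HasGerm θ f.1 (shift Y))
    (hcut : ∀ φ x, IsChange φ → IsBase x → φ x = x → x.1 ≤ -1 → ∃ f : G, f.1 ∈ B ∧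
      HasGerm θ f.1 φ ∧ ∀ p, f.1 p ≠ p → ∃ z, LT z x ∧ p = θ z)
    (hU : ∀ x : ℤ × Y, x.1 ≤ K₀ → θ x ∈ U)
    (hcomm : ∀ f g : G, (∀ p ∉ U, f.1 p = p) → (∀ p ∉ U, g.1 p = p) → f * g * f⁻¹ * g⁻¹ ∈ N)
    {φ : Equiv.Perm (ℤ × Y)} (hφ : IsChange φ) : ∃ f : G, f.1 ∈ B ∧ f ∈ N ∧ HasGerm θ f.1 φ := by
  -- The graph of the assignment from germs to classes modulo `N` of elements of `B` realizing them.
  -- Monotonicity and equivariance are carried along since composing germs needs them.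
  let R : Subgroup (Equiv.Perm (ℤ × Y) × (G ⧸ N)) :=
    { carrier := {r | Mono r.1 ∧ Commute r.1 (shift Y) ∧
        ∃ f : G, f.1 ∈ B ∧ HasGerm θ f.1 r.1 ∧ r.2 = (f : G ⧸ N)}
      one_mem' := ⟨Mono.one, Commute.one_left _, 1, B.one_mem, ⟨-1, fun x hx => ⟨hx, rfl⟩⟩, rfl⟩
      mul_mem' := by
        rintro ⟨φ, q⟩ ⟨χ, r⟩ ⟨h1, h2, f, hf, h3, h4⟩ ⟨h5, h6, g, hg, h7, h8⟩
        refine ⟨h1.mul h5, h2.mul_left h6, f * g, B.mul_mem hf hg, h3.mul h5 h6 h7, ?_⟩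
        simp only at h4 h8
        simp [h4, h8]
      inv_mem' := by
        rintro ⟨φ, q⟩ ⟨h1, h2, f, hf, h3, h4⟩
        refine ⟨h1.inv, h2.inv_left, f⁻¹, B.inv_mem hf, h3.inv h1 h2, ?_⟩
        simp only at h4
        simp [h4] }
  have hfun : ∀ {q}, ((1 : Equiv.Perm (ℤ × Y)), q) ∈ R → q = 1 := by
    rintro q ⟨-, -, f, hf, ⟨K, hK⟩, h⟩
    simp only at h
    rw [h, QuotientGroup.eq_one_iff]
    exact htriv f hf ⟨K, fun x hx => (hK x hx).2⟩
  have hS : (shift Y, 1) ∈ R := by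
    obtain ⟨f, hf, hN, h⟩ := hshift
    exact ⟨mono_shift, Commute.refl _, f, hf, h, ((QuotientGroup.eq_one_iff f).mpr hN).symm⟩
  have hfix : ∀ {φ : Equiv.Perm (ℤ × Y)}, Commute φ (shift Y) → ∀ {x}, φ x = x → ∀ j : ℤ,
      φ ((shift Y ^ j) x) = (shift Y ^ j) x := by
    intro φ h x hx j
    have := congrArg (fun g => g x) (h.zpow_right j).eq
    simpa only [Equiv.Perm.mul_apply, hx] using this
  -- All translates of a fixed point by the shift are fixed. Moving the cutting point towards `-∞`
  -- makes the support as small as desired.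
  have hcut' : ∀ (K : ℤ) φ x, IsChange φ → IsBase x → φ x = x → ∃ f : G, f.1 ∈ B ∧
      HasGerm θ f.1 φ ∧ ∀ p, f.1 p ≠ p → ∃ z : ℤ × Y, z.1 ≤ K ∧ p = θ z := by
    intro K φ x hφ hx hfx
    obtain ⟨f, hf, h1, h2⟩ := hcut φ ((shift Y ^ (min K (-1) - x.1)) x) hφ (hx.shift_zpow _)
      (hfix hφ.commute hfx _) (by rw [shift_zpow_apply]; simp)
    refine ⟨f, hf, h1, fun p hp => ?_⟩
    obtain ⟨z, hz, rfl⟩ := h2 p hp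
    refine ⟨z, ?_, rfl⟩
    rw [shift_zpow_apply] at hz
    have : z.1 ≤ min K (-1) := by
      rcases hz with h | ⟨h, -⟩
      · simp only at h; omega
      · simp only at h; omega
    exact this.trans (min_le_left _ _)
  have hmem : ∀ {φ : Equiv.Perm (ℤ × Y)}, IsChange φ → ∀ {f : G}, f.1 ∈ B → HasGerm θ f.1 φ →
      (φ, (f : G ⧸ N)) ∈ R := fun hφ f hf h => ⟨hφ.mono, hφ.commute, f, hf, h, rfl⟩
  have hc₀ : (system Y).Frame 4 (double Y ^ 2) := frame_double 2
  have hker : (φ, 1) ∈ R := by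
    refine hφ.mem_graphKer hfun hS ?_ hc₀ (by norm_num) ?_
    · intro φ x hφ hx hfx
      obtain ⟨f, hf, h, -⟩ := hcut' 0 φ x hφ hx hfx
      exact ⟨_, hmem hφ hf h⟩
    · have h1 := isChange_move hc₀ (i := 1) (j := 0) (by norm_num) (by norm_num)
      have h2 := isChange_move hc₀ (i := 0) (j := 2) (by norm_num) (by norm_num)
      obtain ⟨g, hg, hg1, hg2⟩ := hcut' K₀ _ _ h1 (frame_isBase hc₀ 0)
        (move_base _ (by norm_num) (by norm_num))
      obtain ⟨h, hh, hh1, hh2⟩ := hcut' K₀ _ _ h2 (frame_isBase hc₀ 0)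
        (move_base _ (by norm_num) (by norm_num))
      -- Both moves are now realized with support in `U`, so their commutator is in `N` and their
      -- classes commute.
      refine ⟨_, _, hmem h1 hg hg1, hmem h2 hh hh1, ?_⟩
      have hsupp : ∀ k : G, (∀ p, k.1 p ≠ p → ∃ z : ℤ × Y, z.1 ≤ K₀ ∧ p = θ z) →
          ∀ p ∉ U, k.1 p = p := by
        intro k hk p hp
        by_contra hne
        obtain ⟨z, hz, rfl⟩ := hk p hne
        exact hp (hU z hz)
      have := hcomm g h (hsupp g hg2) (hsupp h hh2)
      rw [← QuotientGroup.eq_one_iff] at this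
      simp only [QuotientGroup.mk_mul, QuotientGroup.mk_inv] at this
      rw [mul_inv_eq_one, mul_inv_eq_iff_eq_mul] at this
      exact this
  obtain ⟨-, -, f, hf, h, h1⟩ := hker
  exact ⟨f, hf, (QuotientGroup.eq_one_iff f).mp h1.symm, h⟩

end Germ

end Line

end FiniteGerm

namespace FiniteGerm

namespace Line

variable {Y : Type*} [LinearOrder Y] [OrderBot Y] [Halving Y]

/-- A change of labelled partition maps cells to cells, and adjacent cells to adjacent cells. -/
theorem IsChange.cells {φ : Equiv.Perm (ℤ × Y)} (h : IsChange φ) (x : ℤ × Y) :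
    ∃ (n : ℕ) (a : ℤ) (y : Y) (n' : ℕ) (a' : ℤ), x = (double Y ^ n)⁻¹ (a, y) ∧
      (∀ z, φ ((double Y ^ n)⁻¹ (a, z)) = (double Y ^ n')⁻¹ (a', z)) ∧
      ∃ (m : ℕ) (b : ℤ) (m' : ℕ) (b' : ℤ),
        (∀ z, φ ((double Y ^ m)⁻¹ (b, z)) = (double Y ^ m')⁻¹ (b', z)) ∧
        (2 : ℤ) ^ n * (b + 1) = 2 ^ m * a ∧ (2 : ℤ) ^ n' * (b' + 1) = 2 ^ m' * a' := by
  obtain ⟨m, c, c', hc, hc', rfl⟩ := h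
  obtain ⟨⟨k, y⟩, rfl⟩ := (c⁻¹ : Equiv.Perm _).surjective x
  obtain ⟨n, a, h⟩ := frame_isCell hc k
  obtain ⟨n', a', h'⟩ := frame_isCell hc' k
  obtain ⟨m, b, hm⟩ := frame_isCell hc (k - 1)
  obtain ⟨m', b', hm'⟩ := frame_isCell hc' (k - 1)
  have e1 := (frame_mono hc).inv.next hm
  have e2 := (frame_mono hc').inv.next hm'
  simp only [sub_add_cancel] at h h' hm hm' e1 e2
  rw [h] at e1
  rw [h'] at e2
  refine ⟨n, a, y, n', a', h y, fun z => ?_, m, b, m', b', fun z => ?_, (cell_bot_inj e1).symm,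
    (cell_bot_inj e2).symm⟩
  · rw [← h, ← h', Equiv.Perm.mul_apply, ← Equiv.Perm.mul_apply c, mul_inv_cancel,
      Equiv.Perm.one_apply]
  · rw [← hm, ← hm', Equiv.Perm.mul_apply, ← Equiv.Perm.mul_apply c, mul_inv_cancel,
      Equiv.Perm.one_apply]

end Line

/-! ### The real line as a line of cells -/

/-- The half-open unit interval. -/
abbrev UnitCell : Type := Set.Ico (0 : ℝ) 1

instance : OrderBot UnitCell where
  bot := ⟨0, by simp⟩
  bot_le y := y.2.1

theorem UnitCell.coe_bot : ((⊥ : UnitCell) : ℝ) = 0 := rfl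

noncomputable instance : Halving UnitCell where
  sp :=
    { toFun y := if h : y.1 < 1 / 2 then (false, ⟨2 * y.1, by have := y.2.1; constructor <;> linarith⟩)
        else (true, ⟨2 * y.1 - 1, by have := y.2.2; constructor <;> linarith⟩)
      invFun x := if x.1 then ⟨(1 + x.2.1) / 2, by
          have := x.2.2.1; have := x.2.2.2; constructor <;> linarith⟩
        else ⟨x.2.1 / 2, by have := x.2.2.1; have := x.2.2.2; constructor <;> linarith⟩
      left_inv := by
        rintro ⟨y, hy⟩
        by_cases h : y < 1 / 2
        · simp only [h, dif_pos]; ext; simp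
        · simp only [h]; ext; simp
      right_inv := by
        rintro ⟨b, ⟨y, hy⟩⟩
        have := hy.1
        have := hy.2
        cases b
        · have h : y / 2 < 1 / 2 := by linarith
          simp only [Bool.false_eq_true, if_false, h, dif_pos]; ext1; · rfl
          · ext; simp; ring
        · have h : ¬ (1 + y) / 2 < 1 / 2 := by linarith
          simp only [if_true, h, dif_neg, not_false_eq_true]; ext1; · rfl
          · ext; simp; ring }
  lt_iff := by
    rintro ⟨y, hy⟩ ⟨z, hz⟩
    by_cases h : y < 1 / 2 <;> by_cases h' : z < 1 / 2 <;>
      simp only [Equiv.coe_fn_mk, h, h', dif_pos, dif_neg, not_false_eq_true, Subtype.mk_lt_mk,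
        lt_self_iff_false, false_or, true_and, Bool.lt_iff, reduceCtorEq, and_true, and_false,
        false_and, or_false, iff_true, iff_false]
    · change y < z ↔ 2 * y < 2 * z
      constructor <;> intro <;> linarith
    · linarith
    · linarith
    · change y < z ↔ 2 * y - 1 < 2 * z - 1
      constructor <;> intro <;> linarith
  sp_bot := by
    have : ((⊥ : UnitCell) : ℝ) < 1 / 2 := by rw [UnitCell.coe_bot]; norm_num
    simp only [Equiv.coe_fn_mk, this, dif_pos]
    ext1
    · rfl
    · ext; simp

/-- The real line as a line of unit cells. -/
noncomputable def realEquiv : ℤ × UnitCell ≃ ℝ where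
  toFun x := x.1 + x.2.1
  invFun t := (⌊t⌋, ⟨Int.fract t, Int.fract_nonneg t, Int.fract_lt_one t⟩)
  left_inv := by
    rintro ⟨k, y, hy⟩
    have h1 : ⌊y⌋ = 0 := Int.floor_eq_zero_iff.mpr hy
    ext
    · simp [h1]
    · simp [Int.fract_eq_self.mpr hy]
  right_inv t := by simp

theorem realEquiv_apply (k : ℤ) (y : UnitCell) : realEquiv (k, y) = k + y.1 := rfl

theorem realEquiv_lt {x y : ℤ × UnitCell} : realEquiv x < realEquiv y ↔ Line.LT x y := by
  have key : ∀ x y : ℤ × UnitCell, Line.LT x y → realEquiv x < realEquiv y := by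
    rintro ⟨k, y, hy⟩ ⟨l, z, hz⟩ (h | ⟨h, h'⟩)
    · have h : k < l := h
      have : (k : ℝ) + 1 ≤ l := by exact_mod_cast h
      simp only [realEquiv_apply]
      linarith [hy.1, hy.2, hz.1, hz.2]
    · have h : k = l := h
      have h' : y < z := h'
      simp only [realEquiv_apply, h]
      linarith
  refine ⟨fun h => ?_, key x y⟩
  rcases Line.LT.trichotomy x y with h1 | h1 | h1
  · exact h1
  · rw [h1] at h; exact absurd h (lt_irrefl _)
  · exact absurd (key _ _ h1) h.asymm

theorem realEquiv_shift (x : ℤ × UnitCell) : realEquiv (Line.shift _ x) = realEquiv x + 1 := by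
  obtain ⟨k, y⟩ := x
  rw [Line.shift_apply, realEquiv_apply, realEquiv_apply]
  push_cast; ring

theorem UnitCell.coe_symm (b : Bool) (y : UnitCell) :
    ((Halving.sp.symm (b, y) : UnitCell) : ℝ) = ((b.toNat : ℝ) + y.1) / 2 := by
  cases b <;> simp [Halving.sp]

theorem realEquiv_double (x : ℤ × UnitCell) :
    realEquiv (Line.double _ x) = 2 * realEquiv x := by
  obtain ⟨k, y⟩ := x
  obtain ⟨⟨b, y⟩, rfl⟩ := Halving.sp.symm.surjective y
  rw [Line.double_apply, realEquiv_apply, realEquiv_apply, UnitCell.coe_symm]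
  push_cast; ring

theorem realEquiv_double_pow (n : ℕ) (x : ℤ × UnitCell) :
    realEquiv ((Line.double _ ^ n) x) = 2 ^ n * realEquiv x := by
  induction n generalizing x with
  | zero => simp
  | succ n ih => rw [pow_succ', Equiv.Perm.mul_apply, realEquiv_double, ih]; ring

theorem realEquiv_cell (n : ℕ) (a : ℤ) (y : UnitCell) :
    realEquiv ((Line.double _ ^ n)⁻¹ (a, y)) = (a + y.1) / 2 ^ n := by
  have h := realEquiv_double_pow n ((Line.double _ ^ n)⁻¹ (a, y))
  rw [← Equiv.Perm.mul_apply, mul_inv_cancel, Equiv.Perm.one_apply, realEquiv_apply] at h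
  rw [h]; field_simp

/-! ### Piecewise linear dyadic maps -/

/-- Near `t`, the map `F` is piecewise linear with slopes powers of two, dyadic translation parts
and at most a dyadic breakpoint. -/
def PLAt (F : ℝ → ℝ) (t : ℝ) : Prop :=
  ∃ (n m : ℤ) (b c : ℝ), IsDyadic b ∧ IsDyadic c ∧
    (∀ᶠ s in 𝓝[≥] t, F s = (2 : ℝ) ^ n * s + b) ∧ (∀ᶠ s in 𝓝[≤] t, F s = (2 : ℝ) ^ m * s + c) ∧
    (IsDyadic t ∨ n = m ∧ b = c)

theorem eventually_nhds_iff_sides {t : ℝ} {P : ℝ → Prop} :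
    (∀ᶠ s in 𝓝 t, P s) ↔ (∀ᶠ s in 𝓝[≥] t, P s) ∧ ∀ᶠ s in 𝓝[≤] t, P s := by
  rw [← nhdsLE_sup_nhdsGE t, eventually_sup, and_comm]

theorem plAt_affine (n : ℤ) {b : ℝ} (hb : IsDyadic b) {F : ℝ → ℝ} {t : ℝ}
    (h : ∀ᶠ s in 𝓝 t, F s = (2 : ℝ) ^ n * s + b) : PLAt F t := by
  rw [eventually_nhds_iff_sides] at h
  exact ⟨n, n, b, b, hb, hb, h.1, h.2, Or.inr ⟨rfl, rfl⟩⟩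

theorem PLAt.congr {F G : ℝ → ℝ} {t : ℝ} (hG : PLAt G t) (h : ∀ᶠ s in 𝓝 t, F s = G s) :
    PLAt F t := by
  obtain ⟨n, m, b, c, hb, hc, h1, h2, h3⟩ := hG
  rw [eventually_nhds_iff_sides] at h
  refine ⟨n, m, b, c, hb, hc, ?_, ?_, h3⟩
  · filter_upwards [h1, h.1] with s h1 h2 using h2.trans h1
  · filter_upwards [h2, h.2] with s h1 h2 using h2.trans h1

theorem tendsto_affine_ge (n : ℤ) (b t : ℝ) :
    Tendsto (fun s : ℝ => (2 : ℝ) ^ n * s + b) (𝓝[≥] t) (𝓝[≥] ((2 : ℝ) ^ n * t + b)) := by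
  have hc : Continuous (fun s : ℝ => (2 : ℝ) ^ n * s + b) := by fun_prop
  refine tendsto_nhdsWithin_iff.mpr ⟨(hc.tendsto t).mono_left nhdsWithin_le_nhds, ?_⟩
  filter_upwards [self_mem_nhdsWithin] with s hs
  have : (0 : ℝ) < 2 ^ n := by positivity
  simp only [Set.mem_Ici] at hs ⊢
  nlinarith

theorem tendsto_affine_le (n : ℤ) (b t : ℝ) :
    Tendsto (fun s : ℝ => (2 : ℝ) ^ n * s + b) (𝓝[≤] t) (𝓝[≤] ((2 : ℝ) ^ n * t + b)) := by
  have hc : Continuous (fun s : ℝ => (2 : ℝ) ^ n * s + b) := by fun_prop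
  refine tendsto_nhdsWithin_iff.mpr ⟨(hc.tendsto t).mono_left nhdsWithin_le_nhds, ?_⟩
  filter_upwards [self_mem_nhdsWithin] with s hs
  have : (0 : ℝ) < 2 ^ n := by positivity
  simp only [Set.mem_Iic] at hs ⊢
  nlinarith

theorem self_of_ge {t : ℝ} {P : ℝ → Prop} (h : ∀ᶠ s in 𝓝[≥] t, P s) : P t :=
  h.self_of_nhdsWithin (Set.mem_Ici.mpr le_rfl)

theorem self_of_le {t : ℝ} {P : ℝ → Prop} (h : ∀ᶠ s in 𝓝[≤] t, P s) : P t :=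
  h.self_of_nhdsWithin (Set.mem_Iic.mpr le_rfl)

theorem PLAt.isDyadic_iff {F : ℝ → ℝ} {t : ℝ} (h : PLAt F t) : IsDyadic (F t) ↔ IsDyadic t := by
  obtain ⟨n, m, b, c, hb, hc, h1, h2, h3⟩ := h
  rw [self_of_ge h1, isDyadic_iff_affine n hb]

theorem PLAt.comp {F G : ℝ → ℝ} {t : ℝ} (hG : PLAt G (F t)) (hF : PLAt F t) :
    PLAt (fun s => G (F s)) t := by
  have hd := hF.isDyadic_iff
  obtain ⟨n, m, b, c, hb, hc, h1, h2, h3⟩ := hF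
  obtain ⟨n', m', b', c', hb', hc', h1', h2', h3'⟩ := hG
  have e1 := self_of_ge h1
  have e2 := self_of_le h2
  refine ⟨n' + n, m' + m, (2 : ℝ) ^ n' * b + b', (2 : ℝ) ^ m' * c + c', (hb.zpow_mul _).add hb',
    (hc.zpow_mul _).add hc', ?_, ?_, ?_⟩
  · rw [e1] at h1'
    filter_upwards [h1, (tendsto_affine_ge n b t).eventually h1'] with s h3 h4
    rw [h3, h4, zpow_add₀ two_ne_zero]; ring
  · rw [e2] at h2'
    filter_upwards [h2, (tendsto_affine_le m c t).eventually h2'] with s h3 h4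
    rw [h3, h4, zpow_add₀ two_ne_zero]; ring
  · rw [hd] at h3'
    rcases h3 with h | ⟨rfl, rfl⟩
    · exact Or.inl h
    · rcases h3' with h | ⟨rfl, rfl⟩
      · exact Or.inl h
      · exact Or.inr ⟨rfl, rfl⟩

theorem affine_inv_apply (n : ℤ) (b s : ℝ) :
    (2 : ℝ) ^ n * ((2 : ℝ) ^ (-n) * s + -((2 : ℝ) ^ (-n) * b)) + b = s := by
  rw [zpow_neg]; field_simp; ring

theorem affine_inv_apply' (n : ℤ) (b s : ℝ) :
    (2 : ℝ) ^ (-n) * ((2 : ℝ) ^ n * s + b) + -((2 : ℝ) ^ (-n) * b) = s := by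
  rw [zpow_neg]; field_simp; ring

theorem PLAt.inv {F G : ℝ → ℝ} {t : ℝ} (hF : PLAt F t) (h : ∀ᶠ s in 𝓝 t, G (F s) = s) :
    PLAt G (F t) := by
  have hd := hF.isDyadic_iff
  obtain ⟨n, m, b, c, hb, hc, h1, h2, h3⟩ := hF
  rw [eventually_nhds_iff_sides] at h
  have e1 := self_of_ge h1
  have e2 := self_of_le h2
  refine ⟨-n, -m, -((2 : ℝ) ^ (-n) * b), -((2 : ℝ) ^ (-m) * c), (hb.zpow_mul _).neg,
    (hc.zpow_mul _).neg, ?_, ?_, ?_⟩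
  · have := tendsto_affine_ge (-n) (-((2 : ℝ) ^ (-n) * b)) (F t)
    rw [e1, affine_inv_apply'] at this
    rw [e1]
    filter_upwards [this.eventually h1, this.eventually h.1] with s h3 h4
    rw [h3, affine_inv_apply] at h4
    exact h4
  · have := tendsto_affine_le (-m) (-((2 : ℝ) ^ (-m) * c)) (F t)
    rw [e2, affine_inv_apply'] at this
    rw [e2]
    filter_upwards [this.eventually h2, this.eventually h.2] with s h3 h4
    rw [h3, affine_inv_apply] at h4
    exact h4
  · rw [hd]
    rcases h3 with h | ⟨rfl, rfl⟩
    · exact Or.inl h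
    · exact Or.inr ⟨rfl, rfl⟩

/-- The map of the real line that corresponds to a permutation of the line of unit cells. -/
noncomputable def realMap (φ : Equiv.Perm (ℤ × UnitCell)) : ℝ ≃ ℝ :=
  realEquiv.symm.trans (φ.trans realEquiv)

theorem realMap_realEquiv (φ : Equiv.Perm (ℤ × UnitCell)) (x : ℤ × UnitCell) :
    realMap φ (realEquiv x) = realEquiv (φ x) := by simp [realMap]

theorem strictMono_realMap {φ : Equiv.Perm (ℤ × UnitCell)} (h : Line.Mono φ) :
    StrictMono (realMap φ) := by
  intro s t hst
  obtain ⟨x, rfl⟩ := realEquiv.surjective s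
  obtain ⟨y, rfl⟩ := realEquiv.surjective t
  rw [realMap_realEquiv, realMap_realEquiv, realEquiv_lt]
  exact h _ _ (realEquiv_lt.mp hst)

theorem realMap_add_one {φ : Equiv.Perm (ℤ × UnitCell)} (h : Commute φ (Line.shift _)) (t : ℝ) :
    realMap φ (t + 1) = realMap φ t + 1 := by
  obtain ⟨x, rfl⟩ := realEquiv.surjective t
  rw [← realEquiv_shift, realMap_realEquiv, realMap_realEquiv, ← realEquiv_shift]
  congr 1
  exact congrArg (fun g => g x) h.eq

theorem cell_affine {φ : Equiv.Perm (ℤ × UnitCell)} {n n' : ℕ} {a a' : ℤ}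
    (h : ∀ z, φ ((Line.double _ ^ n)⁻¹ (a, z)) = (Line.double _ ^ n')⁻¹ (a', z)) {s : ℝ}
    (h1 : (a : ℝ) / 2 ^ n ≤ s) (h2 : s < (a + 1) / 2 ^ n) :
    realMap φ s = (2 : ℝ) ^ ((n : ℤ) - n') * s + (a' - a) / 2 ^ n' := by
  have hp : (0 : ℝ) < 2 ^ n := by positivity
  rw [div_le_iff₀ hp] at h1
  rw [lt_div_iff₀ hp] at h2
  have hs : s = realEquiv ((Line.double _ ^ n)⁻¹ (a, ⟨s * 2 ^ n - a, by linarith, by linarith⟩)) := by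
    rw [realEquiv_cell]; field_simp; ring
  conv_lhs => rw [hs]
  rw [realMap_realEquiv, h, realEquiv_cell, zpow_sub₀ two_ne_zero, zpow_natCast, zpow_natCast]
  field_simp
  ring

/-- Inside a cell the map is affine. At the left endpoint of a cell, which is dyadic, the cell
itself gives the right piece and its predecessor the left piece. -/
theorem plAt_realMap {φ : Equiv.Perm (ℤ × UnitCell)} (hφ : Line.IsChange φ) (t : ℝ) :
    PLAt (realMap φ) t := by
  obtain ⟨x, rfl⟩ := realEquiv.surjective t
  obtain ⟨n, a, y, n', a', rfl, h, m, b, m', b', h', e1, e2⟩ := hφ.cells x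
  have hp : (0 : ℝ) < 2 ^ n := by positivity
  have hp' : (0 : ℝ) < 2 ^ m := by positivity
  rw [realEquiv_cell]
  have hy := y.2
  have hlt : ((a : ℝ) + y.1) / 2 ^ n < (a + 1) / 2 ^ n := by gcongr; exact hy.2
  have hd : ∀ (a' a : ℤ) (n' : ℕ), IsDyadic (((a' : ℝ) - a) / 2 ^ n') := fun a' a n' =>
    ⟨a' - a, n', by push_cast; ring⟩
  rcases hy.1.eq_or_lt with h0 | h0
  · rw [← h0, add_zero] at hlt ⊢
    have hab : ((b : ℝ) + 1) / 2 ^ m = a / 2 ^ n := by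
      rw [div_eq_div_iff hp'.ne' hp.ne']
      have : (2 : ℝ) ^ n * (b + 1) = 2 ^ m * a := by exact_mod_cast e1
      linarith
    have hab' : ((b' : ℝ) + 1) / 2 ^ m' = a' / 2 ^ n' := by
      rw [div_eq_div_iff (by positivity) (by positivity)]
      have : (2 : ℝ) ^ n' * (b' + 1) = 2 ^ m' * a' := by exact_mod_cast e2
      linarith
    refine ⟨(n : ℤ) - n', (m : ℤ) - m', ((a' : ℝ) - a) / 2 ^ n', ((b' : ℝ) - b) / 2 ^ m', hd a' a n',
      hd b' b m', ?_, ?_, Or.inl ⟨a, n, rfl⟩⟩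
    · filter_upwards [Ico_mem_nhdsGE hlt] with s hs
      exact cell_affine h hs.1 hs.2
    · have hlt' : (b : ℝ) / 2 ^ m < a / 2 ^ n := by rw [← hab]; gcongr; linarith
      filter_upwards [Ioc_mem_nhdsLE hlt'] with s hs
      -- Cells are half-open, so the formula of the preceding cell is checked separately at the
      -- endpoint; it holds there because both the source and the target cells are adjacent.
      rcases hs.2.eq_or_lt with h3 | h3
      · rw [h3, cell_affine h le_rfl hlt, ← hab, zpow_sub₀ two_ne_zero, zpow_sub₀ two_ne_zero,
          zpow_natCast, zpow_natCast, zpow_natCast, zpow_natCast]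
        have e3 : (2 : ℝ) ^ n / 2 ^ n' * ((b + 1) / 2 ^ m) + (a' - a) / 2 ^ n' = a' / 2 ^ n' := by
          rw [hab]; field_simp; ring
        rw [e3, ← hab']
        field_simp
        ring
      · exact cell_affine h' hs.1.le (by rw [hab]; exact h3)
  · refine plAt_affine ((n : ℤ) - n') (hd a' a n') ?_
    have hlt' : (a : ℝ) / 2 ^ n < (a + y.1) / 2 ^ n := by gcongr; linarith
    filter_upwards [Ioo_mem_nhds hlt' hlt] with s hs
    exact cell_affine h hs.1.le hs.2

/-- A piecewise linear dyadic map has the required form on all sufficiently short standard dyadic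
intervals near a given point. -/
theorem PLAt.eventually_cell {F : ℝ → ℝ} {t : ℝ} (h : PLAt F t) :
    ∃ U ∈ 𝓝 t, ∃ N₀ : ℕ, ∀ N ≥ N₀, ∀ k : ℤ, (∃ s ∈ Set.Icc ((k : ℝ) / 2 ^ N) ((k + 1) / 2 ^ N),
      s ∈ U) → ∃ (n : ℕ) (a : ℤ), ∀ y ∈ Set.Ico (0 : ℝ) 1, F ((k + y) / 2 ^ N) = (a + y) / 2 ^ n := by
  obtain ⟨n, m, b, c, ⟨b, j, rfl⟩, ⟨c, l, rfl⟩, h1, h2, h3⟩ := h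
  obtain ⟨ε, hε, h1⟩ := Metric.mem_nhdsWithin_iff.mp h1
  obtain ⟨η, hη, h2⟩ := Metric.mem_nhdsWithin_iff.mp h2
  set ζ := min ε η with hζ
  have hζ0 : 0 < ζ := lt_min hε hη
  have h1' : ∀ s, t ≤ s → |s - t| < ζ → F s = (2 : ℝ) ^ n * s + b / 2 ^ j := fun s hs hs' =>
    h1 ⟨by rw [Metric.mem_ball, Real.dist_eq]; exact hs'.trans_le (min_le_left _ _), hs⟩
  have h2' : ∀ s, s ≤ t → |s - t| < ζ → F s = (2 : ℝ) ^ m * s + c / 2 ^ l := fun s hs hs' =>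
    h2 ⟨by rw [Metric.mem_ball, Real.dist_eq]; exact hs'.trans_le (min_le_right _ _), hs⟩
  obtain ⟨N₁, hN₁⟩ : ∃ N₁ : ℕ, (1 / 2 : ℝ) ^ N₁ < ζ / 2 :=
    exists_pow_lt_of_lt_one (by linarith) (by norm_num)
  -- Slope `2 ^ n` turns an interval of depth `N` into one of depth `n' = N - n`; the bound on `N`
  -- ensures `j ≤ n'`, so the translation part is a multiple of the new length.
  have hnum : ∀ (n : ℤ) (b : ℤ) (j N : ℕ) (k : ℤ), n.toNat + j + n.toNat ≤ N →
      ∃ (n' : ℕ) (a : ℤ), ∀ y : ℝ,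
        (2 : ℝ) ^ n * ((k + y) / 2 ^ N) + b / 2 ^ j = (a + y) / 2 ^ n' := by
    intro n b j N k hN
    obtain ⟨n', hn'⟩ : ∃ n' : ℕ, (n' : ℤ) = N - n := ⟨(N - n).toNat, by omega⟩
    have hj : j ≤ n' := by omega
    refine ⟨n', k + b * 2 ^ (n' - j), fun y => ?_⟩
    have e1 : (2 : ℝ) ^ n = 2 ^ N / 2 ^ n' := by
      rw [eq_div_iff (by positivity), ← zpow_natCast, ← zpow_natCast, ← zpow_add₀ two_ne_zero, hn']
      congr 1; ring
    have e2 : (2 : ℝ) ^ n' = 2 ^ j * 2 ^ (n' - j) := by rw [← pow_add]; congr 1; omega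
    rw [e1, e2]
    push_cast
    field_simp
    ring
  -- A dyadic `t` is an endpoint of the grid from depth `N₂` on, so no grid interval straddles the
  -- breakpoint.
  obtain ⟨N₂, hN₂⟩ : ∃ N₂ : ℕ, IsDyadic t → ∀ N ≥ N₂, ∃ d : ℤ, t = d / 2 ^ N := by
    by_cases ht : IsDyadic t
    · obtain ⟨d, i, rfl⟩ := ht
      refine ⟨i, fun _ N hN => ⟨d * 2 ^ (N - i), ?_⟩⟩
      have : (2 : ℝ) ^ N = 2 ^ i * 2 ^ (N - i) := by rw [← pow_add]; congr 1; omega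
      rw [this]
      push_cast
      field_simp
    · exact ⟨0, fun h => absurd h ht⟩
  refine ⟨Metric.ball t (ζ / 2), Metric.ball_mem_nhds t (by linarith),
    N₁ + N₂ + (n.toNat + j + n.toNat) + (m.toNat + l + m.toNat), fun N hN k => ?_⟩
  rintro ⟨s, hs, hst⟩
  rw [Metric.mem_ball, Real.dist_eq, abs_lt] at hst
  have hp : (0 : ℝ) < 2 ^ N := by positivity
  have hlen : ((k : ℝ) + 1) / 2 ^ N = k / 2 ^ N + 1 / 2 ^ N := by ring
  have hsmall : (1 : ℝ) / 2 ^ N < ζ / 2 := by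
    refine lt_of_le_of_lt ?_ hN₁
    rw [one_div_pow]
    exact one_div_le_one_div_of_le (by positivity) (pow_le_pow_right₀ (by norm_num) (by omega))
  have hmem : ∀ y ∈ Set.Ico (0 : ℝ) 1, (k : ℝ) / 2 ^ N ≤ (k + y) / 2 ^ N ∧
      ((k : ℝ) + y) / 2 ^ N ≤ (k + 1) / 2 ^ N := by
    intro y hy
    constructor <;> gcongr
    · linarith [hy.1]
    · exact hy.2.le
  have hnear : ∀ y ∈ Set.Ico (0 : ℝ) 1, |(k + y) / 2 ^ N - t| < ζ := by
    intro y hy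
    obtain ⟨h4, h5⟩ := hmem y hy
    rw [abs_lt]
    constructor <;> linarith [hs.1, hs.2]
  by_cases hd : IsDyadic t
  · obtain ⟨d, hd⟩ := hN₂ hd N (by omega)
    rcases le_or_gt d k with hdk | hdk
    · obtain ⟨n', a, h6⟩ := hnum n b j N k (by omega)
      refine ⟨n', a, fun y hy => ?_⟩
      rw [h1' _ ?_ (hnear y hy), h6]
      refine le_trans ?_ (hmem y hy).1
      rw [hd]; gcongr
    · obtain ⟨n', a, h6⟩ := hnum m c l N k (by omega)
      refine ⟨n', a, fun y hy => ?_⟩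
      rw [h2' _ ?_ (hnear y hy), h6]
      refine le_trans (hmem y hy).2 ?_
      rw [hd]; gcongr; exact_mod_cast hdk
  · obtain ⟨rfl, h5⟩ := h3.resolve_left hd
    obtain ⟨n', a, h6⟩ := hnum n b j N k (by omega)
    refine ⟨n', a, fun y hy => ?_⟩
    rw [← h6]
    rcases le_total t ((k + y) / 2 ^ N) with h | h
    · exact h1' _ h (hnear y hy)
    · rw [h2' _ h (hnear y hy), h5]

/-- A periodic piecewise linear dyadic map is a change of labelled partition. -/
theorem isChange_of_plAt {φ : Equiv.Perm (ℤ × UnitCell)} (hφ : Line.Mono φ)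
    (hS : Commute φ (Line.shift _)) (h : ∀ t, PLAt (realMap φ) t) : Line.IsChange φ := by
  have key : ∃ N₀ : ℕ, ∀ N ≥ N₀, ∀ k : ℤ,
      (∃ s ∈ Set.Icc ((k : ℝ) / 2 ^ N) ((k + 1) / 2 ^ N), s ∈ Set.Icc (0 : ℝ) 1) →
      ∃ (n : ℕ) (a : ℤ), ∀ y ∈ Set.Ico (0 : ℝ) 1, realMap φ ((k + y) / 2 ^ N) = (a + y) / 2 ^ n := by
    -- One depth for a whole period, by compactness; the other periods follow from equivariance.
    refine isCompact_Icc.induction_on (p := fun S => ∃ N₀ : ℕ, ∀ N ≥ N₀, ∀ k : ℤ,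
      (∃ s ∈ Set.Icc ((k : ℝ) / 2 ^ N) ((k + 1) / 2 ^ N), s ∈ S) → ∃ (n : ℕ) (a : ℤ),
        ∀ y ∈ Set.Ico (0 : ℝ) 1, realMap φ ((k + y) / 2 ^ N) = (a + y) / 2 ^ n) ?_ ?_ ?_ ?_
    · exact ⟨0, fun N _ k ⟨s, _, hs⟩ => absurd hs (Set.notMem_empty s)⟩
    · rintro S T hST ⟨N₀, hN₀⟩
      exact ⟨N₀, fun N hN k ⟨s, h1, h2⟩ => hN₀ N hN k ⟨s, h1, hST h2⟩⟩
    · rintro S T ⟨N₀, hN₀⟩ ⟨N₁, hN₁⟩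
      refine ⟨max N₀ N₁, fun N hN k ⟨s, h1, h2⟩ => ?_⟩
      rcases h2 with h2 | h2
      · exact hN₀ N (le_trans (le_max_left _ _) hN) k ⟨s, h1, h2⟩
      · exact hN₁ N (le_trans (le_max_right _ _) hN) k ⟨s, h1, h2⟩
    · intro t _
      obtain ⟨U, hU, hN⟩ := (h t).eventually_cell
      exact ⟨U, mem_nhdsWithin_of_mem_nhds hU, hN⟩
  obtain ⟨N, hN⟩ := key
  refine Line.IsChange.of_cells hφ hS (N := N) fun k hk0 hk1 => ?_
  have hp : (0 : ℝ) < 2 ^ N := by positivity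
  have hk0' : (0 : ℝ) ≤ k := by exact_mod_cast hk0
  have hk1' : (k : ℝ) ≤ 2 ^ N := by exact_mod_cast hk1.le
  obtain ⟨n, a, h1⟩ := hN N le_rfl k ⟨k / 2 ^ N, ⟨le_rfl, by gcongr; linarith⟩,
    by positivity, by rw [div_le_one hp]; exact hk1'⟩
  refine ⟨n, a, fun y => ?_⟩
  apply realEquiv.injective
  rw [← realMap_realEquiv, realEquiv_cell, realEquiv_cell]
  exact h1 y.1 y.2

end FiniteGerm

namespace FiniteGerm

/-! ### Lifts of circle homeomorphisms -/

/-- Lifts through the covering `ℝ → ℝ/ℤ` that agree at one point agree everywhere. -/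
theorem eq_add_int_of_coe_eq {F G : ℝ → ℝ} (hF : Continuous F) (hG : Continuous G)
    (h : ∀ s, (F s : UnitAddCircle) = G s) : ∃ k : ℤ, ∀ s, F s = G s + k := by
  obtain ⟨k, hk⟩ := coe_eq_coe (h 0)
  refine ⟨k, fun s => congrFun ((AddCircle.isCoveringMap_coe (1 : ℝ)).eq_of_comp_eq hF
    (g₂ := fun s => G s + k) (by fun_prop) ?_ 0 hk) s⟩
  funext s
  simp only [Function.comp_apply, coe_add_int, h]

theorem exists_continuous_lift {f : UnitAddCircle → UnitAddCircle} (hf : Continuous f) :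
    ∃ F : ℝ → ℝ, Continuous F ∧ ∀ s : ℝ, (F s : UnitAddCircle) = f s := by
  obtain ⟨t, ht⟩ := exists_coe (f ((0 : ℝ) : UnitAddCircle))
  obtain ⟨F, ⟨-, hF⟩, -⟩ := (AddCircle.isCoveringMap_coe (1 : ℝ)).existsUnique_continuousMap_lifts
    ⟨fun s : ℝ => f s, hf.comp (AddCircle.continuous_mk' 1)⟩ 0 t ht
  exact ⟨F, F.continuous, fun s => congrFun hF s⟩

/-- A lift of a circle homeomorphism that preserves the orientation somewhere. -/
theorem exists_lift (f : UnitAddCircle ≃ₜ UnitAddCircle)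
    (hpos : ∀ F : ℝ → ℝ, Continuous F → (∀ s : ℝ, (F s : UnitAddCircle) = f s) →
      ∃ s t, s < t ∧ F s < F t) :
    ∃ F : ℝ ≃o ℝ, (∀ s, F (s + 1) = F s + 1) ∧ ∀ s : ℝ, (F s : UnitAddCircle) = f s := by
  obtain ⟨F, hFc, hF⟩ := exists_continuous_lift f.continuous
  obtain ⟨G, hGc, hG⟩ := exists_continuous_lift f.symm.continuous
  -- Lifts of `f` and of its inverse compose to integer translations, so the lift of `f` is
  -- bijective and therefore monotone or antitone.
  obtain ⟨k, hk⟩ := eq_add_int_of_coe_eq (F := fun s => G (F s)) (G := id) (hGc.comp hFc)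
    continuous_id (fun s => by rw [hG, hF, f.symm_apply_apply]; rfl)
  obtain ⟨l, hl⟩ := eq_add_int_of_coe_eq (F := fun s => F (G s)) (G := id) (hFc.comp hGc)
    continuous_id (fun s => by rw [hF, hG, f.apply_symm_apply]; rfl)
  simp only [id_eq] at hk hl
  have hinj : Function.Injective F := by
    intro s t hst
    have h1 := hk s
    rw [hst, hk t] at h1
    linarith
  have hsurj : Function.Surjective F := fun t => ⟨G (t - l), by rw [hl]; ring⟩
  have hmono : StrictMono F := by
    refine (hFc.strictMono_of_inj hinj).resolve_right fun h => ?_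
    obtain ⟨s, t, hst, hlt⟩ := hpos F hFc hF
    exact (h hst).asymm hlt
  obtain ⟨d, hd⟩ := eq_add_int_of_coe_eq (F := fun s => F (s + 1)) (by fun_prop) hFc
    (fun s => by rw [hF, hF, show s + 1 = s + (1 : ℤ) by simp, coe_add_int])
  obtain ⟨e, he⟩ := eq_add_int_of_coe_eq (F := fun s => G (s + 1)) (by fun_prop) hGc
    (fun s => by rw [hG, hG, show s + 1 = s + (1 : ℤ) by simp, coe_add_int])
  have hGd : ∀ (n : ℕ) s, G (s + n) = G s + n * e := by
    intro n
    induction n with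
    | zero => simp
    | succ n ih => intro s; push_cast; rw [← add_assoc, he, ih]; ring
  have hdpos : 0 < d := by
    have := hmono (show (0 : ℝ) < 0 + 1 by norm_num)
    rw [hd] at this
    have : (0 : ℝ) < d := by linarith
    exact_mod_cast this
  obtain ⟨n, rfl⟩ := Int.eq_ofNat_of_zero_le hdpos.le
  -- The degrees of `f` and of its inverse are integers with product one, and `f` has positive
  -- degree.
  have hde : (n : ℤ) * e = 1 := by
    have h1 := hk (0 + 1)
    rw [hd, Int.cast_natCast, hGd, hk] at h1
    have : (n : ℝ) * e = 1 := by linarith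
    exact_mod_cast this
  have hn : (n : ℤ) = 1 := by
    rcases Int.eq_one_or_neg_one_of_mul_eq_one hde with h | h
    · exact h
    · omega
  refine ⟨StrictMono.orderIsoOfSurjective F hmono hsurj, fun s => ?_, hF⟩
  change F (s + 1) = F s + 1
  rw [hd, hn]; simp

/-- The circle homeomorphism with a given lift. -/
theorem exists_homeo (F : ℝ ≃o ℝ) (hF : ∀ s, F (s + 1) = F s + 1) :
    ∃ f : UnitAddCircle ≃ₜ UnitAddCircle, ∀ s : ℝ, f s = (F s : UnitAddCircle) := by
  have hFs : ∀ s, F.symm (s + 1) = F.symm s + 1 := by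
    intro s
    rw [OrderIso.symm_apply_eq, hF, OrderIso.apply_symm_apply]
  have hper : ∀ {F : ℝ ≃o ℝ}, (∀ s, F (s + 1) = F s + 1) →
      Function.Periodic (fun s : ℝ => (F s : UnitAddCircle)) 1 := by
    intro F hF s
    simp only
    rw [hF, show F s + 1 = F s + (1 : ℤ) by simp, coe_add_int]
  have hcont : ∀ {F : ℝ ≃o ℝ} (hF : ∀ s, F (s + 1) = F s + 1), Continuous (hper hF).lift := by
    intro F hF
    refine isQuotientMap_quotient_mk'.continuous_iff.mpr ?_
    exact (AddCircle.continuous_mk' 1).comp F.continuous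
  refine ⟨{ toFun := (hper hF).lift, invFun := (hper hFs).lift,
            left_inv := ?_, right_inv := ?_, continuous_toFun := hcont hF,
            continuous_invFun := hcont hFs }, fun s => rfl⟩
  · intro p
    obtain ⟨s, rfl⟩ := exists_coe p
    rw [Function.Periodic.lift_coe, Function.Periodic.lift_coe, OrderIso.symm_apply_apply]
  · intro p
    obtain ⟨s, rfl⟩ := exists_coe p
    rw [Function.Periodic.lift_coe, Function.Periodic.lift_coe, OrderIso.apply_symm_apply]

/-! ### Elements of `T` -/

theorem DyadicAffineAt.of_coe_eq {f : UnitAddCircle ≃ₜ UnitAddCircle} {s t : ℝ}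
    (h : DyadicAffineAt f t) (hst : (s : UnitAddCircle) = t) : DyadicAffineAt f s := by
  obtain ⟨k, rfl⟩ := coe_eq_coe hst
  obtain ⟨n, b, hb, h⟩ := h
  refine ⟨n, b - (2 : ℝ) ^ n * k, hb.sub ((IsDyadic.int k).zpow_mul n), ?_⟩
  have hc : Continuous fun s : ℝ => s - k := by fun_prop
  have hlim := hc.tendsto (t + k)
  rw [add_sub_cancel_right] at hlim
  filter_upwards [hlim.eventually h] with s hs
  rw [← coe_add_int (s - k) k, sub_add_cancel] at hs
  rw [hs]
  congr 1; ring

/-- A circle homeomorphism with a piecewise linear dyadic lift is in `T`. -/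
theorem mem_thompsonT_of_plAt {f : UnitAddCircle ≃ₜ UnitAddCircle} {F : ℝ → ℝ}
    (hf : ∀ s : ℝ, (F s : UnitAddCircle) = f s) (h : ∀ t, PLAt F t) : f ∈ thompsonT := by
  have key : ∃ D : Set UnitAddCircle, D.Finite ∧ (∀ p ∈ D, IsDyadicPoint p) ∧
      ∀ t : ℝ, (t : UnitAddCircle) ∈ Set.univ → (t : UnitAddCircle) ∉ D → DyadicAffineAt f t := by
    -- Finiteness of the set of breakpoints is a compactness statement: near each point there is at
    -- most that one breakpoint, and it is dyadic.
    refine isCompact_univ.induction_on (p := fun S => ∃ D : Set UnitAddCircle, D.Finite ∧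
      (∀ p ∈ D, IsDyadicPoint p) ∧
      ∀ t : ℝ, (t : UnitAddCircle) ∈ S → (t : UnitAddCircle) ∉ D → DyadicAffineAt f t) ?_ ?_ ?_ ?_
    · exact ⟨∅, Set.finite_empty, by simp, by simp⟩
    · rintro S S' hS ⟨D, h1, h2, h3⟩
      exact ⟨D, h1, h2, fun t ht => h3 t (hS ht)⟩
    · rintro S S' ⟨D, h1, h2, h3⟩ ⟨D', h1', h2', h3'⟩
      refine ⟨D ∪ D', h1.union h1', ?_, ?_⟩
      · rintro p (hp | hp)
        · exact h2 p hp
        · exact h2' p hp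
      · rintro t (ht | ht) hD
        · exact h3 t ht fun h => hD (Or.inl h)
        · exact h3' t ht fun h => hD (Or.inr h)
    · intro p _
      obtain ⟨t, rfl⟩ := exists_coe p
      obtain ⟨n, m, b, c, hb, hc, h1, h2, h3⟩ := h t
      have hside : ∀ᶠ s in 𝓝[≠] t, DyadicAffineAt f s := by
        rw [← nhdsLT_sup_nhdsGT, eventually_sup]
        constructor
        · have h2 := h2.filter_mono (nhdsWithin_mono t Set.Iio_subset_Iic_self)
          filter_upwards [eventually_eventually_nhdsWithin.mpr h2, self_mem_nhdsWithin] with s hs hst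
          rw [IsOpen.nhdsWithin_eq isOpen_Iio hst] at hs
          exact ⟨m, c, hc, hs.mono fun s hs => by rw [← hf, hs]⟩
        · have h1 := h1.filter_mono (nhdsWithin_mono t Set.Ioi_subset_Ici_self)
          filter_upwards [eventually_eventually_nhdsWithin.mpr h1, self_mem_nhdsWithin] with s hs hst
          rw [IsOpen.nhdsWithin_eq isOpen_Ioi hst] at hs
          exact ⟨n, b, hb, hs.mono fun s hs => by rw [← hf, hs]⟩
      have hall : ∃ D : Set UnitAddCircle, D.Finite ∧ (∀ p ∈ D, IsDyadicPoint p) ∧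
          ∀ᶠ s : ℝ in 𝓝 t, (s : UnitAddCircle) ∉ D → DyadicAffineAt f s := by
        rcases h3 with hd | ⟨rfl, rfl⟩
        · refine ⟨{(t : UnitAddCircle)}, Set.finite_singleton _, ?_, ?_⟩
          · rintro p rfl
            exact isDyadicPoint_coe.mpr hd
          · rw [eventually_nhdsWithin_iff] at hside
            filter_upwards [hside] with s hs hD
            exact hs fun hst => hD (congrArg _ hst)
        · refine ⟨∅, Set.finite_empty, by simp, ?_⟩
          have hev := eventually_nhds_iff_sides.mpr ⟨h1, h2⟩
          filter_upwards [eventually_eventually_nhds.mpr hev] with s hs _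
          exact ⟨n, b, hb, hs.mono fun s hs => by rw [← hf, hs]⟩
      obtain ⟨D, hD, hDd, hev⟩ := hall
      refine ⟨{x | ∃ s : ℝ, (s : UnitAddCircle) = x ∧ (x ∉ D → DyadicAffineAt f s)},
        mem_nhdsWithin_of_mem_nhds ?_, D, hD, hDd, ?_⟩
      · change ∀ᶠ x in 𝓝 (t : UnitAddCircle), _
        rw [eventually_coe]
        exact hev.mono fun s hs => ⟨s, rfl, hs⟩
      · rintro s ⟨s', hs, h5⟩ hsD
        exact (h5 hsD).of_coe_eq hs.symm
  obtain ⟨D, h1, h2, h3⟩ := key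
  exact ⟨D, h1, h2, fun t => h3 t (Set.mem_univ _)⟩

/-- The rotation of the circle by `t`. -/
noncomputable def rotation (t : ℝ) : UnitAddCircle ≃ₜ UnitAddCircle :=
  Homeomorph.addRight (t : UnitAddCircle)

theorem rotation_coe (t s : ℝ) : rotation t (s : UnitAddCircle) = ((s + t : ℝ) : UnitAddCircle) := by
  rw [AddCircle.coe_add]; rfl

theorem rotation_mem {t : ℝ} (ht : IsDyadic t) : rotation t ∈ thompsonT :=
  ⟨∅, Set.finite_empty, by simp, fun _ _ => ⟨0, t, ht, Eventually.of_forall fun s => by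
    rw [rotation_coe, zpow_zero, one_mul]⟩⟩

theorem eventually_eq_of_coe_eq {F G : ℝ → ℝ} (hF : Continuous F) (hG : Continuous G) {t : ℝ}
    {l : Filter ℝ} (hl : l ≤ 𝓝 t) (h0 : F t = G t)
    (h : ∀ᶠ s in l, (F s : UnitAddCircle) = G s) : ∀ᶠ s in l, F s = G s := by
  have hlim : Tendsto (fun s => F s - G s) (𝓝 t) (𝓝 (F t - G t)) := (hF.sub hG).tendsto t
  rw [h0, sub_self] at hlim
  filter_upwards [h, (hlim.mono_left hl).eventually (Metric.ball_mem_nhds (0 : ℝ) one_pos)]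
    with s h1 h2
  obtain ⟨j, hj⟩ := coe_eq_coe h1
  rw [hj, add_sub_cancel_left, dist_zero_right, Real.norm_eq_abs] at h2
  have : j = 0 := by
    rw [← Int.abs_lt_one_iff]
    exact_mod_cast h2
  rw [hj, this]; simp

/-- The integer ambiguity of the lift is absorbed into the dyadic translation part. A general filter
covers one-sided and two-sided neighbourhoods at once. -/
theorem eventually_affine_of_coe {F : ℝ → ℝ} (hF : Continuous F) {t : ℝ} {l : Filter ℝ} (hl : l ≤ 𝓝 t)
    (hl' : ∀ {P : ℝ → Prop}, (∀ᶠ s in l, P s) → P t) {n : ℤ} {b : ℝ} (hb : IsDyadic b)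
    (h : ∀ᶠ s in l, (F s : UnitAddCircle) = (((2 : ℝ) ^ n * s + b : ℝ) : UnitAddCircle)) :
    ∃ c, IsDyadic c ∧ ∀ᶠ s in l, F s = (2 : ℝ) ^ n * s + c := by
  obtain ⟨k, hk⟩ := coe_eq_coe (hl' h)
  refine ⟨b + k, hb.add (IsDyadic.int k), eventually_eq_of_coe_eq hF (by fun_prop) hl
    (by rw [hk, add_assoc]) ?_⟩
  filter_upwards [h] with s hs
  rw [hs, ← add_assoc, coe_add_int]

/-- At nonsingular points the lift is piecewise linear. -/
theorem plAt_of_notMem_sing {f : UnitAddCircle ≃ₜ UnitAddCircle} {F : ℝ → ℝ} (hF : Continuous F)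
    (hf : ∀ s : ℝ, (F s : UnitAddCircle) = f s) {t : ℝ}
    (ht : (t : UnitAddCircle) ∉ sing thompsonT f) : PLAt F t := by
  rw [notMem_sing] at ht
  obtain ⟨g, hg, hfg⟩ := ht
  rw [eventually_coe] at hfg
  by_cases hd : IsDyadic t
  · obtain ⟨ε, hε, ⟨n, b, hb, h1⟩, ⟨m, c, hc, h2⟩⟩ := IsThompsonT.sides hg t
    rw [eventually_nhds_iff_sides] at hfg
    obtain ⟨b', hb', h3⟩ := eventually_affine_of_coe hF nhdsWithin_le_nhds self_of_ge hb
      (l := 𝓝[≥] t) (n := n) (by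
        filter_upwards [hfg.1, Icc_mem_nhdsGE (show t < t + ε by linarith)] with s h3 h4
        rw [hf, h3, h1 s h4])
    obtain ⟨c', hc', h4⟩ := eventually_affine_of_coe hF nhdsWithin_le_nhds self_of_le hc
      (l := 𝓝[≤] t) (n := m) (by
        filter_upwards [hfg.2, Icc_mem_nhdsLE (show t - ε < t by linarith)] with s h3 h4
        rw [hf, h3, h2 s h4])
    exact ⟨n, m, b', c', hb', hc', h3, h4, Or.inl hd⟩
  · obtain ⟨D, hD, hDd, hg⟩ := hg
    obtain ⟨n, b, hb, h1⟩ := hg t fun h => hd (isDyadicPoint_coe.mp (hDd _ h))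
    obtain ⟨b', hb', h3⟩ := eventually_affine_of_coe hF le_rfl (fun h => h.self_of_nhds) hb
      (l := 𝓝 t) (n := n) (by
        filter_upwards [hfg, h1] with s h3 h4
        rw [hf, h3, h4])
    exact plAt_affine n hb' h3

theorem exists_notMem_sing {f : UnitAddCircle ≃ₜ UnitAddCircle} (hf : (sing thompsonT f).Finite) :
    ∃ t : ℝ, (t : UnitAddCircle) ∉ sing thompsonT f :=
  (eventually_notMem_finite hf 0).exists

/-- Elements of `TA` preserve the orientation: the singular set is finite, and at any other point
the slope on the right is a power of two, hence positive. -/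
theorem IsTA.exists_lift {f : UnitAddCircle ≃ₜ UnitAddCircle} (hf : IsTA f) :
    ∃ F : ℝ ≃o ℝ, (∀ s, F (s + 1) = F s + 1) ∧ ∀ s : ℝ, (F s : UnitAddCircle) = f s := by
  refine FiniteGerm.exists_lift f fun F hFc hF => ?_
  obtain ⟨t, ht⟩ := exists_notMem_sing hf.finite
  obtain ⟨n, -, b, -, -, -, h, -⟩ := plAt_of_notMem_sing hFc hF ht
  obtain ⟨s, h1, h2⟩ := ((h.filter_mono (nhdsWithin_mono t Set.Ioi_subset_Ici_self)).and
    (self_mem_nhdsWithin : Set.Ioi t ∈ 𝓝[>] t)).exists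
  have hn : (0 : ℝ) < 2 ^ n := by positivity
  have h2 : t < s := h2
  refine ⟨t, s, h2, ?_⟩
  rw [h1, self_of_ge h]
  nlinarith

theorem isTA_of_mem_thompsonT {f : UnitAddCircle ≃ₜ UnitAddCircle} (hf : f ∈ thompsonT) :
    IsTA f := by
  constructor <;> simp [sing_of_mem hf]

/-! ### Prescribing one-sided slopes -/

/-- `g` fixes `0` and has slopes `2 ^ n` on the right and `2 ^ m` on the left of `0`. -/
def HasSlopes (g : UnitAddCircle ≃ₜ UnitAddCircle) (n m : ℤ) : Prop :=
  (∀ᶠ s : ℝ in 𝓝[≥] 0, g s = (((2 : ℝ) ^ n * s : ℝ) : UnitAddCircle)) ∧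
    ∀ᶠ s : ℝ in 𝓝[≤] 0, g s = (((2 : ℝ) ^ m * s : ℝ) : UnitAddCircle)

theorem tendsto_zpow_mul_ge (n : ℤ) :
    Tendsto (fun s : ℝ => (2 : ℝ) ^ n * s) (𝓝[≥] 0) (𝓝[≥] 0) := by
  simpa using tendsto_affine_ge n 0 0

theorem tendsto_zpow_mul_le (n : ℤ) :
    Tendsto (fun s : ℝ => (2 : ℝ) ^ n * s) (𝓝[≤] 0) (𝓝[≤] 0) := by
  simpa using tendsto_affine_le n 0 0

theorem HasSlopes.mul {g h : UnitAddCircle ≃ₜ UnitAddCircle} {n m n' m' : ℤ}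
    (hg : HasSlopes g n m) (hh : HasSlopes h n' m') : HasSlopes (g * h) (n + n') (m + m') := by
  constructor
  · filter_upwards [hh.1, (tendsto_zpow_mul_ge n').eventually hg.1] with s h1 h2
    rw [Homeomorph.mul_apply, h1, h2, zpow_add₀ two_ne_zero, mul_assoc]
  · filter_upwards [hh.2, (tendsto_zpow_mul_le m').eventually hg.2] with s h1 h2
    rw [Homeomorph.mul_apply, h1, h2, zpow_add₀ two_ne_zero, mul_assoc]

theorem HasSlopes.inv {g : UnitAddCircle ≃ₜ UnitAddCircle} {n m : ℤ} (hg : HasSlopes g n m) :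
    HasSlopes g⁻¹ (-n) (-m) := by
  have key : ∀ (n : ℤ) (s : ℝ), (2 : ℝ) ^ n * ((2 : ℝ) ^ (-n) * s) = s := fun n s => by
    rw [← mul_assoc, ← zpow_add₀ two_ne_zero, add_neg_cancel, zpow_zero, one_mul]
  constructor
  · filter_upwards [(tendsto_zpow_mul_ge (-n)).eventually hg.1] with s h
    rw [key] at h
    exact g.symm_apply_eq.mpr h.symm
  · filter_upwards [(tendsto_zpow_mul_le (-m)).eventually hg.2] with s h
    rw [key] at h
    exact g.symm_apply_eq.mpr h.symm

theorem HasSlopes.one : HasSlopes 1 0 0 := by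
  constructor <;> exact Eventually.of_forall fun s => by simp

end FiniteGerm

namespace FiniteGerm

/-! ### Changes of labelled partition as elements of `T` -/

theorem exists_mem_thompsonT_of_isChange {φ : Equiv.Perm (ℤ × UnitCell)} (hφ : Line.IsChange φ) :
    ∃ f ∈ thompsonT, ∀ s : ℝ, f s = (realMap φ s : UnitAddCircle) := by
  obtain ⟨f, hf⟩ := exists_homeo (StrictMono.orderIsoOfSurjective _ (strictMono_realMap hφ.mono)
    (realMap φ).surjective) (realMap_add_one hφ.commute)
  exact ⟨f, mem_thompsonT_of_plAt (fun s => (hf s).symm) (plAt_realMap hφ), hf⟩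

theorem exists_hasSlopes_of_cells {φ : Equiv.Perm (ℤ × UnitCell)} (hφ : Line.IsChange φ)
    {n n' m m' : ℕ}
    (h : ∀ z, φ ((Line.double _ ^ n)⁻¹ (0, z)) = (Line.double _ ^ n')⁻¹ (0, z))
    (h' : ∀ z, φ ((Line.double _ ^ m)⁻¹ (-1, z)) = (Line.double _ ^ m')⁻¹ (-1, z)) :
    ∃ g ∈ thompsonT, HasSlopes g ((n : ℤ) - n') ((m : ℤ) - m') := by
  obtain ⟨g, hg, hgφ⟩ := exists_mem_thompsonT_of_isChange hφ
  have h0 : ∀ s : ℝ, 0 ≤ s → s < 1 / 2 ^ n → realMap φ s = (2 : ℝ) ^ ((n : ℤ) - n') * s := by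
    intro s h0 h1
    simpa using cell_affine h (by simpa using h0) (by simpa using h1)
  refine ⟨g, hg, ?_, ?_⟩
  · filter_upwards [Ico_mem_nhdsGE (show (0 : ℝ) < 1 / 2 ^ n by positivity)] with s hs
    rw [hgφ, h0 s hs.1 hs.2]
  · filter_upwards [Ioc_mem_nhdsLE (show (-1 : ℝ) / 2 ^ m < 0 by
      rw [neg_div, neg_lt_zero]; positivity)] with s hs
    rcases hs.2.eq_or_lt with rfl | h1
    · rw [hgφ, h0 0 le_rfl (by positivity)]; simp
    · rw [hgφ, cell_affine h' (by push_cast; exact hs.1.le) (by simpa using h1)]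
      simp

-- Moves in the partition into quarters. Splitting cell 0 instead of cell 1 stretches `[0, 1/8]`
-- onto `[0, 1/4]` and fixes the quarter to the left of `0`. Splitting cell 3 instead of cell 2 does
-- the mirror image, since cell `-1` has residue 3.
open Line in
theorem exists_hasSlopes_basic : (∃ g ∈ thompsonT, HasSlopes g 1 0) ∧
    ∃ g ∈ thompsonT, HasSlopes g 0 1 := by
  have hc := frame_double (Y := UnitCell) 2
  have hmul : ∀ (i j : ℕ) x, ((double UnitCell ^ 2)⁻¹ * ((split UnitCell 4 i)⁻¹ * split UnitCell 4 j)
      * double UnitCell ^ 2) ((double UnitCell ^ 2)⁻¹ x) =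
      (double UnitCell ^ 2)⁻¹ ((split UnitCell 4 i)⁻¹ (split UnitCell 4 j x)) := fun i j x => by
    rw [Equiv.Perm.mul_apply, ← Equiv.Perm.mul_apply (double UnitCell ^ 2), mul_inv_cancel]; rfl
  have hz : ∀ i (z : UnitCell), 0 < i → i < 4 → split UnitCell 4 i (0, z) = (0, z) := by
    intro i z h0 h4
    simpa using split_lt (Y := UnitCell) (m := 4) (i := i) (q := 0) (r := 0) (y := z) le_rfl
      (by omega) h4
  have hl : ∀ i (z : UnitCell), i < 3 → split UnitCell 4 i (-1, z) = (-1, z) := by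
    intro i z h0
    simpa using split_gt (Y := UnitCell) (m := 4) (i := i) (q := -1) (r := 3) (y := z)
      (by omega) (by omega) (by norm_num)
  constructor
  · have := exists_hasSlopes_of_cells (isChange_move hc (i := 1) (j := 0) (by norm_num) (by norm_num))
      (n := 3) (n' := 2) (m := 2) (m' := 2) ?_ ?_
    · simpa using this
    · intro z
      have h1 := cell_succ 2 0 false z
      have h2 := split_eq (m := 4) (i := 0) (q := 0) (y := z) (by norm_num) false
      simp only [mul_zero, Bool.toNat_false, Nat.cast_zero, add_zero] at h1 h2
      rw [h1]
      refine (hmul 1 0 _).trans ?_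
      rw [h2, Equiv.Perm.inv_eq_iff_eq.mpr (hz 1 z (by norm_num) (by norm_num)).symm]
    · intro z
      refine (hmul 1 0 _).trans ?_
      rw [hl 0 z (by norm_num), Equiv.Perm.inv_eq_iff_eq.mpr (hl 1 z (by norm_num)).symm]
  · have := exists_hasSlopes_of_cells (isChange_move hc (i := 2) (j := 3) (by norm_num) (by norm_num))
      (n := 2) (n' := 2) (m := 3) (m' := 2) ?_ ?_
    · simpa using this
    · intro z
      refine (hmul 2 3 _).trans ?_
      rw [hz 3 z (by norm_num) (by norm_num),
        Equiv.Perm.inv_eq_iff_eq.mpr (hz 2 z (by norm_num) (by norm_num)).symm]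
    · intro z
      have h1 : (double UnitCell ^ 3)⁻¹ (-1, z) =
          (double UnitCell ^ 2)⁻¹ (-1, Halving.sp.symm (true, z)) := by
        rw [← cell_succ, show (2 : ℤ) * -1 + (true.toNat : ℤ) = -1 by simp]
      have h2 := split_eq (m := 4) (i := 3) (q := -1) (y := z) (by norm_num) true
      norm_num at h2
      rw [h1]
      refine (hmul 2 3 _).trans ?_
      rw [h2, Equiv.Perm.inv_eq_iff_eq.mpr (hl 2 z (by norm_num)).symm]

theorem exists_hasSlopes (n m : ℤ) : ∃ g ∈ thompsonT, HasSlopes g n m := by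
  obtain ⟨⟨r, hr, hr'⟩, l, hl, hl'⟩ := exists_hasSlopes_basic
  have key : ∀ {n m : ℤ} (k : ℤ) {g : UnitAddCircle ≃ₜ UnitAddCircle}, HasSlopes g n m →
      HasSlopes (g ^ k) (k * n) (k * m) := by
    intro n m k g hg
    induction k with
    | zero => simpa using HasSlopes.one
    | succ k ih => rw [zpow_add_one, add_mul, add_mul, one_mul, one_mul]; exact ih.mul hg
    | pred k ih =>
      rw [zpow_sub_one, sub_mul, sub_mul, one_mul, one_mul]; exact ih.mul hg.inv
  refine ⟨r ^ n * l ^ m, mul_mem (zpow_mem hr n) (zpow_mem hl m), ?_⟩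
  simpa using (key n hr').mul (key m hl')

theorem exists_isDyadic_le (t : ℝ) {ε : ℝ} (hε : 0 < ε) : ∃ d, IsDyadic d ∧ d ≤ t ∧ t < d + ε := by
  obtain ⟨N, hN⟩ : ∃ N : ℕ, (1 / 2 : ℝ) ^ N < ε := exists_pow_lt_of_lt_one hε (by norm_num)
  have hp : (0 : ℝ) < 2 ^ N := by positivity
  refine ⟨⌊t * 2 ^ N⌋ / 2 ^ N, ⟨_, _, rfl⟩, ?_, lt_trans ?_ (add_lt_add_right hN _)⟩
  · rw [div_le_iff₀ hp]; exact Int.floor_le _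
  · rw [one_div_pow, ← add_div, lt_div_iff₀ hp]; exact Int.lt_floor_add_one _

/-- Where a circle homeomorphism is given by a piecewise linear dyadic map, it is not singular. -/
theorem notMem_sing_of_plAt {f : UnitAddCircle ≃ₜ UnitAddCircle} {F : ℝ → ℝ} {t : ℝ}
    (hf : ∀ᶠ s : ℝ in 𝓝 t, f s = (F s : UnitAddCircle)) (h : PLAt F t) :
    (t : UnitAddCircle) ∉ sing thompsonT f := by
  have hd := h.isDyadic_iff
  obtain ⟨n, m, b, c, hb, hc, h1, h2, h3⟩ := h
  rw [notMem_sing]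
  rcases h3 with ht | ⟨rfl, rfl⟩
  · obtain ⟨g, hg, hg1, hg2⟩ := exists_hasSlopes n m
    refine ⟨rotation (F t) * g * rotation (-t), mul_mem (mul_mem (rotation_mem (hd.mpr ht)) hg)
      (rotation_mem ht.neg), ?_⟩
    rw [eventually_coe]
    have e1 := self_of_ge h1
    have e2 := self_of_le h2
    rw [eventually_nhds_iff_sides] at hf ⊢
    have l1 := tendsto_affine_ge 0 (-t) t
    have l2 := tendsto_affine_le 0 (-t) t
    simp only [zpow_zero, one_mul, add_neg_cancel] at l1 l2
    constructor
    · filter_upwards [hf.1, h1, l1.eventually hg1] with s h4 h5 h6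
      rw [h4, h5, Homeomorph.mul_apply, Homeomorph.mul_apply, rotation_coe, h6, rotation_coe, e1]
      congr 1; ring
    · filter_upwards [hf.2, h2, l2.eventually hg2] with s h4 h5 h6
      rw [h4, h5, Homeomorph.mul_apply, Homeomorph.mul_apply, rotation_coe, h6, rotation_coe, e2]
      congr 1; ring
  · obtain ⟨g, hg, hg1, hg2⟩ := exists_hasSlopes n n
    have hg0 := eventually_nhds_iff_sides.mpr ⟨hg1, hg2⟩
    -- Here `t` need not be dyadic, so rotation by `t` may not be in `T`. A dyadic `d` so close to
    -- `t` that `g` is still linear at distance `t - d` takes its place.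
    obtain ⟨ε, hε, hball⟩ := Metric.eventually_nhds_iff.mp hg0
    obtain ⟨d, hd, h5, h6⟩ := exists_isDyadic_le t hε
    have hdt : dist (t - d) 0 < ε := by
      rw [dist_zero_right, Real.norm_eq_abs, abs_lt]
      constructor <;> linarith
    refine ⟨rotation ((2 : ℝ) ^ n * d + b) * g * rotation (-d),
      mul_mem (mul_mem (rotation_mem ((hd.zpow_mul n).add hb)) hg) (rotation_mem hd.neg), ?_⟩
    rw [eventually_coe]
    have hcont : Continuous fun s : ℝ => dist (s - d) 0 := by fun_prop
    filter_upwards [hf, eventually_nhds_iff_sides.mpr ⟨h1, h2⟩,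
      (hcont.tendsto t).eventually (gt_mem_nhds hdt)] with s h4 h5 h6
    rw [h4, h5, Homeomorph.mul_apply, Homeomorph.mul_apply, rotation_coe, ← sub_eq_add_neg,
      hball h6, rotation_coe]
    congr 1; ring

theorem exists_isChange_of_orderIso (F : ℝ ≃o ℝ) (hF : ∀ s, F (s + 1) = F s + 1)
    (h : ∀ t, PLAt F t) : ∃ φ, Line.IsChange φ ∧ ∀ s, realMap φ s = F s := by
  let φ : Equiv.Perm (ℤ × UnitCell) := realEquiv.trans (F.toEquiv.trans realEquiv.symm)
  have hφF : ∀ s, realMap φ s = F s := fun s => by simp [realMap, φ]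
  have hφF' : ∀ x, realEquiv (φ x) = F (realEquiv x) := fun x => by simp [φ]
  refine ⟨φ, isChange_of_plAt (fun x y h => ?_) ?_ fun t => ?_, hφF⟩
  · rw [← realEquiv_lt, hφF', hφF']
    exact F.strictMono (realEquiv_lt.mpr h)
  · ext1 x
    apply realEquiv.injective
    rw [Equiv.Perm.mul_apply, Equiv.Perm.mul_apply, realEquiv_shift, hφF', hφF', realEquiv_shift,
      hF]
  · exact (h t).congr (Eventually.of_forall hφF)

open Line in
/-- A normal subgroup of `TA` that contains the commutators of elements supported near `0`
contains `T`. -/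
theorem mem_of_mem_thompsonT {N : Subgroup TA} [N.Normal] {U : Set UnitAddCircle}
    (hU : U ∈ 𝓝 ((0 : ℝ) : UnitAddCircle))
    (hcomm : ∀ f g : TA, (∀ p ∉ U, f.1 p = p) → (∀ p ∉ U, g.1 p = p) → f * g * f⁻¹ * g⁻¹ ∈ N)
    (f : TA) (hf : f.1 ∈ thompsonT) : f ∈ N := by
  obtain ⟨ε, hε, hball⟩ := Metric.eventually_nhds_iff.mp (eventually_coe.mp hU)
  obtain ⟨n, hn⟩ : ∃ n : ℕ, (1 / 2 : ℝ) ^ n < ε / 4 :=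
    exists_pow_lt_of_lt_one (by linarith) (by norm_num)
  -- The graph of the assignment from lifts to classes modulo `N` of the circle maps they induce. A
  -- map is determined by its lift, so it is single-valued.
  let R : Subgroup (Equiv.Perm (ℤ × UnitCell) × (TA ⧸ N)) :=
    { carrier := {r | ∃ f : TA, (∀ x, f.1 (realEquiv x : ℝ) = ((realEquiv (r.1 x) : ℝ) :
        UnitAddCircle)) ∧ r.2 = (f : TA ⧸ N)}
      one_mem' := ⟨1, fun x => rfl, rfl⟩
      mul_mem' := by
        rintro ⟨φ, q⟩ ⟨χ, r⟩ ⟨f, hf, h1⟩ ⟨g, hg, h2⟩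
        refine ⟨f * g, fun x => ?_, ?_⟩
        · change f.1 (g.1 _) = _
          rw [hg, hf]; rfl
        · simp only at h1 h2
          simp [h1, h2]
      inv_mem' := by
        rintro ⟨φ, q⟩ ⟨f, hf, h1⟩
        refine ⟨f⁻¹, fun x => ?_, ?_⟩
        · obtain ⟨x, rfl⟩ := φ.surjective x
          change f.1.symm _ = _
          rw [Homeomorph.symm_apply_eq]
          simpa using (hf x).symm
        · simp only at h1
          simp [h1] }
  have hR : ∀ {φ : Equiv.Perm (ℤ × UnitCell)} {f : TA},
      (∀ s : ℝ, f.1 s = (realMap φ s : UnitAddCircle)) → (φ, (f : TA ⧸ N)) ∈ R :=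
    fun {φ f} h => ⟨f, fun x => by rw [h, realMap_realEquiv], rfl⟩
  have huniq : ∀ {f g : TA}, (∀ s : ℝ, f.1 s = g.1 s) → f = g := by
    intro f g h
    apply Subtype.ext
    ext p
    obtain ⟨s, rfl⟩ := exists_coe p
    exact h s
  have hfun : ∀ {q}, ((1 : Equiv.Perm (ℤ × UnitCell)), q) ∈ R → q = 1 := by
    rintro q ⟨f, hf, h⟩
    simp only at hf h
    have : f = 1 := huniq fun s => by
      obtain ⟨x, rfl⟩ := realEquiv.surjective s
      exact hf x
    rw [h, this]; rfl
  have hreal : ∀ φ, IsChange φ → ∃ f : TA, ∀ s : ℝ, f.1 s = (realMap φ s : UnitAddCircle) := by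
    intro φ hφ
    obtain ⟨f, hf, h⟩ := exists_mem_thompsonT_of_isChange hφ
    exact ⟨⟨f, isTA_of_mem_thompsonT hf⟩, h⟩
  -- A partition so fine that the cells 0, 1 and 2 lie within `ε` of `0`.
  have hc₀ := frame_double (Y := UnitCell) (n + 2)
  have h4 : 4 ≤ 2 ^ (n + 2) := by
    rw [pow_add]
    have := Nat.one_le_two_pow (n := n)
    omega
  obtain ⟨F, hF1, hF⟩ := f.2.exists_lift
  obtain ⟨φ, hφ, hφF⟩ := exists_isChange_of_orderIso F hF1 fun t =>
    plAt_of_notMem_sing F.continuous hF (by rw [sing_of_mem hf]; exact Set.notMem_empty (t : UnitAddCircle))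
  have key : (φ, 1) ∈ R := by
    refine IsChange.mem_graphKer hfun ?_ (fun χ _ h _ _ => ?_) hc₀ (by omega) ?_ hφ
    -- The shift is a lift of the identity.
    · refine ⟨1, fun x => ?_, rfl⟩
      simp only
      rw [realEquiv_shift, show realEquiv x + 1 = realEquiv x + (1 : ℤ) by simp, coe_add_int]
      rfl
    · obtain ⟨g, hg⟩ := hreal χ h
      exact ⟨_, hR hg⟩
    · obtain ⟨g, hg⟩ := hreal _ (isChange_move hc₀ (i := 1) (j := 0) (by omega) (by omega))
      obtain ⟨h, hh⟩ := hreal _ (isChange_move hc₀ (i := 0) (j := 2) (by omega) (by omega))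
      refine ⟨_, _, hR hg, hR hh, ?_⟩
      -- The moves involved split only cells of index below 3. Both splittings push every later cell
      -- of the period up by one, so the moves fix these cells.
      have hsupp : ∀ (i j : ℕ) (k : TA), i < 3 → j < 3 → (∀ s : ℝ, k.1 s =
          (realMap ((double UnitCell ^ (n + 2))⁻¹ * ((split UnitCell (2 ^ (n + 2)) i)⁻¹ *
            split UnitCell (2 ^ (n + 2)) j) * double UnitCell ^ (n + 2)) s : UnitAddCircle)) →
          ∀ p ∉ U, k.1 p = p := by
        intro i j k hi hj hk p hp
        obtain ⟨t, rfl⟩ := exists_coe p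
        have hfr : ((Int.fract t : ℝ) : UnitAddCircle) = t := by
          rw [← coe_add_int _ ⌊t⌋, Int.fract_add_floor]
        rw [← hfr] at hp ⊢
        rw [hk]
        congr 1
        obtain ⟨x, hx⟩ := realEquiv.surjective (Int.fract t)
        obtain ⟨⟨a, y⟩, rfl⟩ := (double UnitCell ^ (n + 2))⁻¹.surjective x
        have hpos : (0 : ℝ) < 2 ^ (n + 2) := by positivity
        have h0 := Int.fract_nonneg t
        have h1 := Int.fract_lt_one t
        rw [← hx] at hp ⊢
        rw [← hx, realEquiv_cell] at h0 h1
        rw [div_nonneg_iff] at h0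
        rw [div_lt_one hpos] at h1
        have hy := y.2
        have ha : 3 ≤ a := by
          by_contra hlt
          have hlt : (a : ℝ) ≤ 2 := by exact_mod_cast (show a ≤ 2 by omega)
          apply hp
          apply hball
          rw [dist_zero_right, Real.norm_eq_abs, realEquiv_cell, abs_lt]
          have h5 : ((a : ℝ) + y.1) / 2 ^ (n + 2) < 4 * (1 / 2) ^ n := by
            rw [div_lt_iff₀ hpos, pow_add, one_div_pow]
            field_simp
            linarith [hy.2]
          have h6 : 0 ≤ ((a : ℝ) + y.1) / 2 ^ (n + 2) := by
            rcases h0 with h0 | h0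
            · exact div_nonneg h0.1 h0.2
            · linarith [h0.2]
          constructor <;> linarith
        have ha' : a < ((2 ^ (n + 2) : ℕ) : ℤ) := by
          have : (a : ℝ) < ((2 ^ (n + 2) : ℕ) : ℤ) := by push_cast; linarith [hy.1]
          exact_mod_cast this
        rw [realMap_realEquiv]
        congr 1
        have hsp : ∀ l < 3, split UnitCell (2 ^ (n + 2)) l (a, y) = (a + 1, y) := by
          intro l hl
          have := split_gt (Y := UnitCell) (m := 2 ^ (n + 2)) (i := l) (q := 0) (r := a) (y := y)
            (by omega) (by omega) ha'
          simpa using this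
        rw [Equiv.Perm.mul_apply, ← Equiv.Perm.mul_apply (double UnitCell ^ (n + 2)),
          mul_inv_cancel, Equiv.Perm.one_apply, Equiv.Perm.mul_apply, Equiv.Perm.mul_apply,
          hsp j hj, Equiv.Perm.inv_eq_iff_eq.mpr (hsp i hi).symm]
      have := hcomm g h (hsupp 1 0 g (by norm_num) (by norm_num) hg)
        (hsupp 0 2 h (by norm_num) (by norm_num) hh)
      rw [← QuotientGroup.eq_one_iff] at this
      have h5 : (g : TA ⧸ N) * h * (g : TA ⧸ N)⁻¹ * (h : TA ⧸ N)⁻¹ = 1 := this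
      rwa [mul_inv_eq_one, mul_inv_eq_iff_eq_mul] at h5
  obtain ⟨g, hg, h1⟩ := key
  have : f = g := huniq fun s => by
    obtain ⟨x, rfl⟩ := realEquiv.surjective s
    rw [hg, ← hF, ← hφF, realMap_realEquiv]
  rw [this]
  exact (QuotientGroup.eq_one_iff g).mp h1.symm

end FiniteGerm

namespace FiniteGerm

/-! ### The piecewise linear exponential map -/

/-- The piecewise linear interpolation of `k ↦ 2 ^ k`. -/
noncomputable def expPL (s : ℝ) : ℝ := (2 : ℝ) ^ ⌊s⌋ * (1 + Int.fract s)

theorem expPL_pos (s : ℝ) : 0 < expPL s := by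
  have := Int.fract_nonneg s
  unfold expPL
  positivity

/-- Conjugation by `expPL` turns translation by one into doubling, exactly as for `2 ^ s`, while
staying within piecewise linear maps. -/
theorem expPL_add_int (s : ℝ) (k : ℤ) : expPL (s + k) = (2 : ℝ) ^ k * expPL s := by
  rw [expPL, expPL, Int.floor_add_intCast, Int.fract_add_intCast, zpow_add₀ two_ne_zero]
  ring

theorem expPL_add_one (s : ℝ) : expPL (s + 1) = 2 * expPL s := by
  simpa using expPL_add_int s 1

theorem expPL_of_mem {s : ℝ} {k : ℤ} (h : s ∈ Set.Icc (k : ℝ) (k + 1)) :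
    expPL s = (2 : ℝ) ^ k * s + (2 : ℝ) ^ k * ((1 : ℤ) - k : ℤ) := by
  rcases h.2.eq_or_lt with rfl | hlt
  · have : (k : ℝ) + 1 = ((k + 1 : ℤ) : ℝ) := by push_cast; ring
    rw [this, expPL, Int.floor_intCast, Int.fract_intCast, zpow_add_one₀ two_ne_zero]
    push_cast
    ring
  · have hk : ⌊s⌋ = k := Int.floor_eq_iff.mpr ⟨h.1, hlt⟩
    rw [expPL, ← Int.self_sub_floor, hk]
    push_cast
    ring

theorem expPL_lt (s : ℝ) : expPL s < (2 : ℝ) ^ (⌊s⌋ + 1) := by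
  have h1 := Int.fract_lt_one s
  have h2 : (0 : ℝ) < 2 ^ ⌊s⌋ := by positivity
  rw [expPL, zpow_add_one₀ two_ne_zero]
  nlinarith

theorem le_expPL (s : ℝ) : (2 : ℝ) ^ ⌊s⌋ ≤ expPL s := by
  have h1 := Int.fract_nonneg s
  have h2 : (0 : ℝ) < 2 ^ ⌊s⌋ := by positivity
  rw [expPL]
  nlinarith

theorem strictMono_expPL : StrictMono expPL := by
  intro s t hst
  rcases (Int.floor_mono hst.le).eq_or_lt with h | h
  · have h2 : (0 : ℝ) < 2 ^ ⌊t⌋ := by positivity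
    rw [expPL, expPL, ← Int.self_sub_floor, ← Int.self_sub_floor, h]
    gcongr
  · refine ((expPL_lt s).trans_le ?_).trans_le (le_expPL t)
    exact zpow_le_zpow_right₀ (by norm_num) (by omega)

theorem exists_expPL_eq {r : ℝ} (hr : 0 < r) : ∃ s, expPL s = r := by
  obtain ⟨k, h1, h2⟩ := exists_mem_Ico_zpow hr (show (1 : ℝ) < 2 by norm_num)
  have hp : (0 : ℝ) < 2 ^ k := by positivity
  rw [zpow_add_one₀ two_ne_zero] at h2
  refine ⟨k + (r / 2 ^ k - 1), ?_⟩
  rw [expPL_of_mem (k := k)]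
  · push_cast; field_simp; ring
  · constructor
    · have : 1 ≤ r / 2 ^ k := by rwa [le_div_iff₀ hp, one_mul]
      linarith
    · have : r / 2 ^ k ≤ 2 := by rw [div_le_iff₀ hp]; linarith
      linarith

/-- The breakpoints are integers and the slopes powers of two. So conjugating by `expPL` keeps maps
piecewise linear and dyadic away from `0`, although breakpoints may accumulate at `0`. -/
theorem plAt_expPL (t : ℝ) : PLAt expPL t := by
  have hd : ∀ k : ℤ, IsDyadic ((2 : ℝ) ^ k * ((1 : ℤ) - k : ℤ)) := fun k => (IsDyadic.int _).zpow_mul k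
  rcases (Int.floor_le t).eq_or_lt with h | h
  · refine ⟨⌊t⌋, ⌊t⌋ - 1, _, _, hd ⌊t⌋, hd (⌊t⌋ - 1), ?_, ?_, Or.inl (h ▸ IsDyadic.int _)⟩
    · filter_upwards [Icc_mem_nhdsGE (show t < t + 1 by linarith)] with s hs
      exact expPL_of_mem (by rwa [h])
    · filter_upwards [Icc_mem_nhdsLE (show t - 1 < t by linarith)] with s hs
      refine expPL_of_mem ?_
      push_cast
      rwa [h, sub_add_cancel]
  · refine plAt_affine ⌊t⌋ (hd ⌊t⌋) ?_
    filter_upwards [Ioo_mem_nhds h (Int.lt_floor_add_one t)] with s hs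
    exact expPL_of_mem ⟨hs.1.le, hs.2.le⟩

/-- The inverse of `expPL` on the positive reals. -/
noncomputable def logPL : ℝ → ℝ := Function.invFun expPL

theorem logPL_expPL (s : ℝ) : logPL (expPL s) = s :=
  Function.leftInverse_invFun strictMono_expPL.injective s

theorem expPL_logPL {r : ℝ} (hr : 0 < r) : expPL (logPL r) = r :=
  Function.invFun_eq (exists_expPL_eq hr)

theorem plAt_logPL {r : ℝ} (hr : 0 < r) : PLAt logPL r := by
  have := (plAt_expPL (logPL r)).inv (Eventually.of_forall logPL_expPL)
  rwa [expPL_logPL hr] at this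

/-- Germs to the right of `0` become germs at `-∞`. -/
theorem eventually_pos_iff {P : ℝ → Prop} :
    (∀ᶠ s in 𝓝[>] 0, P s) ↔ ∃ K : ℤ, ∀ s < (K : ℝ), P (expPL s) := by
  constructor
  · intro h
    obtain ⟨ε, hε, h⟩ := mem_nhdsGT_iff_exists_Ioo_subset.mp h
    have hε : (0 : ℝ) < ε := hε
    refine ⟨⌊logPL ε⌋, fun s hs => h ⟨expPL_pos s, ?_⟩⟩
    rw [← expPL_logPL hε]
    exact strictMono_expPL (hs.trans_le (Int.floor_le _))
  · rintro ⟨K, hK⟩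
    filter_upwards [Ioo_mem_nhdsGT (expPL_pos K)] with s hs
    rw [← expPL_logPL hs.1]
    apply hK
    rw [← strictMono_expPL.lt_iff_lt, expPL_logPL hs.1]
    exact hs.2

theorem lt_of_fst_le {K : ℤ} {x : ℤ × UnitCell} (h : x.1 ≤ K - 1) : realEquiv x < K := by
  obtain ⟨k, y⟩ := x
  have h : (k : ℝ) ≤ K - 1 := by exact_mod_cast h
  rw [realEquiv_apply]
  linarith [y.2.2]

theorem fst_lt_of_lt {K : ℤ} {x : ℤ × UnitCell} (h : realEquiv x < K) : x.1 < K := by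
  obtain ⟨k, y⟩ := x
  rw [realEquiv_apply] at h
  have : (k : ℝ) < K := by linarith [y.2.1]
  exact_mod_cast this

/-! ### Germs on the right of `0` -/

/-- A coordinate on the right of `0`, in which the doubling map is the shift. -/
noncomputable def rightCoord (x : ℤ × UnitCell) : UnitAddCircle := (expPL (realEquiv x) : ℝ)

theorem hasGerm_rightCoord {f : UnitAddCircle ≃ₜ UnitAddCircle} {φ : Equiv.Perm (ℤ × UnitCell)}
    (hφ : Line.IsChange φ)
    (h : ∃ K : ℤ, ∀ s < (K : ℝ), f (expPL s : ℝ) = (expPL (realMap φ s) : ℝ)) :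
    Line.HasGerm rightCoord f φ := by
  obtain ⟨K, hK⟩ := h
  obtain ⟨L, hL⟩ := Line.exists_le_of_mono hφ.mono hφ.commute (-1)
  refine ⟨min L (K - 1), fun x hx => ⟨hL x (hx.trans (min_le_left _ _)), ?_⟩⟩
  rw [rightCoord, hK _ (lt_of_fst_le (hx.trans (min_le_right _ _))), realMap_realEquiv]
  rfl

/-- Cutting off a map of the positive reals at a fixed point. -/
theorem exists_cut_orderIso {H : ℝ → ℝ} (hH : StrictMono H) (hs : Function.Surjective H) {a : ℝ}
    (ha : H a = a) : ∃ h : ℝ ≃o ℝ, (∀ s ≤ a, h (expPL s) = expPL (H s)) ∧ (∀ s ≤ 0, h s = s) ∧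
      ∀ s, expPL a ≤ s → h s = s := by
  classical
  let h : ℝ → ℝ := fun s => if 0 < s ∧ s < expPL a then expPL (H (logPL s)) else s
  have h1 : ∀ s ≤ 0, h s = s := fun s hs => if_neg fun h => h.1.not_ge hs
  have h2 : ∀ s, expPL a ≤ s → h s = s := fun s hs => if_neg fun h => h.2.not_ge hs
  have h3 : ∀ s ≤ a, h (expPL s) = expPL (H s) := by
    intro s hs
    rcases hs.eq_or_lt with rfl | hs
    · rw [h2 _ le_rfl, ha]
    · refine (if_pos ⟨expPL_pos s, strictMono_expPL hs⟩).trans ?_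
      rw [logPL_expPL]
  have hcase : ∀ s, s ≤ 0 ∨ (∃ u ≤ a, s = expPL u) ∨ expPL a ≤ s := by
    intro s
    rcases le_or_gt s 0 with h0 | h0
    · exact Or.inl h0
    · obtain ⟨u, rfl⟩ := exists_expPL_eq h0
      rcases le_total u a with h | h
      · exact Or.inr (Or.inl ⟨u, h, rfl⟩)
      · exact Or.inr (Or.inr (strictMono_expPL.monotone h))
  have hle : ∀ u ≤ a, H u ≤ a := fun u hu => ha ▸ hH.monotone hu
  refine ⟨StrictMono.orderIsoOfSurjective h ?_ ?_, h3, h1, h2⟩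
  · intro s t hst
    have hpos := expPL_pos a
    rcases hcase s with hs | ⟨u, hu, rfl⟩ | hs <;> rcases hcase t with ht | ⟨v, hv, rfl⟩ | ht
    · rwa [h1 s hs, h1 t ht]
    · rw [h1 s hs, h3 v hv]
      exact hs.trans_lt (expPL_pos _)
    · rwa [h1 s hs, h2 t ht]
    · exact absurd ((expPL_pos u).trans hst) ht.not_gt
    · rw [h3 u hu, h3 v hv]
      exact strictMono_expPL (hH (strictMono_expPL.lt_iff_lt.mp hst))
    · rcases hu.eq_or_lt with rfl | hu'
      · rw [h2 _ le_rfl, h2 t ht]; exact hst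
      · rw [h3 u hu, h2 t ht]
        refine lt_of_lt_of_le (strictMono_expPL ?_) ht
        rw [← ha]; exact hH hu'
    · linarith
    · have := strictMono_expPL.monotone hv
      linarith
    · rwa [h2 s hs, h2 t ht]
  · intro t
    rcases hcase t with ht | ⟨v, hv, rfl⟩ | ht
    · exact ⟨t, h1 t ht⟩
    · obtain ⟨u, rfl⟩ := hs v
      refine ⟨expPL u, h3 u ?_⟩
      rw [← ha] at hv
      exact hH.le_iff_le.mp hv
    · exact ⟨t, h2 t ht⟩

/-- The circle homeomorphism obtained from a homeomorphism of the unit interval. -/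
theorem exists_homeo_of_Icc (h : ℝ ≃o ℝ) (h0 : h 0 = 0) (h1 : h 1 = 1) :
    ∃ f : UnitAddCircle ≃ₜ UnitAddCircle, ∀ s ∈ Set.Icc (0 : ℝ) 1, f s = (h s : UnitAddCircle) := by
  have hmem : ∀ s, 0 ≤ h (Int.fract s) ∧ h (Int.fract s) < 1 := by
    intro s
    rw [← h0, ← h1]
    exact ⟨h.monotone (Int.fract_nonneg s), h.strictMono (Int.fract_lt_one s)⟩
  have hmono : StrictMono fun s : ℝ => (⌊s⌋ : ℝ) + h (Int.fract s) := by
    intro s t hst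
    rcases (Int.floor_mono hst.le).eq_or_lt with h' | h'
    · have : Int.fract s < Int.fract t := by
        rw [← Int.self_sub_floor, ← Int.self_sub_floor, h']; linarith
      simp only [h', add_lt_add_iff_left]
      exact h.strictMono this
    · have : (⌊s⌋ : ℝ) + 1 ≤ ⌊t⌋ := by exact_mod_cast h'
      simp only
      linarith [(hmem s).2, (hmem t).1]
  have hsurj : Function.Surjective fun s : ℝ => (⌊s⌋ : ℝ) + h (Int.fract s) := by
    intro t
    have e1 : 0 ≤ h.symm (Int.fract t) := by
      rw [← h.le_iff_le, h0, h.apply_symm_apply]; exact Int.fract_nonneg t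
    have e2 : h.symm (Int.fract t) < 1 := by
      rw [← h.lt_iff_lt, h1, h.apply_symm_apply]; exact Int.fract_lt_one t
    refine ⟨⌊t⌋ + h.symm (Int.fract t), ?_⟩
    simp only [Int.floor_intCast_add, Int.fract_intCast_add, Int.floor_eq_zero_iff.mpr ⟨e1, e2⟩,
      Int.fract_eq_self.mpr ⟨e1, e2⟩, add_zero, h.apply_symm_apply, Int.floor_add_fract]
  obtain ⟨f, hf⟩ := exists_homeo (StrictMono.orderIsoOfSurjective _ hmono hsurj) fun s => by
    simp only [StrictMono.coe_orderIsoOfSurjective, Int.floor_add_one, Int.fract_add_one]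
    push_cast; ring
  refine ⟨f, fun s hs => ?_⟩
  rw [hf]
  simp only [StrictMono.coe_orderIsoOfSurjective]
  rcases hs.2.eq_or_lt with rfl | h2
  · simp [h0, h1]
  · rw [Int.floor_eq_zero_iff.mpr ⟨hs.1, h2⟩, Int.fract_eq_self.mpr ⟨hs.1, h2⟩]; simp

theorem eventually_nhdsGE_iff {P : ℝ → Prop} {t : ℝ} :
    (∀ᶠ s in 𝓝[≥] t, P s) ↔ P t ∧ ∀ᶠ s in 𝓝[>] t, P s := by
  rw [← Set.Ioi_insert, nhdsWithin_insert, eventually_sup, eventually_pure]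

theorem eventually_nhdsLE_iff {P : ℝ → Prop} {t : ℝ} :
    (∀ᶠ s in 𝓝[≤] t, P s) ↔ P t ∧ ∀ᶠ s in 𝓝[<] t, P s := by
  rw [← Set.Iio_insert, nhdsWithin_insert, eventually_sup, eventually_pure]

/-- The elements of `TA` that fix `0`, have no other singular points, and are the identity on the
left of `0`. -/
def rightGroup : Subgroup (UnitAddCircle ≃ₜ UnitAddCircle) where
  carrier := {f | IsTA f ∧ f (0 : ℝ) = (0 : ℝ) ∧ sing thompsonT f ⊆ {((0 : ℝ) : UnitAddCircle)} ∧
    ∀ᶠ s : ℝ in 𝓝[≤] 0, f s = s}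
  one_mem' := ⟨TA.one_mem, rfl, by simp [sing_one], Eventually.of_forall fun _ => rfl⟩
  mul_mem' := by
    rintro f g ⟨h1, h2, h3, h4⟩ ⟨h5, h6, h7, h8⟩
    refine ⟨TA.mul_mem h1 h5, ?_, ?_, ?_⟩
    · rw [Homeomorph.mul_apply, h6, h2]
    · intro p hp
      rcases sing_mul hp with h | h
      · exact h7 h
      · have := h3 h
        rw [Set.mem_singleton_iff, ← h6] at this
        exact g.injective this
    · filter_upwards [h4, h8] with s h9 h10
      rw [Homeomorph.mul_apply, h10, h9]
  inv_mem' := by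
    rintro f ⟨h1, h2, h3, h4⟩
    refine ⟨TA.inv_mem h1, f.symm_apply_eq.mpr h2.symm, ?_, ?_⟩
    · intro p hp
      have := h3 (sing_inv hp)
      rw [Set.mem_singleton_iff] at this ⊢
      exact (f.symm_apply_eq.mp this).trans h2
    · filter_upwards [h4] with s h5
      exact f.symm_apply_eq.mpr h5.symm

theorem isDyadic_zero : IsDyadic 0 := ⟨0, 0, by simp⟩

theorem realEquiv_isDyadic {x : ℤ × UnitCell} (hx : Line.IsBase x) : IsDyadic (realEquiv x) := by
  obtain ⟨n, a, rfl⟩ := hx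
  rw [realEquiv_cell, UnitCell.coe_bot, add_zero]
  exact ⟨a, n, rfl⟩

/-- Conjugate `φ` by `expPL` and replace it by the identity beyond the fixed point. The cutting
point is dyadic, so no singularity arises there, and equivariance under the shift becomes the
doubling condition at `0`. -/
theorem exists_mem_rightGroup_of_fixed {φ : Equiv.Perm (ℤ × UnitCell)} {x : ℤ × UnitCell}
    (hφ : Line.IsChange φ) (hx : Line.IsBase x) (hfx : φ x = x) (hx1 : x.1 ≤ -1) :
    ∃ f ∈ rightGroup, Line.HasGerm rightCoord f φ ∧
      ∀ p, f p ≠ p → ∃ z, Line.LT z x ∧ p = rightCoord z := by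
  set a := realEquiv x with ha
  have hH := strictMono_realMap hφ.mono
  have hHa : realMap φ a = a := by rw [ha, realMap_realEquiv, hfx]
  obtain ⟨h, h1, h2, h3⟩ := exists_cut_orderIso hH (realMap φ).surjective hHa
  have ha0 : a < 0 := by simpa using lt_of_fst_le (K := 0) (x := x) (by omega)
  have hc1 : expPL a < 1 := by
    have := strictMono_expPL ha0
    simpa [expPL] using this
  have hc0 := expPL_pos a
  have had : IsDyadic (expPL a) := (plAt_expPL a).isDyadic_iff.mpr (realEquiv_isDyadic hx)
  obtain ⟨f, hf⟩ := exists_homeo_of_Icc h (h2 0 le_rfl) (h3 1 hc1.le)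
  have hf0 : f (0 : ℝ) = (0 : ℝ) := by rw [hf 0 (by simp), h2 0 le_rfl]
  have hpl : ∀ t ∈ Set.Ioo (0 : ℝ) 1, PLAt h t := by
    intro t ht
    have hconj : PLAt (fun s => expPL (realMap φ (logPL s))) t :=
      (plAt_expPL _).comp ((plAt_realMap hφ _).comp (plAt_logPL ht.1))
    have heq : ∀ s, 0 < s → s ≤ expPL a → h s = expPL (realMap φ (logPL s)) := by
      intro s hs0 hs
      conv_lhs => rw [← expPL_logPL hs0]
      refine h1 _ ?_
      rwa [← strictMono_expPL.le_iff_le, expPL_logPL hs0]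
    rcases lt_trichotomy t (expPL a) with hlt | rfl | hlt
    · refine hconj.congr ?_
      filter_upwards [Ioo_mem_nhds ht.1 hlt] with s hs
      exact heq s hs.1 hs.2.le
    -- At the cutting point the left piece comes from the conjugate of `φ` and the right piece is
    -- the identity.
    · obtain ⟨-, m, -, c, -, hc, -, h6, -⟩ := hconj
      refine ⟨0, m, 0, c, isDyadic_zero, hc, ?_, ?_, Or.inl had⟩
      · filter_upwards [self_mem_nhdsWithin] with s hs
        rw [h3 s hs, zpow_zero]; ring
      · filter_upwards [h6, Ioc_mem_nhdsLE ht.1] with s h7 h8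
        rw [heq s h8.1 h8.2, h7]
    · refine plAt_affine 0 (b := 0) (isDyadic_zero) ?_
      filter_upwards [lt_mem_nhds hlt] with s hs
      rw [h3 s hs.le, zpow_zero]; ring
  have hunit : ∀ p : UnitAddCircle, ∃ t ∈ Set.Ico (0 : ℝ) 1, (t : UnitAddCircle) = p := by
    intro p
    obtain ⟨t, rfl⟩ := exists_coe p
    exact ⟨Int.fract t, ⟨Int.fract_nonneg t, Int.fract_lt_one t⟩, by
      rw [← coe_add_int _ ⌊t⌋, Int.fract_add_floor]⟩
  have hsing : sing thompsonT f ⊆ {((0 : ℝ) : UnitAddCircle)} := by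
    intro p hp
    obtain ⟨t, ht, rfl⟩ := hunit p
    rcases ht.1.eq_or_lt with rfl | ht0
    · rfl
    · refine absurd hp (notMem_sing_of_plAt (F := h) ?_ (hpl t ⟨ht0, ht.2⟩))
      filter_upwards [Ioo_mem_nhds ht0 ht.2] with s hs
      exact hf s ⟨hs.1.le, hs.2.le⟩
  have hleft : ∀ᶠ s : ℝ in 𝓝[≤] 0, f s = s := by
    rw [eventually_nhdsLE_iff]
    refine ⟨hf0, ?_⟩
    filter_upwards [Ioo_mem_nhdsLT (show expPL a - 1 < 0 by linarith)] with s hs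
    rw [← coe_add_int s 1, hf _ ⟨by push_cast; linarith [hs.1], by push_cast; linarith [hs.2]⟩,
      h3 _ (by push_cast; linarith [hs.1])]
  have hright : ∀ s < a, f (expPL s : ℝ) = (expPL (realMap φ s) : ℝ) := by
    intro s hs
    rw [hf _ ⟨(expPL_pos s).le, ((strictMono_expPL hs).trans hc1).le⟩, h1 s hs.le]
  refine ⟨f, ⟨⟨(Set.finite_singleton _).subset hsing, ?_, ?_⟩, hf0, hsing, hleft⟩, ?_, ?_⟩
  · intro p hp
    rw [hsing hp]
    exact ⟨0, isDyadic_zero, rfl⟩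
  · intro p hp
    rw [hsing hp, CommutesWithDoubling, hf0, eventually_coe, eventually_nhds_iff_sides,
      eventually_nhdsGE_iff]
    refine ⟨⟨?_, ?_⟩, ?_⟩
    · rw [hf0, doubling_coe, show (2 * 0 - 0 : ℝ) = 0 by norm_num, hf0]
    -- In logarithmic coordinates, commuting with doubling is commuting with the unit translation.
    · rw [eventually_pos_iff]
      refine ⟨⌊a⌋ - 1, fun s hs => ?_⟩
      push_cast at hs
      have hfl := Int.floor_le a
      rw [hright s (by linarith), doubling_coe, doubling_coe, sub_zero, sub_zero, ← expPL_add_one,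
        ← expPL_add_one, hright _ (by linarith), realMap_add_one hφ.commute]
    · have hl := tendsto_zpow_mul_le 1
      simp only [zpow_one] at hl
      filter_upwards [hleft, hl.eventually hleft] with s h6 h7
      rw [h6, doubling_coe, sub_zero, h7]
  · refine hasGerm_rightCoord hφ ⟨⌊a⌋, fun s hs => hright s (hs.trans_le (Int.floor_le a))⟩
  · intro p hp
    obtain ⟨t, ht, rfl⟩ := hunit p
    have ht0 : 0 < t := by
      rcases ht.1.eq_or_lt with rfl | h0
      · exact absurd hf0 hp
      · exact h0
    have htc : t < expPL a := by
      by_contra hlt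
      exact hp (by rw [hf t ⟨ht0.le, ht.2.le⟩, h3 t (not_lt.mp hlt)])
    refine ⟨realEquiv.symm (logPL t), ?_, ?_⟩
    · rw [← realEquiv_lt, Equiv.apply_symm_apply, ← strictMono_expPL.lt_iff_lt, expPL_logPL ht0]
      exact htc
    · rw [rightCoord, Equiv.apply_symm_apply, expPL_logPL ht0]

end FiniteGerm

namespace FiniteGerm

/-! ### Right germs of elements of `TA` -/

/-- A monotone bijection that commutes with the unit translation near `-∞` agrees there with one
that commutes with it everywhere. -/
theorem exists_extension {P : ℝ → ℝ} (hP : StrictMono P) (hs : Function.Surjective P) {a : ℝ}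
    (ha : ∀ s ≤ a, P (s + 1) = P s + 1) : ∃ Q : ℝ ≃o ℝ, (∀ s, Q (s + 1) = Q s + 1) ∧
      ∀ s (n : ℕ), s - n ≤ a → Q s = P (s - n) + n := by
  have hadd : ∀ (n : ℕ) s, s + n ≤ a → P (s + n) = P s + n := by
    intro n
    induction n with
    | zero => simp
    | succ n ih =>
      intro s h
      push_cast at h ⊢
      rw [← add_assoc, ha _ (by linarith), ih s (by linarith), add_assoc]
  have hind : ∀ s (n m : ℕ), n ≤ m → s - n ≤ a → P (s - m) + m = P (s - n) + n := by
    intro s n m hnm h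
    obtain ⟨k, rfl⟩ := Nat.exists_eq_add_of_le hnm
    push_cast
    rw [show s - n = s - (n + k) + k by ring, hadd k _ (by linarith)]
    ring
  have hex : ∀ s, ∃ n : ℕ, s - n ≤ a := by
    intro s
    obtain ⟨n, hn⟩ := exists_nat_ge (s - a)
    exact ⟨n, by linarith⟩
  choose N hN using hex
  let Q : ℝ → ℝ := fun s => P (s - N s) + N s
  have hQ : ∀ s (n : ℕ), s - n ≤ a → Q s = P (s - n) + n := by
    intro s n hn
    rcases le_total n (N s) with h | h
    · exact hind s n (N s) h hn
    · exact (hind s (N s) n h (hN s)).symm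
  have hmono : StrictMono Q := by
    intro s t hst
    rw [hQ s (N t) (by linarith [hN t]), hQ t (N t) (hN t)]
    have : s - N t < t - N t := by linarith
    linarith [hP this]
  have hsurj : Function.Surjective Q := by
    intro t
    obtain ⟨n, hn⟩ := exists_nat_ge (t - P a)
    obtain ⟨s, hs⟩ := hs (t - n)
    have hsa : s ≤ a := by
      rw [← hP.le_iff_le, hs]; linarith
    refine ⟨s + n, ?_⟩
    rw [hQ (s + n) n (by linarith), add_sub_cancel_right, hs]
    ring
  refine ⟨StrictMono.orderIsoOfSurjective Q hmono hsurj, fun s => ?_, hQ⟩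
  simp only [StrictMono.coe_orderIsoOfSurjective]
  have h1 : s + 1 - ((N s + 1 : ℕ) : ℝ) = s - N s := by push_cast; ring
  rw [hQ (s + 1) (N s + 1) (by rw [h1]; exact hN s), hQ s (N s) (hN s), h1]
  push_cast
  ring

theorem IsTA.exists_lift_zero {f : UnitAddCircle ≃ₜ UnitAddCircle} (hf : IsTA f)
    (hf0 : f (0 : ℝ) = (0 : ℝ)) :
    ∃ F : ℝ ≃o ℝ, F 0 = 0 ∧ ∀ s : ℝ, (F s : UnitAddCircle) = f s := by
  obtain ⟨F, -, hF⟩ := hf.exists_lift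
  obtain ⟨k, hk⟩ := coe_eq_coe ((hF 0).trans hf0)
  refine ⟨F.trans (OrderIso.addRight (-(k : ℝ))), by simp [hk], fun s => ?_⟩
  rw [← hF]
  have := coe_add_int (F s) (-k)
  push_cast at this
  exact this

/-- In the logarithmic coordinate, `f` commutes with the unit translation near `-∞`, by the doubling
condition. It is also piecewise linear there, since singular points do not accumulate at `0`. Its
equivariant extension is therefore a change of labelled partition. -/
theorem exists_rightGerm {f : UnitAddCircle ≃ₜ UnitAddCircle} (hf : IsTA f)
    (hf0 : f (0 : ℝ) = (0 : ℝ)) : ∃ φ, Line.IsChange φ ∧ Line.HasGerm rightCoord f φ := by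
  obtain ⟨F, hF0, hF⟩ := hf.exists_lift_zero hf0
  have hd : ∀ᶠ s in 𝓝[>] 0, 2 * F s = F (2 * s) := by
    have hc := hf.commutesWithDoubling ((0 : ℝ) : UnitAddCircle)
    rw [CommutesWithDoubling, hf0, eventually_coe] at hc
    refine (eventually_eq_of_coe_eq (t := 0) (by fun_prop) (by fun_prop) le_rfl (by simp [hF0])
      ?_).filter_mono nhdsWithin_le_nhds
    filter_upwards [hc] with s hs
    rw [← hF, doubling_coe, doubling_coe, ← hF] at hs
    simpa using hs
  have hs : ∀ᶠ s in 𝓝[>] 0, PLAt F s := by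
    have := (eventually_notMem_finite hf.finite 0).filter_mono
      (nhdsWithin_mono 0 (fun s (hs : s ∈ Set.Ioi (0 : ℝ)) => ne_of_gt hs))
    filter_upwards [this] with s hs
    exact plAt_of_notMem_sing F.continuous hF hs
  obtain ⟨K, hK⟩ := eventually_pos_iff.mp (hd.and hs)
  have hpos : ∀ s, 0 < F (expPL s) := fun s => by
    rw [← hF0]; exact F.strictMono (expPL_pos s)
  let P : ℝ → ℝ := fun s => logPL (F (expPL s))
  have hP : ∀ s, expPL (P s) = F (expPL s) := fun s => expPL_logPL (hpos s)
  have hPm : StrictMono P := by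
    intro s t hst
    rw [← strictMono_expPL.lt_iff_lt, hP, hP]
    exact F.strictMono (strictMono_expPL hst)
  have hPs : Function.Surjective P := by
    intro t
    have h0 : 0 < F.symm (expPL t) := by
      rw [← F.lt_iff_lt, hF0, F.apply_symm_apply]; exact expPL_pos t
    obtain ⟨s, hs⟩ := exists_expPL_eq h0
    refine ⟨s, ?_⟩
    rw [← strictMono_expPL.injective.eq_iff, hP, hs, F.apply_symm_apply]
  have hPpl : ∀ s < (K : ℝ), PLAt P s := fun s hs =>
    PLAt.comp (F := fun s => F (expPL s)) (plAt_logPL (hpos s)) ((hK s hs).2.comp (plAt_expPL s))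
  obtain ⟨Q, hQ1, hQ⟩ := exists_extension hPm hPs (a := K - 1) fun s hs => by
    rw [← strictMono_expPL.injective.eq_iff, hP, expPL_add_one, expPL_add_one, hP,
      (hK s (by linarith)).1]
  have hQpl : ∀ t, PLAt Q t := by
    intro t
    obtain ⟨n, hn⟩ := exists_nat_ge (t + 1 - (K - 1))
    have h1 : PLAt (fun s => s - (n : ℝ)) t := by
      refine plAt_affine 0 ((IsDyadic.int n).neg) (Eventually.of_forall fun s => ?_)
      simp [sub_eq_add_neg]
    have h2 : PLAt (fun s => s + (n : ℝ)) (P (t - n)) := by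
      refine plAt_affine 0 (IsDyadic.int n) (Eventually.of_forall fun s => ?_)
      simp
    refine (PLAt.comp (F := fun s => P (s - n)) h2
      (PLAt.comp (F := fun s => s - (n : ℝ)) (hPpl _ (by linarith)) h1)).congr ?_
    filter_upwards [gt_mem_nhds (show t < t + 1 by linarith)] with s hs
    exact hQ s n (by linarith)
  obtain ⟨φ, hφ, hφQ⟩ := exists_isChange_of_orderIso Q hQ1 hQpl
  refine ⟨φ, hφ, hasGerm_rightCoord hφ ⟨K - 1, fun s hs => ?_⟩⟩
  push_cast at hs
  have := hQ s 0 (by simpa using hs.le)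
  simp only [Nat.cast_zero, sub_zero, add_zero] at this
  rw [hφQ, this, hP, hF]

/-- Agreeing locally with elements of `T` makes a lift piecewise linear everywhere, and compactness
leaves finitely many breakpoints. -/
theorem mem_thompsonT_of_sing_eq_empty {f : UnitAddCircle ≃ₜ UnitAddCircle}
    (h : sing thompsonT f = ∅) : f ∈ thompsonT := by
  have hf : IsTA f := by constructor <;> simp [h]
  obtain ⟨F, -, hF⟩ := hf.exists_lift
  refine mem_thompsonT_of_plAt hF fun t => plAt_of_notMem_sing F.continuous hF ?_
  rw [h]
  exact Set.notMem_empty _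

theorem notMem_sing_of_eventually_eq {X : Type*} [TopologicalSpace X] {B : Subgroup (X ≃ₜ X)}
    {f : X ≃ₜ X} {p : X} (h : ∀ᶠ x in 𝓝 p, f x = x) : p ∉ sing B f :=
  notMem_sing.mpr ⟨1, B.one_mem, h⟩

/-- Every right germ of an element of `TA` that fixes `0` is the right germ of an element of a given
normal subgroup whose left germ is trivial. -/
theorem exists_mem_rightGroup {N : Subgroup TA} [N.Normal] {U : Set UnitAddCircle}
    (hU : U ∈ 𝓝 ((0 : ℝ) : UnitAddCircle))
    (hcomm : ∀ f g : TA, (∀ p ∉ U, f.1 p = p) → (∀ p ∉ U, g.1 p = p) → f * g * f⁻¹ * g⁻¹ ∈ N)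
    {f : UnitAddCircle ≃ₜ UnitAddCircle} (hf : IsTA f) (hf0 : f (0 : ℝ) = (0 : ℝ)) :
    ∃ k ∈ N, k.1 ∈ rightGroup ∧ ∀ᶠ s : ℝ in 𝓝[≥] 0, f s = k.1 s := by
  obtain ⟨φ, hφ, K, hK⟩ := exists_rightGerm hf hf0
  obtain ⟨K₀, hK₀⟩ := eventually_pos_iff.mp
    ((eventually_coe.mp hU).filter_mono (nhdsWithin_le_nhds (s := Set.Ioi 0)))
  have hθ : ∀ {P : UnitAddCircle → Prop} {K : ℤ}, (∀ x, x.1 ≤ K → P (rightCoord x)) →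
      ∀ᶠ s : ℝ in 𝓝[>] 0, P s := by
    intro P K h
    rw [eventually_pos_iff]
    refine ⟨K, fun s hs => ?_⟩
    obtain ⟨x, rfl⟩ := realEquiv.surjective s
    exact h x (fst_lt_of_lt hs).le
  have key : ∃ k : TA, k.1 ∈ rightGroup ∧ k ∈ N ∧ Line.HasGerm rightCoord k.1 φ := by
    refine Line.exists_mem_of_isChange (U := U) (K₀ := K₀ - 1) ?_ ?_ ?_ ?_ hcomm hφ
    -- If the right germ is trivial too, then `0`, the only possible singular point, is regular, so
    -- `g` lies in `T` and hence in `N`.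
    · rintro g ⟨-, h0, h1, h2⟩ ⟨M, hM⟩
      refine mem_of_mem_thompsonT hU hcomm g (mem_thompsonT_of_sing_eq_empty ?_)
      have : ((0 : ℝ) : UnitAddCircle) ∉ sing thompsonT g.1 := by
        refine notMem_sing_of_eventually_eq ?_
        rw [eventually_coe, eventually_nhds_iff_sides, eventually_nhdsGE_iff]
        exact ⟨⟨h0, hθ (P := fun p => g.1 p = p) hM⟩, h2⟩
      ext p
      simp only [Set.mem_empty_iff_false, iff_false]
      intro hp
      rw [h1 hp] at hp
      exact this hp
    -- Slope two on the right of `0` is the shift in the logarithmic coordinate, and slope one on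
    -- the left keeps `g` in `rightGroup`.
    · obtain ⟨g, hg, h1, h2⟩ := exists_hasSlopes 1 0
      refine ⟨⟨g, isTA_of_mem_thompsonT hg⟩, ⟨isTA_of_mem_thompsonT hg, ?_, ?_, ?_⟩,
        mem_of_mem_thompsonT hU hcomm _ hg, ?_⟩
      · simpa using self_of_ge h1
      · simp [sing_of_mem hg]
      · simpa using h2
      · refine hasGerm_rightCoord Line.isChange_shift ?_
        obtain ⟨M, hM⟩ := eventually_pos_iff.mp (eventually_nhdsGE_iff.mp h1).2
        refine ⟨M, fun s hs => ?_⟩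
        obtain ⟨x, rfl⟩ := realEquiv.surjective s
        rw [hM _ hs, realMap_realEquiv, realEquiv_shift, expPL_add_one, zpow_one]
    · intro φ x hφ hx hfx hx1
      obtain ⟨g, hg, h1, h2⟩ := exists_mem_rightGroup_of_fixed hφ hx hfx hx1
      exact ⟨⟨g, hg.1⟩, hg, h1, h2⟩
    · intro x hx
      exact hK₀ _ (lt_of_fst_le hx)
  obtain ⟨k, hk, hkN, L, hL⟩ := key
  refine ⟨k, hkN, hk, ?_⟩
  rw [eventually_nhdsGE_iff]
  refine ⟨by rw [hf0, hk.2.1], hθ (P := fun p => f p = k.1 p) (K := min K L) fun x hx => ?_⟩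
  rw [(hK x (hx.trans (min_le_left _ _))).2, (hL x (hx.trans (min_le_right _ _))).2]

/-! ### Reflection -/

/-- The reflection of the circle. -/
def reflection : UnitAddCircle ≃ₜ UnitAddCircle := Homeomorph.neg _

theorem reflection_coe (s : ℝ) : reflection (s : UnitAddCircle) = ((-s : ℝ) : UnitAddCircle) := rfl

theorem reflection_reflection (p : UnitAddCircle) : reflection (reflection p) = p := neg_neg p

theorem conj_reflection_apply (f : UnitAddCircle ≃ₜ UnitAddCircle) (p : UnitAddCircle) :
    (MulAut.conj reflection f) p = reflection (f (reflection p)) := rfl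

theorem tendsto_reflection (t : ℝ) : Tendsto (fun s : ℝ => -s) (𝓝 t) (𝓝 (-t)) :=
  continuous_neg.tendsto t

theorem conj_reflection_mem_thompsonT {f : UnitAddCircle ≃ₜ UnitAddCircle} (hf : f ∈ thompsonT) :
    MulAut.conj reflection f ∈ thompsonT := by
  obtain ⟨D, hD, hDd, h⟩ := hf
  refine ⟨reflection ⁻¹' D, hD.preimage reflection.injective.injOn, ?_, ?_⟩
  · intro p hp
    obtain ⟨t, rfl⟩ := exists_coe p
    rw [Set.mem_preimage, reflection_coe] at hp
    have := (isDyadicPoint_coe.mp (hDd _ hp)).neg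
    rw [neg_neg] at this
    exact isDyadicPoint_coe.mpr this
  · intro t ht
    rw [Set.mem_preimage, reflection_coe] at ht
    obtain ⟨n, b, hb, h⟩ := h (-t) ht
    refine ⟨n, -b, hb.neg, ?_⟩
    filter_upwards [(tendsto_reflection t).eventually h] with s hs
    rw [conj_reflection_apply, reflection_coe, hs, reflection_coe]
    congr 1; ring

theorem sing_conj_reflection {f : UnitAddCircle ≃ₜ UnitAddCircle} {p : UnitAddCircle}
    (hp : p ∈ sing thompsonT (MulAut.conj reflection f)) : reflection p ∈ sing thompsonT f := by
  by_contra hn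
  rw [notMem_sing] at hn
  obtain ⟨b, hb, h⟩ := hn
  refine hp ⟨_, conj_reflection_mem_thompsonT hb, ?_⟩
  filter_upwards [(tendsto_homeo reflection p).eventually h] with x hx
  rw [conj_reflection_apply, hx, conj_reflection_apply]

theorem reflection_doubling (p x : UnitAddCircle) :
    reflection (doubling p x) = doubling (reflection p) (reflection x) := by
  obtain ⟨t, rfl⟩ := exists_coe p
  obtain ⟨s, rfl⟩ := exists_coe x
  rw [reflection_coe, reflection_coe, doubling_coe, doubling_coe, reflection_coe]
  congr 1; ring

theorem conj_reflection_mem_TA {f : UnitAddCircle ≃ₜ UnitAddCircle} (hf : f ∈ TA) :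
    MulAut.conj reflection f ∈ TA := by
  refine ⟨?_, ?_, ?_⟩
  · exact (hf.finite.preimage reflection.injective.injOn).subset fun p hp => sing_conj_reflection hp
  · intro p hp
    have := hf.dyadic _ (sing_conj_reflection hp)
    obtain ⟨t, rfl⟩ := exists_coe p
    rw [reflection_coe, isDyadicPoint_coe] at this
    have := this.neg
    rw [neg_neg] at this
    exact isDyadicPoint_coe.mpr this
  · intro p hp
    have := hf.commutes _ (sing_conj_reflection hp)
    filter_upwards [(tendsto_homeo reflection p).eventually this] with x hx
    rw [conj_reflection_apply, conj_reflection_apply, conj_reflection_apply, reflection_doubling,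
      ← hx, reflection_doubling]

/-- The automorphism of `TA` given by conjugation with the reflection. -/
def flipTA : TA →* TA where
  toFun f := ⟨MulAut.conj reflection f.1, conj_reflection_mem_TA f.2⟩
  map_one' := Subtype.ext (map_one _)
  map_mul' _ _ := Subtype.ext (map_mul _ _ _)

/-- Left germs, in analogy with `exists_mem_rightGroup`. -/
theorem exists_mem_leftGroup {N : Subgroup TA} [N.Normal] {U : Set UnitAddCircle}
    (hU : U ∈ 𝓝 ((0 : ℝ) : UnitAddCircle))
    (hcomm : ∀ f g : TA, (∀ p ∉ U, f.1 p = p) → (∀ p ∉ U, g.1 p = p) → f * g * f⁻¹ * g⁻¹ ∈ N)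
    {f : UnitAddCircle ≃ₜ UnitAddCircle} (hf : IsTA f) (hf0 : f (0 : ℝ) = (0 : ℝ)) :
    ∃ k ∈ N, k.1 (0 : ℝ) = (0 : ℝ) ∧ sing thompsonT k.1 ⊆ {((0 : ℝ) : UnitAddCircle)} ∧
      (∀ᶠ s : ℝ in 𝓝[≥] 0, k.1 s = s) ∧ ∀ᶠ s : ℝ in 𝓝[≤] 0, f s = k.1 s := by
  have hr0 : reflection ((0 : ℝ) : UnitAddCircle) = (0 : ℝ) := by rw [reflection_coe, neg_zero]
  have hU' : reflection ⁻¹' U ∈ 𝓝 ((0 : ℝ) : UnitAddCircle) := by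
    refine (tendsto_homeo reflection _) ?_
    rwa [hr0]
  have hsupp : ∀ g : TA, (∀ p ∉ reflection ⁻¹' U, g.1 p = p) → ∀ p ∉ U, (flipTA g).1 p = p := by
    intro g hg p hp
    change reflection (g.1 (reflection p)) = p
    rw [hg _ (by rwa [Set.mem_preimage, reflection_reflection]), reflection_reflection]
  -- The case of right germs is applied to the preimage of `N` under conjugation by the reflection.
  obtain ⟨k, hkN, ⟨-, hk0, hks, hkl⟩, hk⟩ := exists_mem_rightGroup (N := N.comap flipTA) hU'
    (fun g h hg hh => by
      rw [Subgroup.mem_comap, map_mul, map_mul, map_mul, map_inv, map_inv]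
      exact hcomm _ _ (hsupp g hg) (hsupp h hh))
    (f := MulAut.conj reflection f) (conj_reflection_mem_TA hf)
    (by rw [conj_reflection_apply, hr0, hf0, hr0])
  have l1 : Tendsto (fun s : ℝ => -s) (𝓝[≥] 0) (𝓝[≤] 0) := by
    simpa using tendsto_neg_nhdsGE_neg (a := (0 : ℝ))
  have l2 : Tendsto (fun s : ℝ => -s) (𝓝[≤] 0) (𝓝[≥] 0) := by
    simpa using tendsto_neg_nhdsLE_neg (a := (0 : ℝ))
  refine ⟨flipTA k, hkN, ?_, ?_, ?_, ?_⟩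
  · change reflection (k.1 (reflection _)) = _
    rw [hr0, hk0, hr0]
  · intro p hp
    have := hks (sing_conj_reflection hp)
    rw [Set.mem_singleton_iff] at this ⊢
    rw [← reflection_reflection p, this, hr0]
  · filter_upwards [l1.eventually hkl] with s hs
    change reflection (k.1 (reflection _)) = _
    rw [reflection_coe, hs, reflection_coe, neg_neg]
  · filter_upwards [l2.eventually hk] with s hs
    change _ = reflection (k.1 (reflection _))
    rw [reflection_coe, ← hs, conj_reflection_apply, reflection_reflection, reflection_coe, neg_neg]

end FiniteGerm

namespace FiniteGerm

/-! ### Simplicity of `TA` -/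

/-- A normal subgroup of `TA` that contains the commutators of elements supported near `0` is the
whole group. -/
theorem mem_of_commutators {N : Subgroup TA} [hN : N.Normal] {U : Set UnitAddCircle}
    (hU : U ∈ 𝓝 ((0 : ℝ) : UnitAddCircle))
    (hcomm : ∀ f g : TA, (∀ p ∉ U, f.1 p = p) → (∀ p ∉ U, g.1 p = p) → f * g * f⁻¹ * g⁻¹ ∈ N)
    (f : TA) : f ∈ N := by
  induction hn : (sing thompsonT f.1).ncard using Nat.strong_induction_on generalizing f with
  | _ n ih =>
  have hT : ∀ {g : UnitAddCircle ≃ₜ UnitAddCircle} (hg : g ∈ thompsonT),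
      (⟨g, isTA_of_mem_thompsonT hg⟩ : TA) ∈ N := fun hg => mem_of_mem_thompsonT hU hcomm _ hg
  rcases (sing thompsonT f.1).eq_empty_or_nonempty with h0 | ⟨p, hp⟩
  · exact mem_of_mem_thompsonT hU hcomm f (mem_thompsonT_of_sing_eq_empty h0)
  obtain ⟨t, ht, rfl⟩ := f.2.dyadic p hp
  obtain ⟨u, hu, hfu⟩ := (f.2.isDyadicPoint_iff t).mpr (f.2.dyadic _ hp)
  -- Dyadic rotations take the singular point and its image to `0` without creating singularities.
  set r : TA := ⟨rotation t, isTA_of_mem_thompsonT (rotation_mem ht)⟩ with hr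
  set r' : TA := ⟨rotation (-u), isTA_of_mem_thompsonT (rotation_mem hu.neg)⟩ with hr'
  have hr0 : r.1 (0 : ℝ) = t := by
    change rotation t _ = _
    rw [rotation_coe, zero_add]
  set g : TA := r' * f * r with hg
  have hg0 : g.1 (0 : ℝ) = (0 : ℝ) := by
    change r'.1 (f.1 (r.1 _)) = _
    rw [hr0, ← hfu]
    change rotation (-u) _ = _
    rw [rotation_coe, add_neg_cancel]
  obtain ⟨k, hkN, ⟨-, hk0, hks, hkl⟩, hk⟩ := exists_mem_rightGroup hU hcomm g.2 hg0
  obtain ⟨l, hlN, hl0, hls, hlr, hl⟩ := exists_mem_leftGroup hU hcomm g.2 hg0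
  -- The map `q ↦ r ((l * k)⁻¹ q)` embeds the singular points of `g * (l * k)⁻¹` into those of `f`
  -- and misses `t`, because `0` is no longer singular.
  have hfac : ∀ q : UnitAddCircle, q ∈ sing thompsonT (g * (l * k)⁻¹).1 →
      (q ≠ (0 : ℝ)) ∧ (r.1 ((l * k)⁻¹.1 q)) ∈ sing thompsonT f.1 := by
    have hinv : ∀ s : UnitAddCircle, (l * k)⁻¹.1 ((l * k).1 s) = s := (l * k).1.symm_apply_apply
    have hinv' : ∀ s : UnitAddCircle, (l * k).1 ((l * k)⁻¹.1 s) = s := (l * k).1.apply_symm_apply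
    have hlk0 : (l * k).1 (0 : ℝ) = (0 : ℝ) := by
      change l.1 (k.1 _) = _
      rw [hk0, hl0]
    have hlk0' : (l * k)⁻¹.1 (0 : ℝ) = (0 : ℝ) := by
      conv_lhs => rw [← hlk0]
      exact hinv _
    -- On the left of `0` only `l` acts. On the right `k` acts and stays on the right, since its
    -- lift is increasing and fixes `0`, and `l` is trivial there.
    have hev : ∀ᶠ x in 𝓝 ((0 : ℝ) : UnitAddCircle), (l * k).1 x = g.1 x := by
      obtain ⟨K, hK0, hK⟩ := k.2.exists_lift_zero hk0
      rw [eventually_coe, eventually_nhds_iff_sides]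
      constructor
      · have hlim : Tendsto K (𝓝[≥] 0) (𝓝[≥] 0) := by
          refine tendsto_nhdsWithin_iff.mpr ⟨?_, ?_⟩
          · conv_rhs => rw [← hK0]
            exact (K.continuous.tendsto 0).mono_left nhdsWithin_le_nhds
          · filter_upwards [self_mem_nhdsWithin] with s hs
            rw [Set.mem_Ici, ← hK0]
            exact K.monotone hs
        filter_upwards [hk, hlim.eventually hlr] with s h1 h2
        rw [h1]
        change l.1 (k.1 s) = _
        rw [← hK, h2]
      · filter_upwards [hl, hkl] with s h1 h2
        change l.1 (k.1 s) = _
        rw [h2, h1]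
    have h0n : ((0 : ℝ) : UnitAddCircle) ∉ sing thompsonT (g * (l * k)⁻¹).1 := by
      refine notMem_sing_of_eventually_eq ?_
      have := tendsto_homeo (l * k)⁻¹.1 ((0 : ℝ) : UnitAddCircle)
      rw [hlk0'] at this
      filter_upwards [this.eventually hev] with x hx
      rw [hinv'] at hx
      exact hx.symm
    intro q hq
    have hq0 : q ≠ (0 : ℝ) := fun h => h0n (h ▸ hq)
    refine ⟨hq0, ?_⟩
    rcases sing_mul (f := g.1) (g := (l * k)⁻¹.1) hq with h | h
    · exfalso
      have := sing_inv (f := (l * k).1) h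
      rcases sing_mul (f := l.1) (g := k.1) this with h | h
      · have := hks h
        apply hq0
        rw [← hinv' q, ← hlk0]
        exact congrArg _ this
      · have := hls h
        apply hq0
        rw [← hinv' q]
        exact (congrArg l.1 this).trans hl0
    · rcases sing_mul (f := (r' * f).1) (g := r.1) h with h | h
      · rw [sing_of_mem (rotation_mem ht)] at h
        exact absurd h (Set.notMem_empty _)
      · rcases sing_mul (f := r'.1) (g := f.1) h with h | h
        · exact h
        · rw [sing_of_mem (rotation_mem hu.neg)] at h
          exact absurd h (Set.notMem_empty _)
  have hlk : l * k ∈ N := N.mul_mem hlN hkN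
  have key : g * (l * k)⁻¹ ∈ N := by
    refine ih _ ?_ _ rfl
    rw [← hn]
    have hinj : Function.Injective fun q => r.1 ((l * k)⁻¹.1 q) :=
      r.1.injective.comp (l * k)⁻¹.1.injective
    rw [← Set.ncard_image_of_injective _ hinj]
    refine Set.ncard_lt_ncard ?_ f.2.finite
    rw [Set.ssubset_iff_of_subset (by rintro _ ⟨q, hq, rfl⟩; exact (hfac q hq).2)]
    refine ⟨t, hp, ?_⟩
    rintro ⟨q, hq, h⟩
    apply (hfac q hq).1
    have h1 : (l * k)⁻¹.1 q = (0 : ℝ) := r.1.injective (h.trans hr0.symm)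
    have h2 : q = (l * k).1 (0 : ℝ) := (Homeomorph.symm_apply_eq _).mp h1
    rw [h2]
    change l.1 (k.1 _) = _
    rw [hk0, hl0]
  have hgN : g ∈ N := by
    have := N.mul_mem key hlk
    rwa [inv_mul_cancel_right] at this
  have : f = r'⁻¹ * g * r⁻¹ := by rw [hg]; group
  rw [this]
  exact N.mul_mem (N.mul_mem (N.inv_mem (hT (rotation_mem hu.neg))) hgN)
    (N.inv_mem (hT (rotation_mem ht)))

theorem isSimpleGroup_TA : IsSimpleGroup TA := by
  have hT : ∀ {t : ℝ}, IsDyadic t → rotation t ∈ TA := fun ht =>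
    isTA_of_mem_thompsonT (rotation_mem ht)
  have : Nontrivial TA := by
    refine ⟨⟨rotation (1 / 2), hT ⟨1, 1, by norm_num⟩⟩, 1, fun h => ?_⟩
    have h1 : rotation (1 / 2) ((0 : ℝ) : UnitAddCircle) = (0 : ℝ) :=
      congrArg (fun f : TA => f.1 ((0 : ℝ) : UnitAddCircle)) h
    rw [rotation_coe] at h1
    obtain ⟨k, hk⟩ := coe_eq_coe h1
    have : (1 : ℝ) = ((2 * k : ℤ) : ℝ) := by push_cast; linarith
    have : (1 : ℤ) = 2 * k := by exact_mod_cast this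
    omega
  refine ⟨fun N hN => ?_⟩
  rw [or_iff_not_imp_left, Subgroup.eq_bot_iff_forall]
  intro hne
  push Not at hne
  obtain ⟨f, hf, hf1⟩ := hne
  obtain ⟨p, hp⟩ : ∃ p, f.1 p ≠ p := by
    by_contra! h
    exact hf1 (Subtype.ext (Homeomorph.ext h))
  -- The set of points that are moved is open, so it contains a dyadic point, and a dyadic rotation
  -- can bring that point to `0`.
  obtain ⟨t, ht, htp⟩ : ∃ t : ℝ, IsDyadic t ∧ f.1 t ≠ t := by
    obtain ⟨s, rfl⟩ := exists_coe p
    have hev : ∀ᶠ x in 𝓝 (s : UnitAddCircle), f.1 x ≠ x :=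
      (isOpen_ne_fun f.1.continuous continuous_id).mem_nhds hp
    obtain ⟨ε, hε, hball⟩ := Metric.eventually_nhds_iff.mp (eventually_coe.mp hev)
    obtain ⟨d, hd, h1, h2⟩ := exists_isDyadic_le s hε
    refine ⟨d, hd, hball ?_⟩
    rw [Real.dist_eq, abs_lt]
    constructor <;> linarith
  have hconj := hN.conj_mem f hf ⟨rotation (-t), hT ht.neg⟩
  set g := (⟨rotation (-t), hT ht.neg⟩ : TA) * f * (⟨rotation (-t), hT ht.neg⟩ : TA)⁻¹ with hg
  have hinv : (rotation (-t))⁻¹ ((0 : ℝ) : UnitAddCircle) = t := by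
    refine (Homeomorph.symm_apply_eq _).mpr ?_
    rw [rotation_coe, add_neg_cancel]
  have hg0 : g.1 (0 : ℝ) ≠ (0 : ℝ) := by
    change rotation (-t) (f.1 ((rotation (-t))⁻¹ _)) ≠ _
    rw [hinv]
    intro h
    exact htp (((Homeomorph.symm_apply_eq _).mpr h.symm).symm.trans hinv)
  obtain ⟨U, V, hUo, hVo, h0U, h0V, hUV⟩ := t2_separation hg0
  have hU : V ∩ g.1 ⁻¹' U ∈ 𝓝 ((0 : ℝ) : UnitAddCircle) :=
    Filter.inter_mem (hVo.mem_nhds h0V) ((tendsto_homeo g.1 _) (hUo.mem_nhds h0U))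
  rw [eq_top_iff]
  rintro h -
  exact mem_of_commutators hU (fun h k hh hk => Line.commutator_mem hconj
    (fun p hp hp' => Set.disjoint_left.mp hUV hp.2 hp'.1) h k hh hk) h

end FiniteGerm

namespace FiniteGerm

/-! ### The Cantor set as a self-similar cell -/

theorem cat_head_tail (x : Cantor) : cat [x 0] (fun i => x (i + 1)) = x := by
  funext i
  cases i <;> rfl

theorem exists_eq_cat_singleton (x : Cantor) : ∃ b y, x = cat [b] y :=
  ⟨_, _, (cat_head_tail x).symm⟩

theorem toLex_cat_singleton_lt {b c : Bool} {x y : Cantor} :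
    toLex (cat [b] x) < toLex (cat [c] y) ↔ b < c ∨ b = c ∧ toLex x < toLex y := by
  by_cases h : b = c
  · subst h
    rw [toLex_cat_lt]
    simp
  · simp only [h, false_and, or_false]
    constructor
    · rintro ⟨i, h1, h2⟩
      cases i with
      | zero => exact h2
      | succ i => exact absurd (h1 0 (Nat.succ_pos i)) h
    · intro h
      exact ⟨0, fun j hj => absurd hj (Nat.not_lt_zero j), h⟩

noncomputable instance : Halving (Lex Cantor) where
  sp :=
    { toFun y := (ofLex y 0, toLex fun i => ofLex y (i + 1))
      invFun x := toLex (cat [x.1] (ofLex x.2))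
      left_inv := fun y => congrArg toLex (cat_head_tail (ofLex y))
      right_inv := fun _ => rfl }
  lt_iff y z := by
    have h := toLex_cat_singleton_lt (b := ofLex y 0) (c := ofLex z 0)
      (x := fun i => ofLex y (i + 1)) (y := fun i => ofLex z (i + 1))
    rwa [cat_head_tail, cat_head_tail] at h
  sp_bot := rfl

theorem sp_symm_cantor (b : Bool) (y : Lex Cantor) :
    Halving.sp.symm (b, y) = toLex (cat [b] (ofLex y)) := rfl

/-! ### A coordinate near `000⋯` -/

/-- The sequence `0 ⋯ 0 1 ψ` with `-k` leading zeros. -/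
def zeroCoord (z : ℤ × Lex Cantor) : Cantor :=
  cat (List.replicate (-z.1).toNat false) (cat [true] (ofLex z.2))

/-- Lowering the index prepends zeros, so near `000⋯` the shift of the line is the deletion of a
zero. The bound on the index is needed because `toNat` truncates the number of zeros at 0. -/
theorem zeroCoord_sub {z : ℤ × Lex Cantor} (hz : z.1 ≤ 0) (n : ℕ) :
    zeroCoord (z.1 - n, z.2) = cat (List.replicate n false) (zeroCoord z) := by
  have : (-(z.1 - n)).toNat = n + (-z.1).toNat := by omega
  rw [zeroCoord, zeroCoord, this, List.replicate_add, cat_append]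

theorem zeroCoord_sub_one {z : ℤ × Lex Cantor} (hz : z.1 ≤ 0) :
    zeroCoord (z.1 - 1, z.2) = cat [false] (zeroCoord z) := by
  simpa using zeroCoord_sub hz 1

theorem exists_zeroCoord_of_le {z : ℤ × Lex Cantor} {n : ℕ} (h : z.1 ≤ -n) :
    ∃ w : ℤ × Lex Cantor, w.1 ≤ 0 ∧ z = (w.1 - n, w.2) :=
  ⟨(z.1 + n, z.2), by simp only; omega, by simp⟩

theorem zeroCoord_lt_of_lt {z w : ℤ × Lex Cantor} (hw : w.1 ≤ 0) (h : Line.LT z w) :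
    toLex (zeroCoord z) < toLex (zeroCoord w) := by
  rcases h with h | ⟨h, h'⟩
  · obtain ⟨n, hn⟩ : ∃ n : ℕ, (-z.1).toNat = (-w.1).toNat + (n + 1) :=
      ⟨(-z.1).toNat - (-w.1).toNat - 1, by omega⟩
    rw [zeroCoord, zeroCoord, hn, List.replicate_add, cat_append, toLex_cat_lt,
      List.replicate_succ, ← List.singleton_append, cat_append, toLex_cat_singleton_lt]
    exact Or.inl rfl
  · rw [zeroCoord, zeroCoord, h, toLex_cat_lt, toLex_cat_lt]
    exact h'

theorem zeroCoord_lt_iff {z w : ℤ × Lex Cantor} (hz : z.1 ≤ 0) (hw : w.1 ≤ 0) :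
    toLex (zeroCoord z) < toLex (zeroCoord w) ↔ Line.LT z w := by
  refine ⟨fun h => ?_, zeroCoord_lt_of_lt hw⟩
  rcases Line.LT.trichotomy z w with h1 | h1 | h1
  · exact h1
  · rw [h1] at h
    exact absurd h (lt_irrefl _)
  · exact absurd h (zeroCoord_lt_of_lt hz h1).asymm

theorem zeroCoord_inj {z w : ℤ × Lex Cantor} (hz : z.1 ≤ 0) (hw : w.1 ≤ 0)
    (h : zeroCoord z = zeroCoord w) : z = w := by
  rcases Line.LT.trichotomy z w with h1 | h1 | h1
  · exact absurd (zeroCoord_lt_of_lt hw h1) (by rw [h]; exact lt_irrefl _)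
  · exact h1
  · exact absurd (zeroCoord_lt_of_lt hz h1) (by rw [h]; exact lt_irrefl _)

theorem exists_zeroCoord_eq {p : Cantor} (hp : p ≠ const false) :
    ∃ z : ℤ × Lex Cantor, z.1 ≤ 0 ∧ zeroCoord z = p := by
  obtain ⟨n, hn⟩ : ∃ n, p n = true := by
    by_contra! h
    exact hp (funext fun n => by simpa [const] using h n)
  clear hp
  induction n generalizing p with
  | zero =>
    refine ⟨(0, toLex fun i => p (i + 1)), le_rfl, ?_⟩
    have := cat_head_tail p
    rwa [hn] at this
  | succ n ih =>
    obtain ⟨b, y, rfl⟩ := exists_eq_cat_singleton p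
    cases b
    · obtain ⟨z, hz, rfl⟩ := ih (p := y) hn
      exact ⟨(z.1 - 1, z.2), by simp only; omega, zeroCoord_sub_one hz⟩
    · exact ⟨(0, toLex y), le_rfl, rfl⟩

theorem cat_eq_const_iff {α : List Bool} {ψ : Cantor} {c : Bool} :
    cat α ψ = const c ↔ α = List.replicate α.length c ∧ ψ = const c := by
  constructor
  · intro h
    obtain ⟨ε, hε⟩ := exists_append (h.trans (const_eq_replicate c α.length)) (by simp)
    have hl := congrArg List.length hε
    simp at hl
    rw [hl, List.append_nil] at hε
    refine ⟨hε.symm, ?_⟩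
    rw [← hε] at h
    conv_rhs at h => rw [const_eq_replicate c α.length]
    exact cat_inj.mp h
  · rintro ⟨h, rfl⟩
    rw [h, ← const_eq_replicate]

theorem zeroCoord_ne (z : ℤ × Lex Cantor) : zeroCoord z ≠ const false := by
  intro h
  have h1 := (cat_eq_const_iff.mp h).2
  have := (cat_eq_const_iff.mp h1).1
  simp at this

theorem eventually_const_iff {c : Bool} {P : Cantor → Prop} :
    (∀ᶠ x in 𝓝 (const c), P x) ↔ ∃ n, ∀ ψ, P (cat (List.replicate n c) ψ) := by
  constructor
  · intro h
    obtain ⟨n, hn⟩ := exists_of_mem_nhds h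
    refine ⟨n, fun ψ => hn _ fun i hi => ?_⟩
    rw [const_eq_replicate c n]
    exact cat_apply_lt (by simpa using hi)
  · rintro ⟨n, hn⟩
    have := eventually_cat (List.replicate n c) (const c)
    rw [← const_eq_replicate] at this
    filter_upwards [this] with x ⟨χ, hx⟩
    rw [hx]
    exact hn χ

/-- The coordinate reaches every point except `000⋯` itself, hence the separate clause. -/
theorem eventually_zero_iff {P : Cantor → Prop} :
    (∀ᶠ x in 𝓝 (const false), P x) ↔
      P (const false) ∧ ∃ K : ℤ, ∀ z : ℤ × Lex Cantor, z.1 ≤ K → P (zeroCoord z) := by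
  rw [eventually_const_iff]
  constructor
  · rintro ⟨n, hn⟩
    refine ⟨by rw [const_eq_replicate false n]; exact hn _, -n, fun z hz => ?_⟩
    obtain ⟨w, hw, rfl⟩ := exists_zeroCoord_of_le hz
    rw [zeroCoord_sub hw]
    exact hn _
  · rintro ⟨h0, K, hK⟩
    refine ⟨(-K).toNat, fun ψ => ?_⟩
    by_cases hψ : ψ = const false
    · rwa [hψ, ← const_eq_replicate]
    · obtain ⟨z, hz, rfl⟩ := exists_zeroCoord_eq hψ
      rw [← zeroCoord_sub hz]
      exact hK _ (by simp only; omega)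

/-! ### Cells and words -/

theorem isCell_cat (k : ℤ) (w : List Bool) :
    Line.IsCell fun y : Lex Cantor => (k, toLex (cat w (ofLex y))) := by
  induction w using List.reverseRecOn with
  | nil => exact ⟨0, k, fun y => rfl⟩
  | append_singleton w b ih =>
    obtain ⟨n, a, h⟩ := ih
    refine ⟨n + 1, 2 * a + (b.toNat : ℤ), fun y => ?_⟩
    rw [Line.cell_succ, ← h, sp_symm_cantor]
    change (k, toLex (cat (w ++ [b]) (ofLex y))) = (k, toLex (cat w (cat [b] (ofLex y))))
    rw [cat_append]

theorem exists_word_of_cell (n : ℕ) (a : ℤ) : ∃ (k : ℤ) (w : List Bool), w.length = n ∧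
    (0 ≤ a → a < 2 ^ n → k = 0) ∧
    ∀ y, (Line.double (Lex Cantor) ^ n)⁻¹ (a, y) = (k, toLex (cat w (ofLex y))) := by
  induction n generalizing a with
  | zero => exact ⟨a, [], rfl, fun h0 h1 => by omega, fun y => rfl⟩
  | succ n ih =>
    obtain ⟨b, c, rfl⟩ : ∃ (b : ℤ) (c : Bool), a = 2 * b + (c.toNat : ℤ) := by
      rcases Int.emod_two_eq_zero_or_one a with h | h
      · exact ⟨a / 2, false, by simp; omega⟩
      · exact ⟨a / 2, true, by simp; omega⟩
    obtain ⟨k, w, hw, hk, h⟩ := ih b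
    have hc : (c.toNat : ℤ) ≤ 1 ∧ (0 : ℤ) ≤ c.toNat := by cases c <;> simp
    refine ⟨k, w ++ [c], by simp [hw], fun h0 h1 => hk (by omega) ?_, fun y => ?_⟩
    · rw [pow_succ] at h1; omega
    · rw [Line.cell_succ, h, sp_symm_cantor, cat_append]
      rfl

/-- In the coordinate `zeroCoord`, cells are cones. -/
theorem exists_cat_of_cell {n : ℕ} {a : ℤ} : ∃ α : List Bool,
    ∀ y, zeroCoord ((Line.double (Lex Cantor) ^ n)⁻¹ (a, y)) = cat α (ofLex y) := by
  obtain ⟨k, w, -, -, h⟩ := exists_word_of_cell n a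
  refine ⟨List.replicate (-k).toNat false ++ [true] ++ w, fun y => ?_⟩
  rw [h, zeroCoord, cat_append, cat_append]
  rfl

/-- A word whose cone misses `000⋯` contains a 1; the zeros before the first 1 give the index of the
unit cell, and the rest is a dyadic interval in it. -/
theorem exists_cell_of_cat {β : List Bool} (h : cat β (const false) ≠ const false) :
    ∃ (n : ℕ) (a : ℤ), ∀ y, ((Line.double (Lex Cantor) ^ n)⁻¹ (a, toLex y)).1 ≤ 0 ∧
      zeroCoord ((Line.double (Lex Cantor) ^ n)⁻¹ (a, toLex y)) = cat β y := by
  have key : ∃ (m : ℕ) (w : List Bool), β = List.replicate m false ++ true :: w := by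
    induction β with
    | nil => exact absurd rfl h
    | cons b β ih =>
      cases b
      · rw [← List.singleton_append, cat_append] at h
        obtain ⟨m, w, rfl⟩ := ih fun h' => h (by rw [h']; exact (const_eq false).symm)
        exact ⟨m + 1, w, rfl⟩
      · exact ⟨0, β, rfl⟩
  obtain ⟨m, w, rfl⟩ := key
  obtain ⟨n, a, h⟩ := isCell_cat (-m) w
  refine ⟨n, a, fun y => ?_⟩
  rw [← h]
  refine ⟨by simp, ?_⟩
  rw [zeroCoord, cat_append]
  simp only [neg_neg, Int.toNat_natCast]
  rfl

/-! ### Uniformity of prefix replacements -/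

/-- A map that is a prefix replacement near all points of a compact set is one on all sufficiently
small cones that meet this set. -/
theorem exists_uniform_depth {f : Cantor ≃ₜ Cantor} {S : Set Cantor} (hS : IsCompact S)
    (h : ∀ p ∈ S, PrefixReplacementAt f p) : ∃ N, ∀ u : List Bool, N ≤ u.length →
      (∃ ψ, cat u ψ ∈ S) → ∃ β, ∀ ψ, f (cat u ψ) = cat β ψ := by
  refine hS.induction_on (p := fun S => ∃ N, ∀ u : List Bool, N ≤ u.length →
      (∃ ψ, cat u ψ ∈ S) → ∃ β, ∀ ψ, f (cat u ψ) = cat β ψ) ?_ ?_ ?_ ?_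
  · exact ⟨0, fun u _ ⟨ψ, hψ⟩ => absurd hψ (Set.notMem_empty _)⟩
  · rintro S T hST ⟨N, hN⟩
    exact ⟨N, fun u hu ⟨ψ, hψ⟩ => hN u hu ⟨ψ, hST hψ⟩⟩
  · rintro S T ⟨N, hN⟩ ⟨M, hM⟩
    refine ⟨max N M, fun u hu ⟨ψ, hψ⟩ => ?_⟩
    rcases hψ with hψ | hψ
    · exact hN u ((le_max_left _ _).trans hu) ⟨ψ, hψ⟩
    · exact hM u ((le_max_right _ _).trans hu) ⟨ψ, hψ⟩
  · intro p hp
    obtain ⟨α, β, hαβ⟩ := h p hp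
    obtain ⟨n, hn⟩ := exists_of_mem_nhds hαβ
    refine ⟨_, mem_nhdsWithin_of_mem_nhds (eventually_agree p n), max n α.length, ?_⟩
    rintro u hu ⟨ψ, hψ⟩
    have hall : ∀ χ, ∃ ξ, cat u χ = cat α ξ ∧ f (cat u χ) = cat β ξ := by
      intro χ
      refine hn _ fun i hi => ?_
      rw [← hψ i hi]
      exact cat_apply_lt (hi.trans_le ((le_max_left _ _).trans hu))
    obtain ⟨ξ, hξ, -⟩ := hall ψ
    obtain ⟨ε, rfl⟩ := exists_append hξ.symm ((le_max_right _ _).trans hu)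
    refine ⟨β ++ ε, fun χ => ?_⟩
    obtain ⟨ξ, h1, h2⟩ := hall χ
    rw [cat_append, cat_inj] at h1
    rw [h2, ← h1, cat_append]

end FiniteGerm

namespace FiniteGerm

/-! ### Swapping two cones -/

theorem continuous_cat (β : List Bool) : Continuous (cat β) := by
  induction β with
  | nil => exact continuous_id
  | cons b β ih =>
    refine continuous_pi fun i => ?_
    cases i with
    | zero => exact continuous_const
    | succ i => exact (continuous_apply i).comp ih

theorem drop_cat (α : List Bool) (ψ : Cantor) : (fun i => cat α ψ (i + α.length)) = ψ := by
  induction α with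
  | nil => rfl
  | cons a α ih => exact ih

theorem continuousAt_of_prefix {f : Cantor → Cantor} {p : Cantor} {α β : List Bool}
    (h : ∀ᶠ x in 𝓝 p, ∃ ψ, x = cat α ψ ∧ f x = cat β ψ) : ContinuousAt f p := by
  have hc : Continuous fun x : Cantor => cat β fun i => x (i + α.length) :=
    (continuous_cat β).comp (continuous_pi fun i => continuous_apply _)
  refine hc.continuousAt.congr ?_
  filter_upwards [h] with x ⟨ψ, hx, hf⟩
  rw [hf, hx, drop_cat]

/-- The cones of `α` and `β` are disjoint. -/
def Incomp (α β : List Bool) : Prop := ∀ ψ χ, cat α ψ ≠ cat β χ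

theorem Incomp.symm {α β : List Bool} (h : Incomp α β) : Incomp β α := fun ψ χ => (h χ ψ).symm

theorem Incomp.append {α β : List Bool} (h : Incomp α β) (γ δ : List Bool) :
    Incomp (α ++ γ) (β ++ δ) := fun ψ χ => by
  rw [cat_append, cat_append]; exact h _ _

theorem incomp_of_not_prefix {α β : List Bool} (hl : α.length ≤ β.length) (h : ∀ ε, β ≠ α ++ ε) :
    Incomp α β := fun _ _ he => by
  obtain ⟨ε, hε⟩ := exists_append he hl
  exact h ε hε

theorem incomp_of_length_eq {α β : List Bool} (hl : α.length = β.length) (h : α ≠ β) :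
    Incomp α β := incomp_of_not_prefix hl.le fun ε hε => by
  have := congrArg List.length hε
  rw [List.length_append] at this
  rw [List.eq_nil_of_length_eq_zero (l := ε) (by omega), List.append_nil] at hε
  exact h hε.symm

theorem incomp_append {α : List Bool} {b c : Bool} (h : b ≠ c) : Incomp (α ++ [b]) (α ++ [c]) :=
  incomp_of_length_eq (by simp) (by simpa using h)

theorem eventually_notMem_cone {α : List Bool} {p : Cantor} (h : ∀ ψ, p ≠ cat α ψ) :
    ∀ᶠ x in 𝓝 p, ∀ ψ, x ≠ cat α ψ := by
  filter_upwards [eventually_agree p α.length] with x hx ψ hψ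
  obtain ⟨χ, hχ⟩ := exists_cat_of_agree (α := α) (ψ := ψ) (x := p) fun i hi => by
    rw [← hx i hi, hψ]
  exact h χ hχ

/-- `s` interchanges the cones of `α` and `β` by prefix replacement and fixes all other points. -/
structure IsSwap (α β : List Bool) (s : Cantor → Cantor) : Prop where
  left : ∀ ψ, s (cat α ψ) = cat β ψ
  right : ∀ ψ, s (cat β ψ) = cat α ψ
  off : ∀ p, (∀ ψ, p ≠ cat α ψ) → (∀ ψ, p ≠ cat β ψ) → s p = p

theorem IsSwap.symm {α β : List Bool} {s : Cantor → Cantor} (h : IsSwap α β s) : IsSwap β α s :=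
  ⟨h.right, h.left, fun p h1 h2 => h.off p h2 h1⟩

theorem cone_cases (α β : List Bool) (p : Cantor) : (∃ ψ, p = cat α ψ) ∨ (∃ ψ, p = cat β ψ) ∨
    ((∀ ψ, p ≠ cat α ψ) ∧ ∀ ψ, p ≠ cat β ψ) := by
  by_cases h1 : ∃ ψ, p = cat α ψ
  · exact Or.inl h1
  by_cases h2 : ∃ ψ, p = cat β ψ
  · exact Or.inr (Or.inl h2)
  · push Not at h1 h2
    exact Or.inr (Or.inr ⟨h1, h2⟩)

theorem IsSwap.unique {α β : List Bool} {s t : Cantor → Cantor} (hs : IsSwap α β s)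
    (ht : IsSwap α β t) : s = t := by
  funext p
  rcases cone_cases α β p with ⟨ψ, rfl⟩ | ⟨ψ, rfl⟩ | ⟨h1, h2⟩
  · rw [hs.left, ht.left]
  · rw [hs.right, ht.right]
  · rw [hs.off p h1 h2, ht.off p h1 h2]

theorem IsSwap.fixes {α β γ : List Bool} {s : Cantor → Cantor} (hs : IsSwap α β s)
    (h1 : Incomp α γ) (h2 : Incomp β γ) (ψ : Cantor) : s (cat γ ψ) = cat γ ψ :=
  hs.off _ (fun _ => (h1 _ _).symm) fun _ => (h2 _ _).symm

theorem IsSwap.prefixReplacement {α β : List Bool} {s : Cantor → Cantor} (hs : IsSwap α β s)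
    (p : Cantor) : ∃ γ δ : List Bool, ∀ᶠ x in 𝓝 p, ∃ ψ, x = cat γ ψ ∧ s x = cat δ ψ := by
  rcases cone_cases α β p with ⟨ψ, rfl⟩ | ⟨ψ, rfl⟩ | ⟨h1, h2⟩
  · refine ⟨α, β, ?_⟩
    filter_upwards [eventually_cat α ψ] with x ⟨χ, hx⟩
    exact ⟨χ, hx, by rw [hx, hs.left]⟩
  · refine ⟨β, α, ?_⟩
    filter_upwards [eventually_cat β ψ] with x ⟨χ, hx⟩
    exact ⟨χ, hx, by rw [hx, hs.right]⟩
  · refine ⟨[], [], ?_⟩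
    filter_upwards [eventually_notMem_cone h1, eventually_notMem_cone h2] with x h3 h4
    exact ⟨x, rfl, hs.off x h3 h4⟩

theorem isVA_of_mem_thompsonV {f : Cantor ≃ₜ Cantor} (hf : f ∈ thompsonV) : f ∈ VA := by
  constructor <;> simp [sing_of_mem hf]

theorem exists_swap {α β : List Bool} (h : Incomp α β) :
    ∃ s : VA, IsSwap α β s.1 ∧ s.1 ∈ thompsonV := by
  classical
  let s : Cantor → Cantor := fun p => if h : ∃ ψ, p = cat α ψ then cat β h.choose else
    if h : ∃ ψ, p = cat β ψ then cat α h.choose else p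
  have hs : IsSwap α β s := by
    refine ⟨fun ψ => ?_, fun ψ => ?_, fun p h1 h2 => ?_⟩
    · have hex : ∃ χ, cat α ψ = cat α χ := ⟨ψ, rfl⟩
      refine (dif_pos hex).trans ?_
      rw [← cat_inj.mp hex.choose_spec]
    · have hex : ∃ χ, cat β ψ = cat β χ := ⟨ψ, rfl⟩
      refine (dif_neg fun ⟨χ, hχ⟩ => h χ ψ hχ.symm).trans ((dif_pos hex).trans ?_)
      rw [← cat_inj.mp hex.choose_spec]
    · exact (dif_neg fun ⟨χ, hχ⟩ => h1 χ hχ).trans (dif_neg fun ⟨χ, hχ⟩ => h2 χ hχ)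
  have hinv : ∀ p, s (s p) = p := by
    intro p
    rcases cone_cases α β p with ⟨ψ, rfl⟩ | ⟨ψ, rfl⟩ | ⟨h1, h2⟩
    · rw [hs.left, hs.right]
    · rw [hs.right, hs.left]
    · rw [hs.off p h1 h2, hs.off p h1 h2]
  have hcont : Continuous s := continuous_iff_continuousAt.mpr fun p => by
    obtain ⟨γ, δ, h⟩ := hs.prefixReplacement p
    exact continuousAt_of_prefix h
  let S : Cantor ≃ₜ Cantor :=
    { toFun := s, invFun := s, left_inv := hinv, right_inv := hinv,
      continuous_toFun := hcont, continuous_invFun := hcont }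
  have hS : S ∈ thompsonV := hs.prefixReplacement
  exact ⟨⟨S, isVA_of_mem_thompsonV hS⟩, hs, hS⟩

open Classical in
/-- The element of `VA` that interchanges the cones of `α` and `β`. -/
noncomputable def swap (α β : List Bool) : VA :=
  if h : Incomp α β then (exists_swap h).choose else 1

theorem swap_spec {α β : List Bool} (h : Incomp α β) :
    IsSwap α β (swap α β).1 ∧ (swap α β).1 ∈ thompsonV := by
  rw [swap, dif_pos h]
  exact (exists_swap h).choose_spec

theorem isSwap_swap {α β : List Bool} (h : Incomp α β) : IsSwap α β (swap α β).1 := (swap_spec h).1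

theorem eq_swap {α β : List Bool} (h : Incomp α β) {s : VA} (hs : IsSwap α β s.1) :
    s = swap α β :=
  Subtype.ext (Homeomorph.ext fun p => congrFun (hs.unique (isSwap_swap h)) p)

theorem swap_comm {α β : List Bool} (h : Incomp α β) : swap α β = swap β α :=
  eq_swap h.symm (isSwap_swap h).symm

theorem swap_conj {α β α' β' : List Bool} (h : Incomp α β) (h' : Incomp α' β') {v : VA}
    (h1 : ∀ ψ, v.1 (cat α ψ) = cat α' ψ) (h2 : ∀ ψ, v.1 (cat β ψ) = cat β' ψ) :
    v * swap α β * v⁻¹ = swap α' β' := by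
  have hs := isSwap_swap h
  have hval : ∀ p, (v * swap α β * v⁻¹).1 (v.1 p) = v.1 ((swap α β).1 p) := fun p =>
    congrArg (fun q => v.1 ((swap α β).1 q)) (v.1.symm_apply_apply p)
  refine eq_swap h' ⟨fun ψ => ?_, fun ψ => ?_, fun p h3 h4 => ?_⟩
  · rw [← h1, hval, hs.left, h2]
  · rw [← h2, hval, hs.right, h1]
  · obtain ⟨q, rfl⟩ := v.1.surjective p
    rw [hval, hs.off]
    · rintro ψ rfl
      exact h3 ψ (h1 ψ)
    · rintro ψ rfl
      exact h4 ψ (h2 ψ)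

/-- This relation lengthens the words of a swap at will and forces the class of a swap modulo `N` to
be idempotent. -/
theorem swap_split {α β : List Bool} (h : Incomp α β) :
    swap α β = swap (α ++ [false]) (β ++ [false]) * swap (α ++ [true]) (β ++ [true]) := by
  have hs : ∀ c, IsSwap _ _ (swap (α ++ [c]) (β ++ [c])).1 := fun c => isSwap_swap (h.append _ _)
  have hne : false ≠ true := by simp
  symm
  refine eq_swap h ⟨fun ψ => ?_, fun ψ => ?_, fun p h3 h4 => ?_⟩
  · change (swap _ _).1 ((swap _ _).1 _) = _
    obtain ⟨b, χ, rfl⟩ := exists_eq_cat_singleton ψ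
    rw [← cat_append, ← cat_append]
    cases b
    · rw [(hs true).fixes (incomp_append hne.symm) (h.symm.append _ _), (hs false).left]
    · rw [(hs true).left, (hs false).fixes (h.append _ _) (incomp_append hne)]
  · change (swap _ _).1 ((swap _ _).1 _) = _
    obtain ⟨b, χ, rfl⟩ := exists_eq_cat_singleton ψ
    rw [← cat_append, ← cat_append]
    cases b
    · rw [(hs true).fixes (h.append _ _) (incomp_append hne.symm), (hs false).right]
    · rw [(hs true).right, (hs false).fixes (incomp_append hne) (h.symm.append _ _)]
  · change (swap _ _).1 ((swap _ _).1 _) = _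
    have hoff : ∀ c, (swap (α ++ [c]) (β ++ [c])).1 p = p := fun c =>
      (hs c).off p (fun ψ => by rw [cat_append]; exact h3 _) fun ψ => by rw [cat_append]; exact h4 _
    rw [hoff, hoff]

/-! ### Swaps in a normal subgroup -/

/-- There are four words of length two, so two remain after excluding `x` and `y`. -/
theorem exists_two_words (x y : List Bool) : ∃ i j : List Bool, i.length = 2 ∧ j.length = 2 ∧
    i ≠ j ∧ i ≠ x ∧ i ≠ y ∧ j ≠ x ∧ j ≠ y := by
  let W : Finset (List Bool) := {[false, false], [false, true], [true, false], [true, true]}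
  have hW : W.card = 4 := by decide
  have hl : ∀ w ∈ W, w.length = 2 := by decide
  have h1 := Finset.pred_card_le_card_erase (s := W) (a := x)
  have h2 := Finset.pred_card_le_card_erase (s := W.erase x) (a := y)
  obtain ⟨i, hi, j, hj, hij⟩ := Finset.one_lt_card.mp
    (show 1 < ((W.erase x).erase y).card by omega)
  simp only [Finset.mem_erase] at hi hj
  exact ⟨i, j, hl i hi.2.2, hl j hj.2.2, hij, hi.2.1, hi.1, hj.2.1, hj.1⟩

section Normal

variable {N : Subgroup VA} [hN : N.Normal] {γ : List Bool}

/-- The two swaps are conjugate by the swap of `γ ++ α` and `γ ++ δ`, and all of this happens inside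
the cone of `γ`, where commutators lie in `N`. -/
theorem mk_swap_eq
    (hcomm : ∀ f g : VA, (∀ p ∉ Set.range (cat γ), f.1 p = p) →
      (∀ p ∉ Set.range (cat γ), g.1 p = p) → f * g * f⁻¹ * g⁻¹ ∈ N)
    {α β δ : List Bool} (h1 : Incomp (γ ++ α) (γ ++ β)) (h2 : Incomp (γ ++ α) (γ ++ δ))
    (h3 : Incomp (γ ++ δ) (γ ++ β)) :
    (swap (γ ++ α) (γ ++ β) : VA ⧸ N) = swap (γ ++ δ) (γ ++ β) := by
  have hsupp : ∀ {α β : List Bool}, Incomp (γ ++ α) (γ ++ β) → ∀ p ∉ Set.range (cat γ),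
      (swap (γ ++ α) (γ ++ β)).1 p = p := by
    intro α β h p hp
    refine (isSwap_swap h).off p ?_ ?_ <;>
    · rintro ψ rfl
      exact hp ⟨_, (cat_append _ _ _).symm⟩
  have h4 := hcomm _ _ (hsupp h2) (hsupp h1)
  rw [swap_conj h1 h3 (isSwap_swap h2).left ((isSwap_swap h2).fixes h1 h3)] at h4
  rw [← QuotientGroup.eq_one_iff, QuotientGroup.mk_mul, QuotientGroup.mk_inv,
    mul_inv_eq_one] at h4
  exact h4.symm

theorem swap_mem_of_length_two
    (hcomm : ∀ f g : VA, (∀ p ∉ Set.range (cat γ), f.1 p = p) →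
      (∀ p ∉ Set.range (cat γ), g.1 p = p) → f * g * f⁻¹ * g⁻¹ ∈ N)
    {i j : List Bool} (hi : i.length = 2) (hj : j.length = 2) (hij : i ≠ j) :
    swap (γ ++ i) (γ ++ j) ∈ N := by
  obtain ⟨k, l, hk, hl, hkl, hki, hkj, hli, hlj⟩ := exists_two_words i j
  have hinc : ∀ {i j : List Bool}, i.length = 2 → j.length = 2 → i ≠ j →
      ∀ δ ε, Incomp (γ ++ (i ++ δ)) (γ ++ (j ++ ε)) := by
    intro i j hi hj hij δ ε
    rw [← List.append_assoc, ← List.append_assoc]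
    exact Incomp.append (incomp_of_length_eq (by simp [hi, hj]) (by simpa using hij)) _ _
  -- Replacing one cone at a time through the two spare words shows that the class does not depend
  -- on `δ`. Then `swap_split` reads `e = e * e`.
  have key : ∀ δ, (swap (γ ++ (i ++ δ)) (γ ++ (j ++ δ)) : VA ⧸ N) =
      swap (γ ++ (l ++ [])) (γ ++ (k ++ [])) := by
    intro δ
    rw [mk_swap_eq hcomm (hinc hi hj hij δ δ) (hinc hi hk hki.symm δ []) (hinc hk hj hkj [] δ),
      swap_comm (hinc hk hj hkj [] δ),
      mk_swap_eq hcomm (hinc hj hk hkj.symm δ []) (hinc hj hl hlj.symm δ [])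
        (hinc hl hk hkl.symm [] [])]
  have h0 := key []
  have h1 := swap_split (hinc hi hj hij [] [])
  simp only [List.append_nil] at h0 h1
  have h2 : (swap (γ ++ i) (γ ++ j) : VA ⧸ N) =
      swap (γ ++ i) (γ ++ j) * swap (γ ++ i) (γ ++ j) := by
    conv_lhs => rw [h1]
    rw [QuotientGroup.mk_mul, List.append_assoc, List.append_assoc, List.append_assoc,
      List.append_assoc, key, key, h0]
    simp only [List.append_nil]
  rw [← QuotientGroup.eq_one_iff]
  exact (left_eq_mul.mp h2)

/-- Two spare cones `γ ++ i` and `γ ++ j` are disjoint from those of `α` and `β`. Two swaps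
conjugate the given swap to that of the spare cones, so no further commutators are needed. -/
theorem swap_mem_of_length_le
    (hcomm : ∀ f g : VA, (∀ p ∉ Set.range (cat γ), f.1 p = p) →
      (∀ p ∉ Set.range (cat γ), g.1 p = p) → f * g * f⁻¹ * g⁻¹ ∈ N)
    {α β : List Bool} (h : Incomp α β) (hα : γ.length + 2 ≤ α.length)
    (hβ : γ.length + 2 ≤ β.length) : swap α β ∈ N := by
  obtain ⟨i, j, hi, hj, hij, hiα, hiβ, hjα, hjβ⟩ :=
    exists_two_words ((α.drop γ.length).take 2) ((β.drop γ.length).take 2)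
  have hinc : ∀ {i α : List Bool}, i.length = 2 → γ.length + 2 ≤ α.length →
      i ≠ (α.drop γ.length).take 2 → Incomp (γ ++ i) α := by
    intro i α hi hα hne
    refine incomp_of_not_prefix (by simp [hi, hα]) ?_
    rintro ε rfl
    apply hne
    rw [List.append_assoc, List.drop_left, ← hi, List.take_left]
  have h1 := hinc hi hα hiα
  have h2 := hinc hi hβ hiβ
  have h3 := hinc hj hβ hjβ
  have hij' : Incomp (γ ++ i) (γ ++ j) :=
    incomp_of_length_eq (by simp [hi, hj]) (by simpa using hij)
  have h4 := swap_mem_of_length_two hcomm hi hj hij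
  have s1 := isSwap_swap h1
  have s3 := isSwap_swap h3
  rw [← swap_conj h2 hij' (s3.fixes hij'.symm h2.symm) s3.right, ← swap_conj h h2 s1.right
    (s1.fixes h2 h)] at h4
  have h5 := hN.conj_mem _ h4 (swap (γ ++ j) β)⁻¹
  have h6 := hN.conj_mem _ h5 (swap (γ ++ i) α)⁻¹
  simpa [mul_assoc] using h6

/-- Short words are lengthened by repeated halving. -/
theorem swap_mem
    (hcomm : ∀ f g : VA, (∀ p ∉ Set.range (cat γ), f.1 p = p) →
      (∀ p ∉ Set.range (cat γ), g.1 p = p) → f * g * f⁻¹ * g⁻¹ ∈ N)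
    {α β : List Bool} (h : Incomp α β) : swap α β ∈ N := by
  have key : ∀ (n : ℕ) {α β : List Bool}, Incomp α β → γ.length + 2 ≤ α.length + n →
      γ.length + 2 ≤ β.length + n → swap α β ∈ N := by
    intro n
    induction n with
    | zero => exact fun h h1 h2 => swap_mem_of_length_le hcomm h h1 h2
    | succ n ih =>
      intro α β h h1 h2
      rw [swap_split h]
      refine N.mul_mem ?_ ?_ <;>
      exact ih (h.append _ _) (by simp; omega) (by simp; omega)
  exact key (γ.length + 2) h (by omega) (by omega)

end Normal

end FiniteGerm

namespace FiniteGerm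

/-! ### Thompson's group `V` is generated by swaps -/

/-- The cones of the words in `A` partition the Cantor set. -/
structure IsCode (A : Finset (List Bool)) : Prop where
  incomp : ∀ a ∈ A, ∀ b ∈ A, a ≠ b → Incomp a b
  cover : ∀ p, ∃ a ∈ A, ∃ ψ, p = cat a ψ

theorem exists_eq_cat_of_length (n : ℕ) (p : Cantor) :
    ∃ (w : List Bool) (ψ : Cantor), w.length = n ∧ p = cat w ψ := by
  induction n generalizing p with
  | zero => exact ⟨[], p, rfl, rfl⟩
  | succ n ih =>
    obtain ⟨b, y, rfl⟩ := exists_eq_cat_singleton p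
    obtain ⟨w, ψ, hw, rfl⟩ := ih y
    exact ⟨b :: w, ψ, by simp [hw], rfl⟩

theorem exists_code_length (n : ℕ) : ∃ A, IsCode A ∧ ∀ a ∈ A, a.length = n := by
  classical
  let A : Finset (List Bool) := Finset.univ.image fun w : List.Vector Bool n => w.1
  have hA : ∀ a, a ∈ A ↔ a.length = n := by
    intro a
    simp only [A, Finset.mem_image, Finset.mem_univ, true_and]
    exact ⟨fun ⟨w, hw⟩ => hw ▸ w.2, fun h => ⟨⟨a, h⟩, rfl⟩⟩
  refine ⟨A, ⟨fun a ha b hb hab => ?_, fun p => ?_⟩, fun a ha => (hA a).mp ha⟩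
  · exact incomp_of_length_eq (((hA a).mp ha).trans ((hA b).mp hb).symm) hab
  · obtain ⟨w, ψ, hw, hp⟩ := exists_eq_cat_of_length n p
    exact ⟨w, (hA w).mpr hw, ψ, hp⟩

theorem IsCode.eq {A : Finset (List Bool)} (hA : IsCode A) {a b : List Bool} (ha : a ∈ A)
    (hb : b ∈ A) {ψ χ : Cantor} (h : cat a ψ = cat b χ) : a = b := by
  by_contra hne
  exact hA.incomp a ha b hb hne ψ χ h

/-- The sibling of a longest word must itself be a code word: a shorter code word covering its cone
would also cover the longest word. -/
theorem IsCode.exists_siblings {A : Finset (List Bool)} (hA : IsCode A) (h : [] ∉ A) :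
    ∃ v, v ++ [false] ∈ A ∧ v ++ [true] ∈ A := by
  obtain ⟨a₀, ha₀, -⟩ := hA.cover (const false)
  obtain ⟨w, hw, hmax⟩ := A.exists_max_image List.length ⟨a₀, ha₀⟩
  obtain ⟨v, c, rfl⟩ : ∃ v c, w = v ++ [c] := by
    rcases List.eq_nil_or_concat' w with rfl | ⟨v, c, rfl⟩
    · exact absurd hw h
    · exact ⟨v, c, rfl⟩
  have hs : v ++ [!c] ∈ A := by
    obtain ⟨a, ha, ψ, hψ⟩ := hA.cover (cat (v ++ [!c]) (const false))
    have hl : a.length ≤ (v ++ [!c]).length := (hmax a ha).trans (by simp)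
    obtain ⟨ε, hε⟩ := exists_append hψ.symm hl
    rcases List.eq_nil_or_concat' ε with rfl | ⟨δ, d, rfl⟩
    · rw [hε, List.append_nil]; exact ha
    · exfalso
      rw [← List.append_assoc] at hε
      obtain ⟨rfl, -⟩ := List.append_inj' hε rfl
      have := hA.eq ha hw (ψ := cat (δ ++ [c]) (const false)) (χ := const false)
        (by rw [← cat_append, List.append_assoc])
      have := congrArg List.length this
      simp at this
  refine ⟨v, ?_⟩
  cases c
  · exact ⟨hw, hs⟩
  · exact ⟨hs, hw⟩

theorem IsCode.merge {A : Finset (List Bool)} (hA : IsCode A) {v : List Bool}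
    (h0 : v ++ [false] ∈ A) (h1 : v ++ [true] ∈ A) :
    IsCode (insert v ((A.erase (v ++ [false])).erase (v ++ [true]))) := by
  have key : ∀ b ∈ (A.erase (v ++ [false])).erase (v ++ [true]), Incomp v b := by
    intro b hb ψ χ he
    simp only [Finset.mem_erase] at hb
    obtain ⟨c, y, rfl⟩ := exists_eq_cat_singleton ψ
    rw [← cat_append] at he
    cases c
    · exact hA.incomp _ h0 b hb.2.2 hb.2.1.symm _ _ he
    · exact hA.incomp _ h1 b hb.2.2 hb.1.symm _ _ he
  constructor
  · intro a ha b hb hab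
    rw [Finset.mem_insert] at ha hb
    rcases ha with rfl | ha <;> rcases hb with rfl | hb
    · exact absurd rfl hab
    · exact key b hb
    · exact (key a ha).symm
    · simp only [Finset.mem_erase] at ha hb
      exact hA.incomp a ha.2.2 b hb.2.2 hab
  · intro p
    obtain ⟨a, ha, ψ, rfl⟩ := hA.cover p
    by_cases ha0 : a = v ++ [false]
    · exact ⟨v, Finset.mem_insert_self _ _, _, by rw [ha0, cat_append]⟩
    by_cases ha1 : a = v ++ [true]
    · exact ⟨v, Finset.mem_insert_self _ _, _, by rw [ha1, cat_append]⟩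
    exact ⟨a, by simp [ha, ha0, ha1], ψ, rfl⟩

theorem card_merge {A : Finset (List Bool)} {v : List Bool}
    (h0 : v ++ [false] ∈ A) (h1 : v ++ [true] ∈ A) :
    (insert v ((A.erase (v ++ [false])).erase (v ++ [true]))).card < A.card := by
  have h2 : v ++ [true] ∈ A.erase (v ++ [false]) := by simp [h1]
  have h3 := Finset.card_insert_le v ((A.erase (v ++ [false])).erase (v ++ [true]))
  rw [Finset.card_erase_of_mem h2, Finset.card_erase_of_mem h0] at h3
  have h4 : 1 < A.card := Finset.one_lt_card.mpr ⟨_, h0, _, h1, by simp⟩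
  omega

theorem IsCode.image {A : Finset (List Bool)} (hA : IsCode A) {f : Cantor ≃ₜ Cantor}
    {β : List Bool → List Bool} (h : ∀ a ∈ A, ∀ ψ, f (cat a ψ) = cat (β a) ψ) :
    IsCode (A.image β) := by
  constructor
  · intro a ha b hb hab ψ χ he
    obtain ⟨a', ha', rfl⟩ := Finset.mem_image.mp ha
    obtain ⟨b', hb', rfl⟩ := Finset.mem_image.mp hb
    rw [← h _ ha', ← h _ hb'] at he
    exact hab (congrArg β (hA.eq ha' hb' (f.injective he)))
  · intro p
    obtain ⟨q, rfl⟩ := f.surjective p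
    obtain ⟨a, ha, ψ, rfl⟩ := hA.cover q
    exact ⟨β a, Finset.mem_image_of_mem _ ha, ψ, h a ha ψ⟩

theorem eq_one_of_cat {f : Cantor ≃ₜ Cantor} {β : List Bool} (h : ∀ ψ, f ψ = cat β ψ) : f = 1 := by
  cases β with
  | nil => exact Homeomorph.ext h
  | cons b β =>
    obtain ⟨q, hq⟩ := f.surjective (const !b)
    rw [h, const_eq, cat_cons_inj] at hq
    simp at hq

section Generation

variable {N : Subgroup VA}

theorem IsCode.exists_transposition (hN : ∀ {α β}, Incomp α β → swap α β ∈ N)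
    {A : Finset (List Bool)} (hA : IsCode A)
    {x y : List Bool} (hx : x ∈ A) (hy : y ∈ A) : ∃ s ∈ N, (∀ ψ, s.1 (cat x ψ) = cat y ψ) ∧
      (∀ ψ, s.1 (cat y ψ) = cat x ψ) ∧ ∀ c ∈ A, c ≠ x → c ≠ y → ∀ ψ, s.1 (cat c ψ) = cat c ψ := by
  by_cases hxy : x = y
  · subst hxy
    exact ⟨1, N.one_mem, fun _ => rfl, fun _ => rfl, fun _ _ _ _ _ => rfl⟩
  · have h := hA.incomp x hx y hy hxy
    exact ⟨swap x y, hN h, (isSwap_swap h).left, (isSwap_swap h).right, fun c hc hcx hcy =>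
      (isSwap_swap h).fixes (hA.incomp x hx c hc hcx.symm) (hA.incomp y hy c hc hcy.symm)⟩

/-- Induction on the size of the code. Composing with transpositions of code words makes a pair of
siblings go to a pair of siblings; then the pair can be merged and a smaller code describes the same
map. -/
theorem mem_of_code (hN : ∀ {α β}, Incomp α β → swap α β ∈ N) {A : Finset (List Bool)} (hA : IsCode A)
    {f : VA} (hf : ∀ a ∈ A, ∃ b, ∀ ψ, f.1 (cat a ψ) = cat b ψ) : f ∈ N := by
  induction hn : A.card using Nat.strong_induction_on generalizing A f with
  | _ n ih =>
  by_cases hnil : [] ∈ A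
  · obtain ⟨b, hb⟩ := hf [] hnil
    have : f = 1 := Subtype.ext (eq_one_of_cat hb)
    rw [this]
    exact N.one_mem
  obtain ⟨v, hv0, hv1⟩ := hA.exists_siblings hnil
  obtain ⟨u, hu0, hu1⟩ : ∃ u, (∃ a ∈ A, ∀ ψ, f.1 (cat a ψ) = cat (u ++ [false]) ψ) ∧
      ∃ a ∈ A, ∀ ψ, f.1 (cat a ψ) = cat (u ++ [true]) ψ := by
    have hf' : ∀ a, ∃ b, a ∈ A → ∀ ψ, f.1 (cat a ψ) = cat b ψ := by
      intro a
      by_cases ha : a ∈ A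
      · obtain ⟨b, hb⟩ := hf a ha
        exact ⟨b, fun _ => hb⟩
      · exact ⟨[], fun h => absurd h ha⟩
    choose β hβ using hf'
    have hB := hA.image hβ
    -- If the image code were trivial, the inverse of `f` would be a global prefix replacement,
    -- hence the identity, and the original code would be trivial as well.
    have hnilB : [] ∉ A.image β := by
      intro h
      obtain ⟨a, ha, ha'⟩ := Finset.mem_image.mp h
      have h1 := hβ a ha
      rw [ha'] at h1
      have h2 : f.1⁻¹ = 1 := eq_one_of_cat (β := a) fun ψ => by
        have := h1 ψ
        rw [cat_nil] at this
        conv_lhs => rw [← this]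
        exact f.1.symm_apply_apply _
      have h3 : ∀ ψ, cat a ψ = ψ := fun ψ => by
        have := h1 ψ
        rw [inv_eq_one.mp h2] at this
        exact this
      apply hnil
      convert ha
      cases a with
      | nil => rfl
      | cons b a =>
        have := congrFun (h3 (const !b)) 0
        exact absurd this (by simp [cat, const])
    obtain ⟨u, h0, h1⟩ := hB.exists_siblings hnilB
    obtain ⟨a0, ha0, h0⟩ := Finset.mem_image.mp h0
    obtain ⟨a1, ha1, h1⟩ := Finset.mem_image.mp h1
    exact ⟨u, ⟨a0, ha0, h0 ▸ hβ a0 ha0⟩, ⟨a1, ha1, h1 ▸ hβ a1 ha1⟩⟩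
  have reduce : ∀ {f : VA} {x y : List Bool}, x ∈ A → y ∈ A →
      (∀ a ∈ A, ∃ b, ∀ ψ, f.1 (cat a ψ) = cat b ψ) → ∃ s ∈ N,
      (∀ a ∈ A, ∃ b, ∀ ψ, (f * s).1 (cat a ψ) = cat b ψ) ∧
      (∀ ψ, (f * s).1 (cat x ψ) = f.1 (cat y ψ)) ∧ (∀ ψ, (f * s).1 (cat y ψ) = f.1 (cat x ψ)) ∧
      ∀ c ∈ A, c ≠ x → c ≠ y → ∀ ψ, (f * s).1 (cat c ψ) = f.1 (cat c ψ) := by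
    intro f x y hx hy hf
    obtain ⟨s, hs, h1, h2, h3⟩ := hA.exists_transposition hN hx hy
    have e1 : ∀ ψ, (f * s).1 (cat x ψ) = f.1 (cat y ψ) := fun ψ => congrArg f.1 (h1 ψ)
    have e2 : ∀ ψ, (f * s).1 (cat y ψ) = f.1 (cat x ψ) := fun ψ => congrArg f.1 (h2 ψ)
    have e3 : ∀ c ∈ A, c ≠ x → c ≠ y → ∀ ψ, (f * s).1 (cat c ψ) = f.1 (cat c ψ) :=
      fun c hc hcx hcy ψ => congrArg f.1 (h3 c hc hcx hcy ψ)
    refine ⟨s, hs, fun a ha => ?_, e1, e2, e3⟩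
    by_cases hax : a = x
    · obtain ⟨b, hb⟩ := hf y hy
      exact ⟨b, fun ψ => by rw [hax, e1, hb]⟩
    by_cases hay : a = y
    · obtain ⟨b, hb⟩ := hf x hx
      exact ⟨b, fun ψ => by rw [hay, e2, hb]⟩
    obtain ⟨b, hb⟩ := hf a ha
    exact ⟨b, fun ψ => by rw [e3 a ha hax hay, hb]⟩
  obtain ⟨a0, ha0, hu0⟩ := hu0
  obtain ⟨a1, ha1, hu1⟩ := hu1
  have hvv : v ++ [false] ≠ v ++ [true] := by simp
  have huu : ∀ ψ, cat (u ++ [false]) ψ ≠ cat (u ++ [true]) ψ :=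
    fun ψ => incomp_append (by simp) ψ ψ
  have haa : a1 ≠ a0 := by
    rintro rfl
    exact huu (const false) ((hu0 _).symm.trans (hu1 _))
  -- After the first transposition `v ++ [false]` goes to `u ++ [false]`; the second treats `v ++
  -- [true]` without disturbing this.
  obtain ⟨s, hs, hlin, e1, e2, e3⟩ := reduce hv0 ha0 hf
  have h0 : ∀ ψ, (f * s).1 (cat (v ++ [false]) ψ) = cat (u ++ [false]) ψ := fun ψ => by
    rw [e1, hu0]
  obtain ⟨a2, ha2, h2⟩ : ∃ a ∈ A, ∀ ψ, (f * s).1 (cat a ψ) = cat (u ++ [true]) ψ := by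
    by_cases h : a1 = v ++ [false]
    · exact ⟨a0, ha0, fun ψ => by rw [e2, ← h, hu1]⟩
    · exact ⟨a1, ha1, fun ψ => by rw [e3 a1 ha1 h haa, hu1]⟩
  have h20 : v ++ [false] ≠ a2 := by
    rintro rfl
    exact huu (const false) ((h0 _).symm.trans (h2 _))
  obtain ⟨t, ht, hlin', e1', -, e3'⟩ := reduce hv1 ha2 hlin
  have hmem : f * s * t ∈ N := by
    refine ih _ (hn ▸ card_merge hv0 hv1) (hA.merge hv0 hv1) (fun a ha => ?_) rfl
    rcases Finset.mem_insert.mp ha with rfl | ha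
    · refine ⟨u, fun ψ => ?_⟩
      obtain ⟨c, y, rfl⟩ := exists_eq_cat_singleton ψ
      rw [← cat_append, ← cat_append]
      cases c
      · rw [e3' _ hv0 hvv h20, h0]
      · rw [e1', h2]
    · exact hlin' a (Finset.mem_of_mem_erase (Finset.mem_of_mem_erase ha))
  exact (N.mul_mem_cancel_right hs).mp ((N.mul_mem_cancel_right ht).mp hmem)

theorem mem_of_mem_thompsonV (hN : ∀ {α β}, Incomp α β → swap α β ∈ N) {f : VA} (hf : f.1 ∈ thompsonV) : f ∈ N := by
  obtain ⟨n, hn⟩ := exists_uniform_depth isCompact_univ fun p _ => hf p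
  obtain ⟨A, hA, hlen⟩ := exists_code_length n
  exact mem_of_code hN hA fun a ha => hn a (hlen a ha).ge ⟨const false, Set.mem_univ _⟩

end Generation

end FiniteGerm

namespace FiniteGerm

/-! ### Elements of `VA` with a single singular point -/

/-- A local prefix replacement is the restriction of a product of two swaps through an auxiliary
cone, hence of an element of `V`. -/
theorem notMem_sing_of_prefixReplacementAt {f : Cantor ≃ₜ Cantor} {p : Cantor}
    (h : PrefixReplacementAt f p) : p ∉ sing thompsonV f := by
  obtain ⟨α, β, h⟩ := h
  obtain ⟨ψ, rfl, -⟩ := h.self_of_nhds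
  -- Lengthening both words by two letters leaves room for an auxiliary cone disjoint from both,
  -- even if a word was empty.
  obtain ⟨ε, χ, hε, rfl⟩ := exists_eq_cat_of_length 2 ψ
  obtain ⟨i, -, hi, -, -, hiα, hiβ, -, -⟩ := exists_two_words ((α ++ ε).take 2) ((β ++ ε).take 2)
  have hinc : ∀ {α : List Bool}, 2 ≤ α.length → i ≠ α.take 2 → Incomp i α := by
    intro α hl hne
    refine incomp_of_not_prefix (by omega) ?_
    rintro δ rfl
    exact hne (by rw [← hi, List.take_left])
  have h1 := hinc (by simp [hε]) hiα
  have h2 := hinc (by simp [hε]) hiβ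
  refine notMem_sing.mpr ⟨(swap i (β ++ ε)).1 * (swap i (α ++ ε)).1,
    thompsonV.mul_mem (swap_spec h2).2 (swap_spec h1).2, ?_⟩
  rw [← cat_append] at h ⊢
  filter_upwards [h, eventually_cat (α ++ ε) χ] with x ⟨ξ, h3, h4⟩ ⟨ζ, h5⟩
  change _ = (swap i (β ++ ε)).1 ((swap i (α ++ ε)).1 x)
  rw [h5, (isSwap_swap h1).right, (isSwap_swap h2).left, ← h5, h4, cat_append]
  rw [h5, cat_append, cat_inj] at h3
  rw [h3]

theorem Line.IsChange.inv {Y : Type*} [LinearOrder Y] [OrderBot Y] [Halving Y]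
    {φ : Equiv.Perm (ℤ × Y)} (h : Line.IsChange φ) : Line.IsChange φ⁻¹ := by
  obtain ⟨m, c, c', hc, hc', rfl⟩ := h
  exact ⟨m, c', c, hc', hc, by simp⟩

theorem bot_le_cantor (x : Cantor) : toLex (const false) ≤ toLex x :=
  bot_le (a := toLex x)

theorem eventually_lex_lt {p b : Cantor} (h : toLex p < toLex b) :
    ∀ᶠ q in 𝓝 p, toLex q < toLex b := by
  obtain ⟨i, h1, h2⟩ := h
  filter_upwards [eventually_agree p (i + 1)] with q hq
  refine ⟨i, fun j hj => (hq j (by omega)).trans (h1 j hj), ?_⟩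
  have := hq i (by omega)
  change q i < b i
  rw [this]
  exact h2

theorem eventually_lt_lex {p b : Cantor} (h : toLex b < toLex p) :
    ∀ᶠ q in 𝓝 p, toLex b < toLex q := by
  obtain ⟨i, h1, h2⟩ := h
  filter_upwards [eventually_agree p (i + 1)] with q hq
  refine ⟨i, fun j hj => (h1 j hj).trans (hq j (by omega)).symm, ?_⟩
  have := hq i (by omega)
  change b i < q i
  rw [this]
  exact h2

/-- Upper sets starting at a point `β000⋯` are open. So cutting off a map at such a point creates no
discontinuity. -/
theorem eventually_le_lex {p : Cantor} {β : List Bool}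
    (h : toLex (cat β (const false)) ≤ toLex p) :
    ∀ᶠ q in 𝓝 p, toLex (cat β (const false)) ≤ toLex q := by
  rcases h.eq_or_lt with h | h
  · have : p = cat β (const false) := toLex.injective h.symm
    rw [this]
    filter_upwards [eventually_cat β (const false)] with q ⟨χ, hq⟩
    rw [hq]
    exact not_lt.mp fun hlt => (bot_le_cantor χ).not_gt (toLex_cat_lt.mp hlt)
  · filter_upwards [eventually_lt_lex h] with q hq using hq.le

/-- Since the scaling germ does not depend on the chosen prefix, both prefixes may be taken empty at
`000⋯`. -/
theorem eventually_shift_iff {f : Cantor ≃ₜ Cantor} (h0 : f (const false) = const false) :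
    CommutesWithShift f (const false) ↔
      ∀ᶠ x in 𝓝 (const false), ∃ ψ, x = cat [false] ψ ∧ f x = cat [false] (f ψ) := by
  constructor
  · rintro ⟨α, β, c, d, h1, h2, h3⟩
    have hev : ∀ᶠ x in 𝓝 (const false), ∃ ψ, x = cat [false] ψ := by
      rw [const_eq]
      exact eventually_cat _ _
    have hev' := tendsto_homeo f (const false)
    rw [h0] at hev' h2
    filter_upwards [h3, hev, hev'.eventually hev] with x ⟨ψ, χ, h4, h5, h6⟩ ⟨ψ', h7⟩ ⟨χ', h8⟩
    have e1 := shift_unique (β := []) (d := false) h1.symm (h4.symm.trans h7)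
    have e2 := shift_unique (β := []) (d := false) h2.symm (h5.symm.trans h8)
    rw [cat_nil] at e1 e2
    rw [e1, e2] at h6
    exact ⟨ψ', h7, by rw [h8, h6]⟩
  · intro h
    refine ⟨[], [], false, false, rfl, h0, ?_⟩
    filter_upwards [h] with x ⟨ψ, h1, h2⟩
    exact ⟨ψ, f ψ, h1, h2, rfl⟩

theorem shift_apply_sub {φ : Equiv.Perm (ℤ × Lex Cantor)}
    (h : Commute φ (Line.shift (Lex Cantor))) (z : ℤ × Lex Cantor) :
    φ (z.1 - 1, z.2) = ((φ z).1 - 1, (φ z).2) := by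
  have := congrArg (fun g => g z) (h.zpow_right (-1)).eq
  simpa only [Equiv.Perm.mul_apply, Line.shift_zpow_apply, ← sub_eq_add_neg] using this

/-- Monotonicity of `φ` is the order condition, and commuting with the shift is the scaling
condition, both read through `zeroCoord`. -/
theorem Line.HasGerm.isVA_zero {f : Cantor ≃ₜ Cantor} {φ : Equiv.Perm (ℤ × Lex Cantor)}
    (hm : Line.Mono φ) (hS : Commute φ (Line.shift _)) (h : Line.HasGerm zeroCoord f φ)
    (h0 : f (const false) = const false) :
    OrderPreservingAt f (const false) ∧ CommutesWithShift f (const false) := by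
  obtain ⟨K, hK⟩ := h
  constructor
  · refine ⟨_, eventually_zero_iff (P := fun x => x = const false ∨
      ∃ z : ℤ × Lex Cantor, z.1 ≤ min K 0 ∧ x = zeroCoord z).mpr
      ⟨Or.inl rfl, min K 0, fun z hz => Or.inr ⟨z, hz, rfl⟩⟩, ?_⟩
    have hne : ∀ x, x ≠ const false → toLex (const false) < toLex (f x) := fun x hx =>
      lt_of_le_of_ne (bot_le_cantor _) fun he => hx (f.injective
        ((toLex.injective he).symm.trans h0.symm))
    rintro x (rfl | ⟨z, hz, rfl⟩) y (rfl | ⟨w, hw, rfl⟩) hxy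
    · exact absurd hxy (lt_irrefl _)
    · rw [h0]
      exact hne _ (zeroCoord_ne w)
    · exact absurd hxy (bot_le_cantor _).not_gt
    · have hz' := hK z (hz.trans (min_le_left _ _))
      have hw' := hK w (hw.trans (min_le_left _ _))
      rw [zeroCoord_lt_iff (hz.trans (min_le_right _ _)) (hw.trans (min_le_right _ _))] at hxy
      rw [hz'.2, hw'.2, zeroCoord_lt_iff (by omega) (by omega)]
      exact hm _ _ hxy
  · rw [eventually_shift_iff h0, eventually_zero_iff]
    refine ⟨⟨const false, const_eq false, ?_⟩, min K 0 - 1, fun z hz => ?_⟩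
    · rw [h0]; exact const_eq false
    · obtain ⟨w, rfl⟩ : ∃ w : ℤ × Lex Cantor, z = (w.1 - 1, w.2) :=
        ⟨(z.1 + 1, z.2), by simp⟩
      simp only at hz
      have hw := hK w (by omega)
      have hz' := hK (w.1 - 1, w.2) (by simp only; omega)
      refine ⟨zeroCoord w, zeroCoord_sub_one (by omega), ?_⟩
      rw [hz'.2, hw.2, shift_apply_sub hS, zeroCoord_sub_one (by omega)]

/-- The elements of `VA` that fix `000⋯` and have no other singular point. -/
def zeroGroup : Subgroup (Cantor ≃ₜ Cantor) where
  carrier := {f | IsVA f ∧ f (const false) = const false ∧ sing thompsonV f ⊆ {const false}}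
  one_mem' := ⟨VA.one_mem, rfl, by simp [sing_one]⟩
  mul_mem' := by
    rintro f g ⟨hf, hf0, hfs⟩ ⟨hg, hg0, hgs⟩
    refine ⟨VA.mul_mem hf hg, ?_, fun p hp => ?_⟩
    · change f (g _) = _
      rw [hg0, hf0]
    · rcases sing_mul hp with h | h
      · exact hgs h
      · exact g.injective ((hfs h).trans hg0.symm)
  inv_mem' := by
    rintro f ⟨hf, hf0, hfs⟩
    have h0 : f⁻¹ (const false) = const false := by
      conv_lhs => rw [← hf0]
      exact f.symm_apply_apply _
    exact ⟨VA.inv_mem hf, h0, fun p hp => (f⁻¹).injective ((hfs (sing_inv hp)).trans h0.symm)⟩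

/-- `f` is given by `φ` in the coordinate `zeroCoord` below the point `x`, and fixes all other
points. -/
structure IsCut (φ : Equiv.Perm (ℤ × Lex Cantor)) (x : ℤ × Lex Cantor) (f : Cantor → Cantor) :
    Prop where
  on : ∀ z, Line.LT z x → f (zeroCoord z) = zeroCoord (φ z)
  off : ∀ p, (∀ z, Line.LT z x → p ≠ zeroCoord z) → f p = p

theorem exists_isCut (φ : Equiv.Perm (ℤ × Lex Cantor)) {x : ℤ × Lex Cantor} (hx : x.1 ≤ -1) :
    ∃ f, IsCut φ x f := by
  classical
  refine ⟨fun p => if h : ∃ z, Line.LT z x ∧ p = zeroCoord z then zeroCoord (φ h.choose) else p,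
    fun z hz => ?_, fun p h => dif_neg fun ⟨z, hz, hp⟩ => h z hz hp⟩
  have hex : ∃ w, Line.LT w x ∧ zeroCoord z = zeroCoord w := ⟨z, hz, rfl⟩
  have hle : ∀ {w}, Line.LT w x → w.1 ≤ 0 := by
    rintro w (h | ⟨h, -⟩) <;> omega
  refine (dif_pos hex).trans ?_
  rw [← zeroCoord_inj (hle hz) (hle hex.choose_spec.1) hex.choose_spec.2]

section Cut

variable {φ : Equiv.Perm (ℤ × Lex Cantor)} {x : ℤ × Lex Cantor} {f : Cantor → Cantor}

theorem IsCut.lt_iff (hm : Line.Mono φ) (hx : φ x = x) {z : ℤ × Lex Cantor} :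
    Line.LT (φ z) x ↔ Line.LT z x := by
  conv_lhs => rw [← hx]
  exact hm.lt_iff

theorem IsCut.zero (hf : IsCut φ x f) : f (const false) = const false :=
  hf.off _ fun z _ => (zeroCoord_ne z).symm

theorem IsCut.left_inverse (hm : Line.Mono φ) (hx : φ x = x) {g : Cantor → Cantor}
    (hf : IsCut φ x f) (hg : IsCut φ⁻¹ x g) (p : Cantor) : g (f p) = p := by
  by_cases h : ∃ z, Line.LT z x ∧ p = zeroCoord z
  · obtain ⟨z, hz, rfl⟩ := h
    rw [hf.on z hz, hg.on _ ((IsCut.lt_iff hm hx).mpr hz)]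
    simp
  · push Not at h
    rw [hf.off p h, hg.off p h]

/-- Below `x` cells go to cells, which are cones in this coordinate. From `x` upwards the map is the
identity on an open set, because `x` is a left endpoint. -/
theorem IsCut.prefixReplacement (hf : IsCut φ x f) (hφ : Line.CellMap φ) (hxb : Line.IsBase x)
    (hx1 : x.1 ≤ -1) {p : Cantor} (hp : p ≠ const false) :
    ∃ α β : List Bool, ∀ᶠ q in 𝓝 p, ∃ ψ, q = cat α ψ ∧ f q = cat β ψ := by
  obtain ⟨z, hz, rfl⟩ := exists_zeroCoord_eq hp
  by_cases h : Line.LT z x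
  · obtain ⟨n, a, y, n', a', hy, hmap⟩ := hφ z
    obtain ⟨α, hα⟩ := exists_cat_of_cell (n := n) (a := a)
    obtain ⟨β, hβ⟩ := exists_cat_of_cell (n := n') (a := a')
    obtain ⟨k, w, -, -, hk⟩ := exists_word_of_cell n a
    refine ⟨α, β, ?_⟩
    have h1 := eventually_cat α (ofLex y)
    rw [← hα, ← hy] at h1
    filter_upwards [h1, eventually_lex_lt (zeroCoord_lt_of_lt (by omega) h)] with q ⟨ψ, hq⟩ hlt
    refine ⟨ψ, hq, ?_⟩
    have h2 := hα (toLex ψ)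
    change _ = cat α ψ at h2
    have hk0 : k ≤ 0 := by rw [hy, hk] at hz; exact hz
    rw [hq, ← h2, zeroCoord_lt_iff (by rw [hk]; exact hk0) (by omega)] at hlt
    rw [hq, ← h2, hf.on _ hlt, hmap, hβ]
    rfl
  · obtain ⟨n, a, hxa⟩ := hxb
    obtain ⟨β, hβ⟩ := exists_cat_of_cell (n := n) (a := a)
    have hxβ : zeroCoord x = cat β (const false) := by rw [hxa, hβ]; rfl
    have hle : toLex (cat β (const false)) ≤ toLex (zeroCoord z) := by
      rw [← hxβ]
      exact not_lt.mp fun hlt => h ((zeroCoord_lt_iff hz (by omega)).mp hlt)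
    refine ⟨[], [], ?_⟩
    filter_upwards [eventually_le_lex hle] with q hq
    refine ⟨q, rfl, hf.off q ?_⟩
    rintro w hw rfl
    rw [← hxβ] at hq
    exact absurd (zeroCoord_lt_of_lt (by omega) hw) hq.not_gt

theorem IsCut.continuous (hf : IsCut φ x f) (hm : Line.Mono φ) (hS : Commute φ (Line.shift _))
    (hφ : Line.CellMap φ) (hxb : Line.IsBase x) (hx1 : x.1 ≤ -1) : Continuous f := by
  refine continuous_iff_continuousAt.mpr fun p => ?_
  by_cases hp : p = const false
  -- At `000⋯` there may be no prefix replacement; continuity comes from `φ` preserving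
  -- neighbourhoods of `-∞`.
  · rw [hp, ContinuousAt, hf.zero]
    intro S hS'
    obtain ⟨h0, K, hK⟩ := eventually_zero_iff.mp hS'
    obtain ⟨L, hL⟩ := Line.exists_le_of_mono hm hS K
    refine eventually_zero_iff.mpr ⟨?_, min L (x.1 - 1), fun z hz => ?_⟩
    · rw [hf.zero]; exact h0
    · rw [hf.on z (Or.inl (by omega))]
      exact hK _ (hL z (by omega))
  · obtain ⟨α, β, h⟩ := hf.prefixReplacement hφ hxb hx1 hp
    exact continuousAt_of_prefix h

end Cut

theorem exists_mem_zeroGroup_of_fixed {φ : Equiv.Perm (ℤ × Lex Cantor)} {x : ℤ × Lex Cantor}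
    (hφ : Line.IsChange φ) (hx : Line.IsBase x) (hfx : φ x = x)
    (hx1 : x.1 ≤ -1) :
    ∃ f ∈ zeroGroup, Line.HasGerm zeroCoord f φ ∧
      ∀ p, f p ≠ p → ∃ z, Line.LT z x ∧ p = zeroCoord z := by
  have hφ' := hφ.inv
  obtain ⟨f, hf⟩ := exists_isCut φ hx1
  obtain ⟨g, hg⟩ := exists_isCut φ⁻¹ hx1
  have hfx' : φ⁻¹ x = x := by rw [Equiv.Perm.inv_eq_iff_eq, hfx]
  let F : Cantor ≃ₜ Cantor :=
    { toFun := f, invFun := g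
      left_inv := hf.left_inverse hφ.mono hfx hg
      right_inv := hg.left_inverse hφ'.mono hfx' (by rwa [inv_inv])
      continuous_toFun := hf.continuous hφ.mono hφ.commute hφ.cellMap hx hx1
      continuous_invFun := hg.continuous hφ'.mono hφ'.commute hφ'.cellMap hx hx1 }
  have hgerm : Line.HasGerm zeroCoord F φ := by
    obtain ⟨L, hL⟩ := Line.exists_le_of_mono hφ.mono hφ.commute (-1)
    exact ⟨min L (x.1 - 1), fun z hz => ⟨hL z (by omega), hf.on z (Or.inl (by omega))⟩⟩
  have hsing : sing thompsonV F ⊆ {const false} := by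
    intro p hp
    by_contra hp0
    exact notMem_sing_of_prefixReplacementAt (f := F) (p := p)
      (hf.prefixReplacement hφ.cellMap hx hx1 hp0) hp
  have h0 : F (const false) = const false := hf.zero
  obtain ⟨h1, h2⟩ := hgerm.isVA_zero hφ.mono hφ.commute h0
  refine ⟨F, ⟨⟨(Set.finite_singleton _).subset hsing, ?_, ?_, ?_⟩, h0, hsing⟩, hgerm, ?_⟩
  · intro p hp
    rw [hsing hp]
    exact ⟨[], false, rfl⟩
  · intro p hp
    rwa [hsing hp]
  · intro p hp
    rwa [hsing hp]
  · intro p hp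
    by_contra! h
    exact hp (hf.off p h)

end FiniteGerm

namespace FiniteGerm

/-! ### Germs at `000⋯` -/

/-- Mutually inverse maps that commute with the shift near `-∞` extend to the line. -/
theorem Line.exists_perm_extension {Y : Type*} [LinearOrder Y] {P R : ℤ × Y → ℤ × Y} {K : ℤ}
    (hP : ∀ z : ℤ × Y, z.1 ≤ K → P (z.1 - 1, z.2) = ((P z).1 - 1, (P z).2))
    (hR : ∀ z : ℤ × Y, z.1 ≤ K → R (z.1 - 1, z.2) = ((R z).1 - 1, (R z).2))
    (hPR : ∀ z : ℤ × Y, z.1 ≤ K → P (R z) = z) (hRP : ∀ z : ℤ × Y, z.1 ≤ K → R (P z) = z)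
    (hm : ∀ z w : ℤ × Y, z.1 ≤ K → w.1 ≤ K → Line.LT z w → Line.LT (P z) (P w)) :
    ∃ φ : Equiv.Perm (ℤ × Y), Line.Mono φ ∧ Commute φ (Line.shift Y) ∧
      ∀ z, z.1 ≤ K → φ z = P z := by
  have hpow : ∀ {P : ℤ × Y → ℤ × Y},
      (∀ z : ℤ × Y, z.1 ≤ K → P (z.1 - 1, z.2) = ((P z).1 - 1, (P z).2)) →
      ∀ (z : ℤ × Y) (n : ℕ), z.1 ≤ K → P (z.1 - n, z.2) = ((P z).1 - n, (P z).2) := by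
    intro P hP z n hz
    induction n with
    | zero => simp
    | succ n ih =>
      have := hP (z.1 - n, z.2) (by simp only; omega)
      rw [ih] at this
      simp only [sub_sub] at this
      rw [Nat.cast_succ, this]
  -- Shift down until the index is at most `K`, apply the map, and shift back; `hE` shows that the
  -- number of shifts does not matter.
  let E : (ℤ × Y → ℤ × Y) → ℤ × Y → ℤ × Y := fun P z =>
    ((P (z.1 - (z.1 - K).toNat, z.2)).1 + (z.1 - K).toNat, (P (z.1 - (z.1 - K).toNat, z.2)).2)
  have hE : ∀ {P : ℤ × Y → ℤ × Y},
      (∀ z : ℤ × Y, z.1 ≤ K → P (z.1 - 1, z.2) = ((P z).1 - 1, (P z).2)) →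
      ∀ (z : ℤ × Y) (n : ℕ), z.1 - n ≤ K →
        E P z = ((P (z.1 - n, z.2)).1 + n, (P (z.1 - n, z.2)).2) := by
    intro P hP z n hn
    obtain ⟨k, rfl⟩ : ∃ k, n = (z.1 - K).toNat + k := ⟨n - (z.1 - K).toNat, by omega⟩
    have h := hpow hP (z.1 - (z.1 - K).toNat, z.2) k (by simp only; omega)
    simp only [sub_sub] at h
    rw [Nat.cast_add, h]
    exact Prod.ext (by simp only [E]; ring) rfl
  have hinv : ∀ {P R : ℤ × Y → ℤ × Y},
      (∀ z : ℤ × Y, z.1 ≤ K → P (z.1 - 1, z.2) = ((P z).1 - 1, (P z).2)) →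
      (∀ z : ℤ × Y, z.1 ≤ K → R (z.1 - 1, z.2) = ((R z).1 - 1, (R z).2)) →
      (∀ z : ℤ × Y, z.1 ≤ K → P (R z) = z) → ∀ z, E P (E R z) = z := by
    intro P R hP hR h z
    set n : ℕ := (z.1 - K).toNat + ((E R z).1 - K).toNat with hn
    rw [hE hP _ n (by omega), hE hR z n (by omega)]
    simp only [add_sub_cancel_right, Prod.mk.eta]
    rw [h _ (by simp only; omega)]
    simp
  let φ : Equiv.Perm (ℤ × Y) := ⟨E P, E R, hinv hR hP hRP, hinv hP hR hPR⟩
  have hφ : ∀ z (n : ℕ), z.1 - n ≤ K → φ z = ((P (z.1 - n, z.2)).1 + n, (P (z.1 - n, z.2)).2) :=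
    hE hP
  refine ⟨φ, fun z w hzw => ?_, Equiv.ext fun z => ?_, fun z hz => ?_⟩
  · set n : ℕ := (z.1 - K).toNat + (w.1 - K).toNat with hn
    have h := hm (z.1 - n, z.2) (w.1 - n, w.2) (by simp only; omega) (by simp only; omega) (by
      rcases hzw with h | ⟨h, h'⟩
      · exact Or.inl (by simp only; omega)
      · exact Or.inr ⟨by simp only; omega, h'⟩)
    rw [hφ z n (by omega), hφ w n (by omega)]
    rcases h with h | ⟨h, h'⟩
    · exact Or.inl (by simp only; omega)
    · exact Or.inr ⟨by simp only; omega, h'⟩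
  · obtain ⟨k, y⟩ := z
    rw [Equiv.Perm.mul_apply, Equiv.Perm.mul_apply, Line.shift_apply,
      hφ (k + 1, y) ((k - K).toNat + 1) (by simp only; push_cast; omega),
      hφ (k, y) (k - K).toNat (by simp only; omega), Line.shift_apply]
    have : k + 1 - (((k - K).toNat + 1 : ℕ) : ℤ) = k - (k - K).toNat := by push_cast; ring
    simp only [this]
    push_cast
    rw [add_assoc]
  · have := hφ z 0 (by simpa using hz)
    simpa using this

/-- The map induced by `f` in the coordinate `zeroCoord`. -/
theorem exists_zeroCoord_map {f : Cantor ≃ₜ Cantor} (h0 : f (const false) = const false) :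
    ∃ P : ℤ × Lex Cantor → ℤ × Lex Cantor,
      ∀ z, z.1 ≤ 0 → (P z).1 ≤ 0 ∧ f (zeroCoord z) = zeroCoord (P z) := by
  have : ∀ z : ℤ × Lex Cantor, ∃ w : ℤ × Lex Cantor, z.1 ≤ 0 → w.1 ≤ 0 ∧
      f (zeroCoord z) = zeroCoord w := by
    intro z
    obtain ⟨w, hw, h⟩ := exists_zeroCoord_eq (p := f (zeroCoord z)) fun h =>
      zeroCoord_ne z (f.injective (h.trans h0.symm))
    exact ⟨w, fun _ => ⟨hw, h.symm⟩⟩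
  choose P hP using this
  exact ⟨P, hP⟩

theorem zeroCoord_map_sub {f : Cantor ≃ₜ Cantor} {P : ℤ × Lex Cantor → ℤ × Lex Cantor}
    (h0 : f (const false) = const false)
    (hP : ∀ z, z.1 ≤ 0 → (P z).1 ≤ 0 ∧ f (zeroCoord z) = zeroCoord (P z))
    (hf : CommutesWithShift f (const false)) : ∃ K : ℤ, ∀ z : ℤ × Lex Cantor, z.1 ≤ K →
      P (z.1 - 1, z.2) = ((P z).1 - 1, (P z).2) := by
  rw [eventually_shift_iff h0, eventually_zero_iff] at hf
  obtain ⟨-, K, hK⟩ := hf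
  refine ⟨min K 0, fun z hz => ?_⟩
  obtain ⟨ψ, h1, h2⟩ := hK (z.1 - 1, z.2) (by simp only; omega)
  rw [zeroCoord_sub_one (by omega), cat_inj] at h1
  obtain ⟨h3, h4⟩ := hP (z.1 - 1, z.2) (by simp only; omega)
  obtain ⟨h5, h6⟩ := hP z (by omega)
  rw [h4, ← h1, h6, ← zeroCoord_sub_one h5] at h2
  exact zeroCoord_inj h3 (by simp only; omega) h2

/-- The unit cell of index `K` is a compact cone free of singular points, so one depth works for all
of it. A single unit cell is enough, as the rest follows from equivariance. -/
theorem isCell_of_uniform {f : Cantor ≃ₜ Cantor} {P : ℤ × Lex Cantor → ℤ × Lex Cantor}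
    (hP : ∀ z, z.1 ≤ 0 → (P z).1 ≤ 0 ∧ f (zeroCoord z) = zeroCoord (P z)) {K : ℤ} (hK : K ≤ 0)
    (hf : ∀ z : ℤ × Lex Cantor, z.1 ≤ K → zeroCoord z ∉ sing thompsonV f) :
    ∃ M : ℕ, ∀ w : List Bool, M ≤ w.length →
      Line.IsCell fun y : Lex Cantor => P (K, toLex (cat w (ofLex y))) := by
  set u := List.replicate (-K).toNat false ++ [true] with hu
  have hz : ∀ ψ, cat u ψ = zeroCoord (K, toLex ψ) := fun ψ => cat_append _ _ _
  obtain ⟨M, hM⟩ := exists_uniform_depth (f := f)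
    (isCompact_range (continuous_cat u)) (by
      rintro _ ⟨ψ, rfl⟩
      refine prefixReplacementAt_of_notMem_sing ?_
      rw [hz]
      exact hf _ le_rfl)
  refine ⟨M, fun w hw => ?_⟩
  obtain ⟨b, hb⟩ := hM (u ++ w) (by simp; omega) ⟨const false, _, (cat_append _ _ _).symm⟩
  have hb' : ∀ ψ, zeroCoord (P (K, toLex (cat w ψ))) = cat b ψ := fun ψ => by
    rw [← hb, cat_append, hz, (hP _ hK).2]
  obtain ⟨n, a, h⟩ := exists_cell_of_cat (β := b) (by rw [← hb']; exact zeroCoord_ne _)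
  refine ⟨n, a, fun y => zeroCoord_inj (hP _ hK).1 (h y).1 ?_⟩
  rw [hb']
  exact (h (ofLex y)).2.symm

/-- Far enough towards `000⋯`, the maps induced by `f` and its inverse commute with the shift,
preserve the order and meet no singular point. Their equivariant extension carries small cells to
cells, so it is a change of labelled partition. -/
theorem exists_zeroGerm {f : Cantor ≃ₜ Cantor} (hf : IsVA f)
    (h0 : f (const false) = const false) :
    ∃ φ, Line.IsChange φ ∧ Line.HasGerm zeroCoord f φ := by
  have h0' : f⁻¹ (const false) = const false := by
    conv_lhs => rw [← h0]
    exact f.symm_apply_apply _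
  have hf' : IsVA f⁻¹ := VA.inv_mem hf
  have hend : EndsConst (const false) := ⟨[], false, rfl⟩
  obtain ⟨P, hP⟩ := exists_zeroCoord_map h0
  obtain ⟨R, hR⟩ := exists_zeroCoord_map h0'
  obtain ⟨K₁, hK₁⟩ := zeroCoord_map_sub h0 hP (hf.commutesWithShift hend)
  obtain ⟨K₂, hK₂⟩ := zeroCoord_map_sub h0' hR (hf'.commutesWithShift hend)
  obtain ⟨U, hU, hmono⟩ := hf.orderPreservingAt (const false)
  obtain ⟨-, K₃, hK₃⟩ := eventually_zero_iff.mp hU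
  have hs : ∀ᶠ x in 𝓝 (const false), x ∉ sing thompsonV f \ {const false} :=
    (hf.finite.subset Set.sdiff_subset).isClosed.isOpen_compl.mem_nhds (by simp)
  obtain ⟨-, K₄, hK₄⟩ := eventually_zero_iff.mp hs
  obtain ⟨K, hK0, hK1, hK2, hK3, hK4⟩ : ∃ K ≤ (0 : ℤ), K ≤ K₁ ∧ K ≤ K₂ ∧ K ≤ K₃ ∧ K ≤ K₄ :=
    ⟨min 0 (min (min K₁ K₂) (min K₃ K₄)), by omega, by omega, by omega, by omega, by omega⟩
  obtain ⟨φ, hm, hS, hφ⟩ := Line.exists_perm_extension (P := P) (R := R) (K := K)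
    (fun z hz => hK₁ z (hz.trans hK1)) (fun z hz => hK₂ z (hz.trans hK2))
    (fun z hz => by
      have h1 := hR z (hz.trans hK0)
      have h2 := hP _ h1.1
      refine zeroCoord_inj h2.1 (hz.trans hK0) ?_
      rw [← h2.2, ← h1.2]
      exact f.apply_symm_apply _)
    (fun z hz => by
      have h1 := hP z (hz.trans hK0)
      have h2 := hR _ h1.1
      refine zeroCoord_inj h2.1 (hz.trans hK0) ?_
      rw [← h2.2, ← h1.2]
      exact f.symm_apply_apply _)
    (fun z w hz hw hzw => by
      have h1 := hP z (hz.trans hK0)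
      have h2 := hP w (hw.trans hK0)
      rw [← zeroCoord_lt_iff h1.1 h2.1, ← h1.2, ← h2.2]
      exact hmono _ (hK₃ z (hz.trans hK3)) _ (hK₃ w (hw.trans hK3))
        (zeroCoord_lt_of_lt (hw.trans hK0) hzw))
  refine ⟨φ, ?_, ?_⟩
  · obtain ⟨M, hM⟩ := isCell_of_uniform hP hK0 fun z hz hzs =>
      hK₄ z (hz.trans hK4) ⟨hzs, zeroCoord_ne z⟩
    refine Line.IsChange.of_cells hm hS (N := M) fun k hk0 hk => ?_
    obtain ⟨l, w, hw, hl, hcell⟩ := exists_word_of_cell M k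
    obtain rfl := hl hk0 hk
    -- The cells to be checked lie in the unit cell of index 0, while `f` is controlled at index
    -- `K`; a power of the shift compares the two.
    have := (hM w hw.ge).shift_zpow (-K)
    convert this using 2 with y
    rw [hcell, ← hφ _ le_rfl, ← Equiv.Perm.mul_apply, ← (hS.zpow_right (-K)).eq,
      Equiv.Perm.mul_apply, Line.shift_zpow_apply]
    simp
  · obtain ⟨L, hL⟩ := Line.exists_le_of_mono hm hS (-1)
    refine ⟨min L K, fun z hz => ⟨hL z (by omega), ?_⟩⟩
    rw [(hP z (by omega)).2, hφ z (by omega)]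

theorem mem_thompsonV_of_sing_eq_empty {f : Cantor ≃ₜ Cantor} (h : sing thompsonV f = ∅) :
    f ∈ thompsonV := fun p =>
  prefixReplacementAt_of_notMem_sing (by rw [h]; exact Set.notMem_empty p)

/-- An element of `V` whose germ at `000⋯` is the shift. -/
theorem exists_shift : ∃ f : VA, f.1 ∈ thompsonV ∧ f.1 ∈ zeroGroup ∧
    Line.HasGerm zeroCoord f.1 (Line.shift (Lex Cantor)) := by
  have h1 : Incomp [true, false] [false] := fun ψ χ h => by
    simpa using (cat_cons_inj.mp h).1
  have h2 : Incomp [false, false] [true, false] := fun ψ χ h => by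
    simpa using (cat_cons_inj.mp h).1
  -- The composite acts by `00ψ ↦ 10ψ ↦ 0ψ`, which deletes a zero near `000⋯`.
  have hval : ∀ ψ, (swap [true, false] [false] * swap [false, false] [true, false]).1
      (cat [false, false] ψ) = cat [false] ψ := fun ψ =>
    (congrArg _ ((isSwap_swap h2).left ψ)).trans ((isSwap_swap h1).left ψ)
  have hV : (swap [true, false] [false] * swap [false, false] [true, false]).1 ∈ thompsonV :=
    thompsonV.mul_mem (swap_spec h1).2 (swap_spec h2).2
  refine ⟨_, hV, ⟨isVA_of_mem_thompsonV hV, ?_, ?_⟩, -2, fun z hz => ⟨?_, ?_⟩⟩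
  · have := hval (const false)
    rwa [← const_eq, show cat [false, false] (const false) = const false from
      (const_eq_replicate false 2).symm] at this
  · rw [sing_of_mem hV]
    exact Set.empty_subset _
  · rw [show Line.shift (Lex Cantor) z = (z.1 + 1, z.2) from rfl]
    simp only
    omega
  · obtain ⟨w, hw, rfl⟩ := exists_zeroCoord_of_le (n := 2) (by simpa using hz)
    rw [zeroCoord_sub hw]
    refine (hval _).trans ?_
    rw [← zeroCoord_sub_one hw, Line.shift_apply]
    congr 2
    push_cast
    ring

/-- Every germ at `000⋯` of an element of `VA` that fixes `000⋯` is the germ of an element of a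
given normal subgroup that has no other singular point. -/
theorem exists_mem_zeroGroup {N : Subgroup VA} [N.Normal] {m : ℕ}
    (hcomm : ∀ f g : VA, (∀ p ∉ Set.range (cat (List.replicate m false)), f.1 p = p) →
      (∀ p ∉ Set.range (cat (List.replicate m false)), g.1 p = p) → f * g * f⁻¹ * g⁻¹ ∈ N)
    {f : Cantor ≃ₜ Cantor} (hf : IsVA f) (h0 : f (const false) = const false) :
    ∃ k ∈ N, k.1 ∈ zeroGroup ∧ ∀ᶠ x in 𝓝 (const false), f x = k.1 x := by
  obtain ⟨φ, hφ, K, hK⟩ := exists_zeroGerm hf h0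
  have hV : ∀ {g : VA}, g.1 ∈ thompsonV → g ∈ N := mem_of_mem_thompsonV (swap_mem hcomm)
  obtain ⟨k, hk, hkN, L, hL⟩ : ∃ k : VA, k.1 ∈ zeroGroup ∧ k ∈ N ∧
      Line.HasGerm zeroCoord k.1 φ := by
    refine Line.exists_mem_of_isChange (K₀ := -m) ?_ ?_ ?_ ?_ hcomm hφ
    -- A trivial germ removes the only possible singular point, so `g` lies in `V` and hence in `N`.
    · rintro g ⟨-, hg0, hgs⟩ ⟨M, hM⟩
      refine hV (mem_thompsonV_of_sing_eq_empty ?_)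
      have : const false ∉ sing thompsonV g.1 :=
        notMem_sing_of_eventually_eq (eventually_zero_iff.mpr ⟨hg0, M, hM⟩)
      refine Set.eq_empty_of_forall_notMem fun p hp => this ?_
      rwa [← hgs hp]
    · obtain ⟨g, hg, hg0, hgs⟩ := exists_shift
      exact ⟨g, hg0, hV hg, hgs⟩
    · intro φ x hφ hx hfx hx1
      obtain ⟨g, hg, h⟩ := exists_mem_zeroGroup_of_fixed hφ hx hfx hx1
      exact ⟨⟨g, hg.1⟩, hg, h⟩
    · intro z hz
      obtain ⟨w, hw, rfl⟩ := exists_zeroCoord_of_le hz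
      rw [zeroCoord_sub hw]
      exact ⟨_, rfl⟩
  refine ⟨k, hkN, hk, eventually_zero_iff.mpr ⟨?_, min K L, fun z hz => ?_⟩⟩
  · rw [h0, hk.2.1]
  · rw [(hK z (hz.trans (min_le_left _ _))).2, (hL z (hz.trans (min_le_right _ _))).2]

end FiniteGerm

namespace FiniteGerm

/-! ### Simplicity of `VA` -/

theorem exists_thompsonV_apply_zero (α : List Bool) :
    ∃ r : VA, r.1 ∈ thompsonV ∧ r.1 (const false) = cat α (const false) := by
  by_cases h : List.replicate α.length false = α
  · refine ⟨1, thompsonV.one_mem, ?_⟩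
    rw [← h, ← const_eq_replicate]
    rfl
  · have hinc : Incomp (List.replicate α.length false) α := incomp_of_length_eq (by simp) h
    refine ⟨_, (swap_spec hinc).2, ?_⟩
    conv_lhs => rw [const_eq_replicate false α.length]
    exact (isSwap_swap hinc).left _

theorem exists_near_ne (α : List Bool) {S : Set Cantor} (hS : S ∈ 𝓝 (cat α (const false))) :
    ∃ x ∈ S, toLex (cat α (const false)) < toLex x := by
  have := (continuous_cat α).tendsto (const false) hS
  obtain ⟨-, K, hK⟩ := eventually_zero_iff.mp this
  exact ⟨_, hK (K, ⊥) le_rfl, toLex_cat_lt.mpr (lt_of_le_of_ne (bot_le_cantor _) fun h =>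
    zeroCoord_ne _ (toLex.injective h).symm)⟩

theorem le_const_true (ψ : Cantor) : ¬ toLex (const true) < toLex ψ := by
  rintro ⟨i, -, h⟩
  have h' : true < ψ i := h
  exact absurd (Bool.le_true (ψ i)) h'.not_ge

/-- Elements of `VA` map points that end in `000⋯` to such points. -/
theorem IsVA.exists_eq_cat_zero {f : Cantor ≃ₜ Cantor} (hf : IsVA f) (α : List Bool) :
    ∃ β, f (cat α (const false)) = cat β (const false) := by
  have hend : EndsConst (cat α (const false)) := ⟨α, false, rfl⟩
  obtain ⟨β, d, hβ⟩ := (hf.commutesWithShift hend).endsConst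
  cases d
  · exact ⟨β, hβ⟩
  · exfalso
    obtain ⟨U, hU, h⟩ := hf.orderPreservingAt (cat α (const false))
    -- There are points slightly above `α000⋯`, but no point of the cone of `β` lies above `β111⋯`,
    -- so the order could not be preserved.
    have h1 := eventually_cat β (const true)
    rw [← hβ] at h1
    obtain ⟨x, ⟨hx, χ, hχ⟩, hlt⟩ :=
      exists_near_ne α (inter_mem hU ((tendsto_homeo f _).eventually h1))
    have h2 := h _ (mem_of_mem_nhds hU) x hx hlt
    rw [hβ, hχ, toLex_cat_lt] at h2
    exact le_const_true χ h2

/-- A nontrivial normal subgroup contains the commutators of elements with small support. -/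
theorem exists_commutator_mem {N : Subgroup VA} [hN : N.Normal] (h : N ≠ ⊥) : ∃ m : ℕ, ∀ f g : VA,
    (∀ p ∉ Set.range (cat (List.replicate m false)), f.1 p = p) →
      (∀ p ∉ Set.range (cat (List.replicate m false)), g.1 p = p) → f * g * f⁻¹ * g⁻¹ ∈ N := by
  obtain ⟨⟨f, hf⟩, hf1⟩ := Subgroup.ne_bot_iff_exists_ne_one.mp h
  replace hf1 : f ≠ 1 := fun h => hf1 (Subtype.ext h)
  obtain ⟨p, hp⟩ : ∃ p, f.1 p ≠ p := by
    by_contra! hcon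
    exact hf1 (Subtype.ext (Homeomorph.ext hcon))
  obtain ⟨n, hn⟩ := exists_of_mem_nhds
    ((isOpen_ne_fun f.1.continuous continuous_id).mem_nhds (show p ∈ {x | f.1 x ≠ id x} from hp))
  -- A whole cone around `p` consists of points that are moved, so its point ending in `000⋯` is
  -- moved too; that one can be brought to `000⋯` inside `V`.
  obtain ⟨α, ψ, hα, rfl⟩ := exists_eq_cat_of_length n p
  have hα0 : f.1 (cat α (const false)) ≠ cat α (const false) :=
    hn _ fun i hi => cat_apply_lt (hα ▸ hi)
  obtain ⟨r, -, hr⟩ := exists_thompsonV_apply_zero α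
  have hg := hN.conj_mem f hf r⁻¹
  rw [inv_inv] at hg
  have hg0 : (r⁻¹ * f * r).1 (const false) ≠ const false := by
    intro he
    apply hα0
    have : r.1.symm (f.1 (r.1 (const false))) = const false := he
    rwa [Homeomorph.symm_apply_eq, hr] at this
  generalize r⁻¹ * f * r = g at hg hg0
  obtain ⟨u, v, hu, hv, hgu, h0v, huv⟩ := t2_separation hg0
  obtain ⟨m, hm⟩ := eventually_const_iff.mp
    (((tendsto_homeo g.1 _).eventually (hu.mem_nhds hgu)).and (hv.mem_nhds h0v))
  refine ⟨m, Line.commutator_mem hg ?_⟩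
  rintro _ ⟨ψ, rfl⟩ ⟨χ, hχ⟩
  refine Set.disjoint_left.mp huv (hm ψ).1 ?_
  rw [← hχ]
  exact (hm χ).2

/-- A singular point ending in `000⋯` can be removed by a factor in a given normal subgroup. -/
theorem exists_ncard_lt_zero {N : Subgroup VA} [hN : N.Normal] (h : N ≠ ⊥) {f : VA} {α : List Bool}
    (hp : cat α (const false) ∈ sing thompsonV f.1) :
    ∃ k ∈ N, (sing thompsonV (f * k).1).ncard < (sing thompsonV f.1).ncard := by
  obtain ⟨m, hcomm⟩ := exists_commutator_mem h
  obtain ⟨β, hβ⟩ := f.2.exists_eq_cat_zero α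
  obtain ⟨r, hrV, hr⟩ := exists_thompsonV_apply_zero α
  obtain ⟨s, hsV, hs⟩ := exists_thompsonV_apply_zero β
  have hg0 : (s⁻¹ * f * r).1 (const false) = const false := by
    change s.1.symm (f.1 (r.1 (const false))) = const false
    rw [Homeomorph.symm_apply_eq, hr, hs, hβ]
  obtain ⟨k, hkN, hk, hev⟩ := exists_mem_zeroGroup hcomm (s⁻¹ * f * r).2 hg0
  have hk' := zeroGroup.inv_mem hk
  -- Near the singular point, `f` equals `s * k * r⁻¹`, so multiplying by `r * k⁻¹ * r⁻¹` on the
  -- right leaves `s * r⁻¹`, an element of `V`.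
  set l : VA := r * k⁻¹ * r⁻¹ with hl
  have hlN : l ∈ N := hN.conj_mem _ (N.inv_mem hkN) r
  have hl_apply : ∀ y, l.1 (r.1 y) = r.1 (k.1⁻¹ y) := fun y =>
    congrArg (fun z => r.1 (k.1⁻¹ z)) (r.1.symm_apply_apply y)
  have hl0 : l.1 (cat α (const false)) = cat α (const false) := by
    rw [← hr, hl_apply, hk'.2.1]
  have hls : ∀ q ∈ sing thompsonV l.1, q = cat α (const false) := by
    intro q hq
    rcases sing_mul (f := (r * k⁻¹).1) (g := r.1⁻¹) hq with h | h
    · rw [sing_of_mem (thompsonV.inv_mem hrV)] at h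
      exact absurd h (Set.notMem_empty _)
    · rcases sing_mul (f := r.1) (g := k.1⁻¹) h with h | h
      · have : r.1.symm q = const false := hk'.2.2 h
        rw [Homeomorph.symm_apply_eq, hr] at this
        exact this
      · rw [sing_of_mem hrV] at h
        exact absurd h (Set.notMem_empty _)
  have hnot : cat α (const false) ∉ sing thompsonV (f * l).1 := by
    refine notMem_sing.mpr ⟨s.1 * r.1⁻¹, thompsonV.mul_mem hsV (thompsonV.inv_mem hrV), ?_⟩
    have hlim := (tendsto_homeo k.1⁻¹ _).comp (tendsto_homeo r.1⁻¹ (cat α (const false)))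
    rw [show r.1⁻¹ (cat α (const false)) = const false from
      (Homeomorph.symm_apply_eq _).mpr hr.symm, hk'.2.1] at hlim
    filter_upwards [hlim.eventually hev] with x hx
    obtain ⟨y, rfl⟩ := r.1.surjective x
    have e1 : r.1⁻¹ (r.1 y) = y := r.1.symm_apply_apply y
    have e2 : k.1 (k.1⁻¹ y) = y := k.1.apply_symm_apply y
    simp only [Function.comp_apply, e1, e2] at hx
    change f.1 (l.1 (r.1 y)) = s.1 (r.1⁻¹ (r.1 y))
    rw [hl_apply, e1]
    exact (Homeomorph.symm_apply_eq s.1).mp hx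
  refine ⟨l, hlN, ?_⟩
  -- The map `l` embeds the remaining singular points into those of `f` and misses the one removed.
  have hfac : ∀ q ∈ sing thompsonV (f * l).1, l.1 q ∈ sing thompsonV f.1 ∧
      l.1 q ≠ cat α (const false) := by
    intro q hq
    have hne : q ≠ cat α (const false) := fun he => hnot (he ▸ hq)
    refine ⟨?_, fun he => hne (l.1.injective (he.trans hl0.symm))⟩
    rcases sing_mul (f := f.1) (g := l.1) hq with h | h
    · exact absurd (hls q h) hne
    · exact h
  rw [← Set.ncard_image_of_injective _ l.1.injective]
  refine Set.ncard_lt_ncard ?_ f.2.finite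
  rw [Set.ssubset_iff_of_subset (by rintro _ ⟨q, hq, rfl⟩; exact (hfac q hq).1)]
  refine ⟨_, hp, ?_⟩
  rintro ⟨q, hq, h⟩
  exact (hfac q hq).2 h

/-! ### Exchanging the letters -/

/-- The homeomorphism of the Cantor set that exchanges the letters `0` and `1`. -/
def flip : Cantor ≃ₜ Cantor where
  toFun x i := !x i
  invFun x i := !x i
  left_inv x := funext fun i => Bool.not_not (x i)
  right_inv x := funext fun i => Bool.not_not (x i)
  continuous_toFun := continuous_pi fun i =>
    (continuous_of_discreteTopology (f := not)).comp (continuous_apply i)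
  continuous_invFun := continuous_pi fun i =>
    (continuous_of_discreteTopology (f := not)).comp (continuous_apply i)

theorem flip_flip (x : Cantor) : flip (flip x) = x := flip.left_inv x

theorem flip_cat (α : List Bool) (ψ : Cantor) : flip (cat α ψ) = cat (α.map not) (flip ψ) := by
  induction α with
  | nil => rfl
  | cons a α ih =>
    funext i
    cases i with
    | zero => rfl
    | succ i => exact congrFun ih i

theorem flip_const (c : Bool) : flip (const c) = const !c := rfl

theorem flip_lt {x y : Cantor} : toLex (flip x) < toLex (flip y) ↔ toLex y < toLex x := by
  have key : ∀ {x y : Cantor}, toLex y < toLex x → toLex (flip x) < toLex (flip y) := by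
    rintro x y ⟨i, h1, h2⟩
    refine ⟨i, fun j hj => congrArg not (h1 j hj).symm, ?_⟩
    have h2' : y i < x i := h2
    change (!x i) < !y i
    revert h2'
    cases x i <;> cases y i <;> decide
  refine ⟨fun h => ?_, key⟩
  have := key h
  rwa [flip_flip, flip_flip] at this

theorem conj_flip_apply (f : Cantor ≃ₜ Cantor) (x : Cantor) :
    (flip * f * flip⁻¹) x = flip (f (flip x)) := rfl

theorem PrefixReplacementAt.flip {f : Cantor ≃ₜ Cantor} {p : Cantor}
    (h : PrefixReplacementAt f (flip p)) : PrefixReplacementAt (flip * f * flip⁻¹) p := by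
  obtain ⟨α, β, h⟩ := h
  refine ⟨α.map not, β.map not, ?_⟩
  filter_upwards [(tendsto_homeo FiniteGerm.flip p).eventually h] with x ⟨ψ, h1, h2⟩
  refine ⟨FiniteGerm.flip ψ, ?_, ?_⟩
  · rw [← flip_cat, ← h1, flip_flip]
  · rw [conj_flip_apply, h2, flip_cat]

theorem flip_mem_sing {f : Cantor ≃ₜ Cantor} {p : Cantor}
    (h : p ∈ sing thompsonV (flip * f * flip⁻¹)) : flip p ∈ sing thompsonV f := by
  by_contra hn
  exact notMem_sing_of_prefixReplacementAt (prefixReplacementAt_of_notMem_sing hn).flip h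

/-- Exchanging the letters reverses the lexicographic order, but conjugation reverses it twice. -/
theorem IsVA.flip {f : Cantor ≃ₜ Cantor} (hf : IsVA f) : IsVA (flip * f * flip⁻¹) := by
  constructor
  · exact (hf.finite.preimage FiniteGerm.flip.injective.injOn).subset fun p hp => flip_mem_sing hp
  · intro p hp
    obtain ⟨α, c, h⟩ := hf.endsConst _ (flip_mem_sing hp)
    exact ⟨α.map not, !c, by rw [← flip_const, ← flip_cat, ← h, flip_flip]⟩
  · intro p hp
    obtain ⟨U, hU, h⟩ := hf.orderPreserving _ (flip_mem_sing hp)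
    refine ⟨_, tendsto_homeo FiniteGerm.flip p hU, fun x hx y hy hxy => ?_⟩
    rw [conj_flip_apply, conj_flip_apply, flip_lt]
    exact h _ hy _ hx (flip_lt.mpr hxy)
  · intro p hp
    obtain ⟨α, β, c, d, h1, h2, h3⟩ := hf.commutes _ (flip_mem_sing hp)
    refine ⟨α.map not, β.map not, !c, !d, ?_, ?_, ?_⟩
    · rw [← flip_const, ← flip_cat, ← h1, flip_flip]
    · rw [conj_flip_apply, h2, flip_cat, flip_const]
    · filter_upwards [(tendsto_homeo FiniteGerm.flip p).eventually h3] with x ⟨ψ, χ, h4, h5, h6⟩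
      have hmap : ∀ (α : List Bool) (c : Bool), α.map not ++ [!c] = (α ++ [c]).map not := by simp
      refine ⟨FiniteGerm.flip ψ, FiniteGerm.flip χ, ?_, ?_, ?_⟩
      · rw [hmap, ← flip_cat, ← h4, flip_flip]
      · rw [conj_flip_apply, h5, hmap, flip_cat]
      · rw [← flip_cat, ← flip_cat, conj_flip_apply, flip_flip, h6]

/-- Conjugation by the exchange of the letters, as an endomorphism of `VA`. -/
def flipVA : VA →* VA where
  toFun f := ⟨flip * f.1 * flip⁻¹, f.2.flip⟩
  map_one' := Subtype.ext (by simp)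
  map_mul' f g := Subtype.ext (by simp [mul_assoc])

theorem flipVA_flipVA (f : VA) : flipVA (flipVA f) = f :=
  Subtype.ext (Homeomorph.ext fun x => by
    change flip (flip (f.1 (flip (flip x)))) = f.1 x
    rw [flip_flip, flip_flip])

theorem ncard_sing_flipVA (f : VA) :
    (sing thompsonV (flipVA f).1).ncard = (sing thompsonV f.1).ncard := by
  have key : ∀ f : VA, (sing thompsonV (flipVA f).1).ncard ≤ (sing thompsonV f.1).ncard := by
    intro f
    rw [← Set.ncard_image_of_injective _ flip.injective]
    refine Set.ncard_le_ncard ?_ f.2.finite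
    rintro _ ⟨p, hp, rfl⟩
    exact flip_mem_sing hp
  refine le_antisymm (key f) ?_
  conv_lhs => rw [← flipVA_flipVA f]
  exact key _

/-- Points ending in `111⋯` are treated by exchanging the letters, which replaces `N` by its
preimage under `flipVA` and keeps the number of singular points. -/
theorem exists_ncard_lt {N : Subgroup VA} [N.Normal] (h : N ≠ ⊥) {f : VA}
    (hf : (sing thompsonV f.1).Nonempty) :
    ∃ k ∈ N, (sing thompsonV (f * k).1).ncard < (sing thompsonV f.1).ncard := by
  obtain ⟨p, hp⟩ := hf
  obtain ⟨α, c, rfl⟩ := f.2.endsConst p hp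
  cases c
  · exact exists_ncard_lt_zero h hp
  · have hN : N.comap flipVA ≠ ⊥ := by
      intro hbot
      apply h
      rw [eq_bot_iff] at hbot ⊢
      intro g hg
      have h1 : flipVA g ∈ N.comap flipVA := by
        rwa [Subgroup.mem_comap, flipVA_flipVA]
      have h2 := hbot h1
      rw [Subgroup.mem_bot] at h2 ⊢
      rw [← flipVA_flipVA g, h2, map_one]
    have hp' : cat (α.map not) (const false) ∈ sing thompsonV (flipVA f).1 := by
      have h1 : flip (cat (α.map not) (const false)) = cat α (const true) := by
        rw [flip_cat, flip_const]
        simp [Function.comp_def]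
      by_contra hn
      refine notMem_sing_of_prefixReplacementAt
        (PrefixReplacementAt.flip (f := (flipVA f).1) (p := cat α (const true)) ?_)
        (show cat α (const true) ∈ sing thompsonV (flipVA (flipVA f)).1 by rwa [flipVA_flipVA])
      rw [← h1, flip_flip]
      exact prefixReplacementAt_of_notMem_sing hn
    obtain ⟨k, hk, hlt⟩ := exists_ncard_lt_zero hN hp'
    refine ⟨flipVA k, hk, ?_⟩
    have e : f * flipVA k = flipVA (flipVA f * k) := by rw [map_mul, flipVA_flipVA]
    rwa [e, ncard_sing_flipVA, ← ncard_sing_flipVA f]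

theorem isSimpleGroup_VA : IsSimpleGroup VA := by
  have hinc : Incomp [false] [true] := incomp_of_length_eq rfl (by simp)
  have hnt : Nontrivial VA := by
    refine ⟨swap [false] [true], 1, fun h => ?_⟩
    have h1 := (isSwap_swap hinc).left (const false)
    rw [h] at h1
    exact absurd (congrFun h1 0) (by simp [cat])
  refine { hnt with eq_bot_or_eq_top_of_normal := fun N hN => ?_ }
  by_cases h : N = ⊥
  · exact Or.inl h
  right
  obtain ⟨m, hcomm⟩ := exists_commutator_mem h
  rw [eq_top_iff]
  rintro f -
  induction hn : (sing thompsonV f.1).ncard using Nat.strong_induction_on generalizing f with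
  | _ n ih =>
  rcases (sing thompsonV f.1).eq_empty_or_nonempty with h0 | h0
  · exact mem_of_mem_thompsonV (swap_mem hcomm) (mem_thompsonV_of_sing_eq_empty h0)
  · obtain ⟨k, hk, hlt⟩ := exists_ncard_lt h h0
    exact (N.mul_mem_cancel_right hk).mp (ih _ (hn ▸ hlt) rfl)

end FiniteGerm

theorem mainTheorem8 : IsSimpleGroup FiniteGerm.TA ∧ IsSimpleGroup FiniteGerm.VA := by
  exact ⟨FiniteGerm.isSimpleGroup_TA, FiniteGerm.isSimpleGroup_VA⟩
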